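/- Let $\mathcal O\subset\mathbb R^d$ be a bounded connected open set, and for $x\in\mathbb R^d$ let $$\nu(x)=\{\nu\in\mathbb S^{d-1}:\ \exists C>0\ \forall x'\in\bar{\mathcal O},\ (x'-x)\cdot\nu+C|x-x'|^2\ge 0\}.$$ Assume that $\mathcal O$ is admissible, that is: 1. $\nu(x)\ne\emptyset$ for every $x\in\partial\mathcal O$, and there is $C_0\ge 0$ such that $(x'-x)\cdot\nu+C_0|x-x'|^2\ge 0$ for all $x'\in\mathcal O$, $x\in\partial\mathcal O$, $\nu\in\nu(x)$; 2. there are $\phi\in C^2(\mathbb R^d;\mathbb R)$ and $\alpha>0$ with $\nabla\phi(x)\cdot\nu\ge\alpha$ for all $x\in\partial\mathcal O$, $\nu\in\nu(x)$; 3. there are $n\ge1$, $\lambda>0$, $R>0$, unit vectors $a_1,\dots,a_n$ and points $x_1,\dots,x_n\in\partial\mathcal O$ with $\partial\mathcal O\subseteq\bigcup_i B(x_i,R)$ and $\nu\cdot a_i\ge\lambda$ whenever $x\in\partial\mathcal O\cap B(x_i,2R)$ and $\nu\in\nu(x)$. Let $\sigma:\bar{\mathcal O}\to\mathrm{Hom}(\mathbb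 R^r;\mathbb R^d)$ be Lipschitz continuous and of class $C^2$ on $\bar{\mathcal O}$, let $b:\bar{\mathcal O}\to\mathbb R^d$ be Lipschitz continuous, and let $x_0\in\bar{\mathcal O}$. Let $\mathbb W$ be the standard Wiener measure on $C([0,\infty);\mathbb R^r)$. For $N\ge0$ and a Wiener path $W$, let $W^N$ be the path that agrees with $W$ at each $m2^{-N}$, $m\in\mathbb N$, and is linear on each $[m2^{-N},(m+1)2^{-N}]$. Let $(X^N,L^N)$ be the (pathwise) solution of the reflected ordinary differential equation $$X^N_t=x_0+\int_0^t\sigma(X^N_s)\,dW^N_s+\int_0^t b(X^N_s)\,ds+L^N_t,\qquad t\ge0,$$ where $X^N$ is continuous with values in $\bar{\mathcal O}$ and $L^N$ is continuous and of locally bounded variation; here, with $|L^N|_t$ the total variation of $L^N$ on $[0,t]$, the measure $d|L^N|$ is carried by $\{s: X^N_s\in\partial\mathcal O\}$, and $dL^N_s/d|L^N|_s\in\nu(X^N_s)$ for $d|L^N|$-almost every $s$. Let $\mathbb P^N$ be the distribution of $(X^N,L^N,W^N)$ under $\mathbb W$, a Borel probability measure on the pathspace $C([0,\infty);\bar{\mathcal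 O})\times C([0,\infty);\mathbb R^d)\times C([0,\infty);\mathbb R^r)$. Write $(X,L,W)$ for the canonical process on this space and $(\mathcal B_t)_{t\ge0}$ for the filtration that it generates. Let $V_i$ be the $i$th column of $\sigma$ for $1\le i\le r$, and $V_0=b$. On $\bar{\mathcal O}\times\mathbb R^r$ put $\tilde V_i(x,y)=(V_i(x),e_i)$ for $1\le i\le r$, with $e_1,\dots,e_r$ the standard basis of $\mathbb R^r$, and $\tilde V_0(x,y)=(V_0(x),0)$. Let $D_V$ denote the directional derivative along a vector field $V$, with $D_V^2=D_VD_V$, and let $(T_\xi h)(x,y)=h(x-\xi,y)$ for $\xi\in\mathbb R^d$. Let $C^2_{\rm b}$ denote the $C^2$ functions that are bounded together with their derivatives of order at most two. Let $\mathbb P$ be any weak limit point of the sequence $(\mathbb P^N)_{N\ge0}$ (the weak limit of a subsequence). Then: (a) for every $h\in C^2_{\rm b}(\mathbb R^d\times\mathbb R^r;\mathbb R)$, the process $$h(X_t-L_t,W_t)-\int_0^t\Big(\tfrac12\sum_{i=1}^r\big[D_{\tilde V_i}^2T_{L_s}h\big](X_s,W_s)+\big[D_{\tilde V_0}T_{L_s}h\big](X_s,W_s)\Big)ds$$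 is a $\mathbb P$-martingale relative to $(\mathcal B_t)_{t\ge0}$; (b) for every $f\in C^2_{\rm b}(\mathbb R^d;\mathbb R)$ such that $\frac{\partial f}{\partial\nu}(x)=\nabla f(x)\cdot\nu\ge0$ for every $x\in\partial\mathcal O$ and $\nu\in\nu(x)$, the process $$f(X_t)-f(x_0)-\int_0^t\Big(\tfrac12\sum_{i=1}^rD_{V_i}^2f(X_s)+D_{V_0}f(X_s)\Big)ds$$ is a $\mathbb P$-submartingale relative to $(\mathcal B_t)_{t\ge0}$. -/

import Mathlib

open MeasureTheory ProbabilityTheory Set Filter Topology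
open scoped NNReal ENNReal

namespace WongZakai

/-! ### Path spaces -/

/-- The space `C([0,∞); Y)` (topology of locally uniform convergence) with its Borel field. -/
instance pathMeasurableSpace (Y : Type*) [TopologicalSpace Y] : MeasurableSpace C(ℝ≥0, Y) :=
  borel _

instance pathBorelSpace (Y : Type*) [TopologicalSpace Y] : BorelSpace C(ℝ≥0, Y) := ⟨rfl⟩

/-- The `(X, L, W)`-pathspace
`C([0,∞); closure O) × C([0,∞); ℝᵈ) × C([0,∞); ℝʳ)`. -/
abbrev PathSpace {d : ℕ} (r : ℕ) (O : Set (EuclideanSpace ℝ (Fin d))) : Type :=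
  C(ℝ≥0, closure O) × C(ℝ≥0, EuclideanSpace ℝ (Fin d)) × C(ℝ≥0, EuclideanSpace ℝ (Fin r))

lemma stronglyMeasurable_eval {d r : ℕ} (O : Set (EuclideanSpace ℝ (Fin d))) (t : ℝ≥0) :
    StronglyMeasurable (fun ω : PathSpace r O => (ω.1 t, ω.2.1 t, ω.2.2 t)) := by
  apply Measurable.stronglyMeasurable
  have h1 : Measurable (fun w : C(ℝ≥0, closure O) => w t) :=
    (continuous_eval_const t).measurable
  have h2 : Measurable (fun w : C(ℝ≥0, EuclideanSpace ℝ (Fin d)) => w t) :=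
    (continuous_eval_const t).measurable
  have h3 : Measurable (fun w : C(ℝ≥0, EuclideanSpace ℝ (Fin r)) => w t) :=
    (continuous_eval_const t).measurable
  exact (h1.comp measurable_fst).prodMk
    ((h2.comp (measurable_fst.comp measurable_snd)).prodMk
      (h3.comp (measurable_snd.comp measurable_snd)))

/-- The filtration `(𝓑_t)` generated by the paths `(X, L, W)`. -/
noncomputable def pathFiltration {d : ℕ} (r : ℕ) (O : Set (EuclideanSpace ℝ (Fin d))) :
    Filtration ℝ≥0 (inferInstance : MeasurableSpace (PathSpace r O)) :=
  Filtration.natural (fun t ω => (ω.1 t, ω.2.1 t, ω.2.2 t)) (stronglyMeasurable_eval O)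

/-- The probability measure `𝕎` is the standard `r`-dimensional Wiener measure: the coordinates of the canonical process are
independent standard one-dimensional Brownian motions started at `0`. -/
structure IsWienerMeasure {r : ℕ} (𝕎 : Measure C(ℝ≥0, EuclideanSpace ℝ (Fin r))) : Prop where
  isBrownianReal : ∀ i : Fin r, IsBrownianReal (fun t w => w t i) 𝕎
  iIndepFun : iIndepFun (fun (i : Fin r) w (t : ℝ≥0) => w t i) 𝕎

/-! ### Dyadic polygonal approximation -/

lemma continuous_interpolate {F : Type*} [NormedAddCommGroup F] [NormedSpace ℝ F] (a : ℕ → F) :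
    Continuous (fun u : ℝ≥0 => a ⌊u⌋₊ + ((u : ℝ) - ⌊u⌋₊) • (a (⌊u⌋₊ + 1) - a ⌊u⌋₊)) := by
  have hlf : LocallyFinite (fun n : ℕ => Icc (n : ℝ≥0) (n + 1)) := by
    intro u
    refine ⟨Iio (u + 1), Iio_mem_nhds (by simp), ?_⟩
    refine (finite_Iic ⌊u + 1⌋₊).subset ?_
    rintro n ⟨v, hv, hv'⟩
    exact Nat.le_floor (hv.1.trans (le_of_lt hv'))
  refine hlf.continuous (iUnion_eq_univ_iff.2 fun u =>
    ⟨⌊u⌋₊, Nat.floor_le (zero_le), (Nat.lt_floor_add_one u).le⟩) (fun n => isClosed_Icc) ?_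
  intro n
  have hc : Continuous (fun u : ℝ≥0 => a n + ((u : ℝ) - n) • (a (n + 1) - a n)) := by fun_prop
  refine hc.continuousOn.congr fun u hu => ?_
  rcases hu.2.eq_or_lt with h | h
  · have hf : ⌊u⌋₊ = n + 1 := by
      rw [h]; exact_mod_cast Nat.floor_natCast (R := ℝ≥0) (n + 1)
    have hu' : (u : ℝ) = n + 1 := by rw [h]; simp
    simp only [hf, hu']
    simp
  · have hf : ⌊u⌋₊ = n := by
      rw [Nat.floor_eq_iff (zero_le)]; exact ⟨hu.1, h⟩
    simp only [hf]

/-- The `N`-dyadic linear polygonalization of `w`: it agrees with `w` at each `m 2⁻ᴺ` and is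
linear on each `[m 2⁻ᴺ, (m+1) 2⁻ᴺ]`. -/
noncomputable def polygonal {F : Type*} [NormedAddCommGroup F] [NormedSpace ℝ F] (N : ℕ)
    (w : C(ℝ≥0, F)) : C(ℝ≥0, F) where
  toFun t := w (⌊2 ^ N * t⌋₊ / 2 ^ N) + (((2 ^ N * t : ℝ≥0) : ℝ) - ⌊2 ^ N * t⌋₊) •
    (w ((⌊2 ^ N * t⌋₊ + 1 : ℕ) / 2 ^ N) - w (⌊2 ^ N * t⌋₊ / 2 ^ N))
  continuous_toFun := by
    have h := continuous_interpolate (fun m : ℕ => w ((m : ℝ≥0) / 2 ^ N))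
    exact h.comp (continuous_const.mul continuous_id : Continuous fun t : ℝ≥0 => 2 ^ N * t)

/-! ### Domains -/

/-- The inward pointing proximal unit normals `ν(x)` of `O` at `x`. -/
def inwardNormals {d : ℕ} (O : Set (EuclideanSpace ℝ (Fin d))) (x : EuclideanSpace ℝ (Fin d)) :
    Set (EuclideanSpace ℝ (Fin d)) :=
  {n | ‖n‖ = 1 ∧ ∃ C : ℝ, 0 < C ∧ ∀ x' ∈ closure O, 0 ≤ inner ℝ (x' - x) n + C * ‖x - x'‖ ^ 2}

/-- Admissible domains (in the sense of Lions and Sznitman). -/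
structure IsAdmissible {d : ℕ} (O : Set (EuclideanSpace ℝ (Fin d))) : Prop where
  isOpen : IsOpen O
  isConnected : IsConnected O
  normals_nonempty : ∀ x ∈ frontier O, (inwardNormals O x).Nonempty
  uniform_exterior_ball : ∃ C₀ : ℝ, 0 ≤ C₀ ∧ ∀ x' ∈ O, ∀ x ∈ frontier O, ∀ n ∈ inwardNormals O x,
    0 ≤ inner ℝ (x' - x) n + C₀ * ‖x - x'‖ ^ 2
  exists_function : ∃ (φ : EuclideanSpace ℝ (Fin d) → ℝ) (α : ℝ), ContDiff ℝ 2 φ ∧ 0 < α ∧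
    ∀ x ∈ frontier O, ∀ n ∈ inwardNormals O x, α ≤ fderiv ℝ φ x n
  exists_cover : ∃ (k : ℕ) (lam R : ℝ) (a y : Fin k → EuclideanSpace ℝ (Fin d)),
    1 ≤ k ∧ 0 < lam ∧ 0 < R ∧ (∀ i, ‖a i‖ = 1) ∧ (∀ i, y i ∈ frontier O) ∧
    frontier O ⊆ ⋃ i, Metric.ball (y i) R ∧
    ∀ i, ∀ x ∈ frontier O ∩ Metric.ball (y i) (2 * R), ∀ n ∈ inwardNormals O x,
      lam ≤ inner ℝ n (a i)

/-! ### Reflected ordinary differential equations -/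

/-- `ℓ` has locally bounded variation, its variation measure `d|ℓ|` (the measure `m` below, which
is determined by `m [0,t] = |ℓ|_t`) is carried by the times at which `x` is in the boundary, and
`ℓ_t = ∫₀ᵗ n d|ℓ|` with a density `n = dℓ/d|ℓ|` that lies in `ν(x)` almost everywhere. -/
def IsReflectionTerm {d : ℕ} (O : Set (EuclideanSpace ℝ (Fin d)))
    (x ℓ : ℝ≥0 → EuclideanSpace ℝ (Fin d)) : Prop :=
  (∀ t, eVariationOn ℓ (Iic t) ≠ ∞) ∧
  ∃ (m : Measure ℝ≥0) (n : ℝ≥0 → EuclideanSpace ℝ (Fin d)),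
    (∀ t, m (Iic t) = eVariationOn ℓ (Iic t)) ∧ Measurable n ∧
    (∀ᵐ s ∂m, x s ∈ frontier O) ∧ (∀ᵐ s ∂m, n s ∈ inwardNormals O (x s)) ∧
    ∀ t, ℓ t = ∫ s in Iic t, n s ∂m

/-- `(x, ℓ)` solves `dx = σ(x) dw + b(x) dt + dℓ`, `x_0 = x₀`, reflected at the boundary of `O`, for
a piecewise smooth input `w` (so that `dw_s = ẇ_s ds`). -/
structure IsReflectedSolution {d r : ℕ} (O : Set (EuclideanSpace ℝ (Fin d)))
    (σ : EuclideanSpace ℝ (Fin d) → EuclideanSpace ℝ (Fin r) →L[ℝ] EuclideanSpace ℝ (Fin d))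
    (b : EuclideanSpace ℝ (Fin d) → EuclideanSpace ℝ (Fin d)) (x₀ : EuclideanSpace ℝ (Fin d))
    (w : C(ℝ≥0, EuclideanSpace ℝ (Fin r))) (x : C(ℝ≥0, closure O))
    (ℓ : C(ℝ≥0, EuclideanSpace ℝ (Fin d))) : Prop where
  equation : ∀ t : ℝ≥0, (x t : EuclideanSpace ℝ (Fin d)) = x₀ +
    (∫ s in (0 : ℝ)..t, σ (x s.toNNReal) (deriv (fun u : ℝ => w u.toNNReal) s)) +
    (∫ s in (0 : ℝ)..t, b (x s.toNNReal)) + ℓ t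
  reflection : IsReflectionTerm O (fun t => (x t : EuclideanSpace ℝ (Fin d))) ℓ

/-- The distribution under `𝕎` of the triple `(X, L, W^N)`, where `W^N` is the `N`-dyadic
polygonalization of the canonical path. -/
noncomputable def approxLaw {d r : ℕ} {O : Set (EuclideanSpace ℝ (Fin d))}
    (𝕎 : Measure C(ℝ≥0, EuclideanSpace ℝ (Fin r))) [IsFiniteMeasure 𝕎] (N : ℕ)
    (X : C(ℝ≥0, EuclideanSpace ℝ (Fin r)) → C(ℝ≥0, closure O))
    (L : C(ℝ≥0, EuclideanSpace ℝ (Fin r)) → C(ℝ≥0, EuclideanSpace ℝ (Fin d))) :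
    FiniteMeasure (PathSpace r O) :=
  ⟨𝕎.map (fun w => (X w, L w, polygonal N w)), inferInstance⟩

/-- `P` is a limit point, for weak convergence, of the sequence `μ`. -/
def IsWeakLimitPoint {S : Type*} [MeasurableSpace S] [TopologicalSpace S] [OpensMeasurableSpace S]
    (μ : ℕ → FiniteMeasure S) (P : ProbabilityMeasure S) : Prop :=
  ∃ k : ℕ → ℕ, StrictMono k ∧ Tendsto (fun j => μ (k j)) atTop (𝓝 P.toFiniteMeasure)

/-! ### Differential operators -/

/-- `C²_b`: the function and its derivatives up to order two are continuous and bounded. -/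
def IsC2b {E : Type*} [NormedAddCommGroup E] [NormedSpace ℝ E] (f : E → ℝ) : Prop :=
  ContDiff ℝ 2 f ∧ ∀ k : ℕ, k ≤ 2 → ∃ C : ℝ, ∀ x, ‖iteratedFDeriv ℝ k f x‖ ≤ C

/-- The directional derivative operator `D_V` of a vector field `V` given on the set `S`. -/
noncomputable def dirDeriv {E : Type*} [NormedAddCommGroup E] [NormedSpace ℝ E] (S : Set E)
    (V : E → E) (f : E → ℝ) : E → ℝ :=
  fun x => fderivWithin ℝ f S x (V x)

/-- The translation `(T_ξ h)(x, y) = h(x - ξ, y)`. -/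
def translate {E F : Type*} [Sub E] (ξ : E) (h : E × F → ℝ) : E × F → ℝ :=
  fun p => h (p.1 - ξ, p.2)

/-- The column `V_i = σ e_i`. -/
noncomputable def column {d r : ℕ}
    (σ : EuclideanSpace ℝ (Fin d) → EuclideanSpace ℝ (Fin r) →L[ℝ] EuclideanSpace ℝ (Fin d))
    (i : Fin r) : EuclideanSpace ℝ (Fin d) → EuclideanSpace ℝ (Fin d) :=
  fun x => σ x (EuclideanSpace.single i 1)

/-- The vector field `(V_i, e_i)` on `closure O × ℝʳ`. -/
noncomputable def columnTilde {d r : ℕ}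
    (σ : EuclideanSpace ℝ (Fin d) → EuclideanSpace ℝ (Fin r) →L[ℝ] EuclideanSpace ℝ (Fin d))
    (i : Fin r) : EuclideanSpace ℝ (Fin d) × EuclideanSpace ℝ (Fin r) →
      EuclideanSpace ℝ (Fin d) × EuclideanSpace ℝ (Fin r) :=
  fun p => (column σ i p.1, EuclideanSpace.single i 1)

/-- The vector field `(V_0, 0)` on `closure O × ℝʳ`, where `V_0 = b`. -/
def driftTilde {d r : ℕ} (b : EuclideanSpace ℝ (Fin d) → EuclideanSpace ℝ (Fin d)) :
    EuclideanSpace ℝ (Fin d) × EuclideanSpace ℝ (Fin r) →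
      EuclideanSpace ℝ (Fin d) × EuclideanSpace ℝ (Fin r) :=
  fun p => (b p.1, 0)

/-- The operator `½ ∑ᵢ D_{V_i}² + D_{V_0}` on functions on `closure O`. -/
noncomputable def gen {d r : ℕ} (O : Set (EuclideanSpace ℝ (Fin d)))
    (σ : EuclideanSpace ℝ (Fin d) → EuclideanSpace ℝ (Fin r) →L[ℝ] EuclideanSpace ℝ (Fin d))
    (b : EuclideanSpace ℝ (Fin d) → EuclideanSpace ℝ (Fin d))
    (f : EuclideanSpace ℝ (Fin d) → ℝ) : EuclideanSpace ℝ (Fin d) → ℝ :=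
  fun x => (1 / 2 : ℝ) * ∑ i, dirDeriv (closure O) (column σ i)
      (dirDeriv (closure O) (column σ i) f) x + dirDeriv (closure O) b f x

/-- The operator `½ ∑ᵢ D_{Ṽ_i}² + D_{Ṽ_0}` on functions on `closure O × ℝʳ`, where
`Ṽ_i = (V_i, e_i)` and `Ṽ_0 = (V_0, 0)`. -/
noncomputable def genTilde {d r : ℕ} (O : Set (EuclideanSpace ℝ (Fin d)))
    (σ : EuclideanSpace ℝ (Fin d) → EuclideanSpace ℝ (Fin r) →L[ℝ] EuclideanSpace ℝ (Fin d))
    (b : EuclideanSpace ℝ (Fin d) → EuclideanSpace ℝ (Fin d))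
    (h : EuclideanSpace ℝ (Fin d) × EuclideanSpace ℝ (Fin r) → ℝ) :
    EuclideanSpace ℝ (Fin d) × EuclideanSpace ℝ (Fin r) → ℝ :=
  fun p => (1 / 2 : ℝ) * ∑ i, dirDeriv (closure O ×ˢ univ) (columnTilde σ i)
      (dirDeriv (closure O ×ˢ univ) (columnTilde σ i) h) p +
    dirDeriv (closure O ×ˢ univ) (driftTilde b) h p

end WongZakai

/-! The path is studied through the lift Z = (X, X - L, W). The last two components are driven by dW
and dt alone, so the reflection dL pushes only the first one. Everything follows from
`submartingale_lift`: if the derivative of H in the direction (n, 0) is nonnegative for every inward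
normal n at the boundary, then H(Z) minus its integrated Stratonovich generator `liftGen` is a
submartingale under every limit law. For (a), H depends on (X - L, W) only, the boundary derivative
vanishes, and both H and -H qualify; for (b), H(z) = f(z.1).

On a dyadic interval of length τ the polygonal path is affine with increment Δ. Two applications of
the chain rule (`one_step_expansion`) bound the increment of H(Z) minus the integrated generator
from below by a term linear in Δ, plus half of A(Δ, Δ) - τ tr A, minus errors, with coefficients
frozen at the left endpoint. By uniqueness for the reflected equation these coefficients depend only
on the past of the Wiener path, so both main terms have mean zero, even after multiplication by a
bounded functional of the past.

The delicate error is |Δ| q, with q the variation of L over the interval: both factors are of order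
√τ, so the product is not small compared with τ. Young's inequality gives |Δ| q ≤ δ q + |Δ|² q /
(4δ). The second term is of third order by a crude pathwise bound on q. For the first, the
admissibility function φ gives `exists_variation_affine`: up to a factor, q is at most the increment
of φ(X), minus a term linear in Δ, plus O(|Δ|² + τ). The increments telescope into a corrector of
size ε, the linear part is centred, and the rest is small with δ. `exists_step_bound` collects this,
and `exists_expectation_bound` sums over the steps.

The a priori bounds rest on `IsAdmissible.exists_stability`, in the manner of Lions and Sznitman: a
weighted squared distance between two reflected paths that reflection can only decrease. Comparing
two solutions gives uniqueness; comparing a solution with a point at rest bounds its oscillation by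
the drift. Since σ is differentiated only within the closed domain, two further facts are needed: a
chain rule within arbitrary sets (`chain_rule`) and an interior cone condition, which makes such
derivatives unique (`uniqueDiffOn_closure`).

The inequality, tested against continuous functionals of the stopped trajectory, passes to the weak
limit. It is then extended from dyadic to all times, from cut-off functions to C²_b, and from
continuous functionals to the events of the filtration. -/

namespace WongZakai

/-! ### Chain rule along paths driven by several atomless measures. -/

section ChainRule

variable {E F ι : Type*} [NormedAddCommGroup E] [NormedSpace ℝ E] [NormedAddCommGroup F]
  [NormedSpace ℝ F]

lemma integrableOn_clm_apply {a b : ℝ} {μ : Measure ℝ} {A : ℝ → E →L[ℝ] F} {q : ℝ → E}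
    (hA : ContinuousOn A (Icc a b)) (hq : IntegrableOn q (Icc a b) μ) :
    IntegrableOn (fun s => A s (q s)) (Icc a b) μ := by
  obtain ⟨C, hC⟩ := isCompact_Icc.exists_bound_of_continuousOn hA
  refine Integrable.mono' (hq.norm.const_mul C) ?_ ?_
  · exact (ContinuousLinearMap.id ℝ (E →L[ℝ] F)).aestronglyMeasurable_comp₂
      (hA.aestronglyMeasurable measurableSet_Icc) hq.aestronglyMeasurable
  · filter_upwards [ae_restrict_mem measurableSet_Icc] with s hs
    exact (A s).le_of_opNorm_le (hC s hs) (q s)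

/-- A continuous function whose increments are locally dominated, to the right of every point, by
those of a monotone function is globally dominated by it. -/
lemma norm_sub_le_of_forall_right {a b : ℝ} (hab : a ≤ b) {Φ : ℝ → F} {V : ℝ → ℝ}
    (hΦ : ContinuousOn Φ (Icc a b)) (hV : ContinuousOn V (Icc a b))
    (h : ∀ x ∈ Ico a b, ∀ᶠ y in 𝓝[>] x, ‖Φ y - Φ x‖ ≤ V y - V x) :
    ‖Φ b - Φ a‖ ≤ V b - V a := by
  have key : Icc a b ⊆ {t | ‖Φ t - Φ a‖ ≤ V t - V a} := by
    refine IsClosed.Icc_subset_of_forall_exists_gt ?_ (by simp) ?_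
    · have h1 : ContinuousOn (fun t => ‖Φ t - Φ a‖) (Icc a b) :=
        (hΦ.sub continuousOn_const).norm
      have := (isClosed_Icc (a := a) (b := b)).isClosed_le h1 (hV.sub (continuousOn_const (c := V a)))
      convert this using 1
      ext t
      simp [and_comm]
    · rintro x ⟨hx, hxI⟩ y hy
      have hy' : Ioc x y ∈ 𝓝[>] x := Ioc_mem_nhdsGT hy
      obtain ⟨z, hz, hzy⟩ := ((h x hxI).and hy').exists
      refine ⟨z, ?_, hzy⟩
      simp only [mem_ofPred_eq] at hx ⊢
      calc ‖Φ z - Φ a‖ = ‖(Φ z - Φ x) + (Φ x - Φ a)‖ := by congr 1; abel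
        _ ≤ _ := norm_add_le _ _
        _ ≤ _ := by linarith
  exact key (right_mem_Icc.2 hab)

variable [Fintype ι]

lemma sum_setIntegral_Ioc_split {a b : ℝ} {μ : ι → Measure ℝ} {g : ι → ℝ → E}
    (hg : ∀ i, IntegrableOn (g i) (Icc a b) (μ i)) {x y : ℝ} (hx : a ≤ x) (hxy : x ≤ y)
    (hy : y ≤ b) : ∑ i, ∫ s in Ioc a y, g i s ∂μ i =
      ∑ i, ∫ s in Ioc a x, g i s ∂μ i + ∑ i, ∫ s in Ioc x y, g i s ∂μ i := by
  rw [← Finset.sum_add_distrib]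
  refine Finset.sum_congr rfl fun i _ => ?_
  rw [← Ioc_union_Ioc_eq_Ioc hx hxy, setIntegral_union (Ioc_disjoint_Ioc_of_le le_rfl)
    measurableSet_Ioc]
  · exact (hg i).mono_set fun s hs => ⟨hs.1.le, hs.2.trans (hxy.trans hy)⟩
  · exact (hg i).mono_set fun s hs => ⟨hx.trans hs.1.le, hs.2.trans hy⟩

/-- The chain rule for a continuous path driven by finitely many atomless measures and a function
that is differentiable within a set containing the path. -/
theorem chain_rule {a b : ℝ} (hab : a ≤ b) {Z : ℝ → E} (hZ : ContinuousOn Z (Icc a b)) {S : Set E}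
    (hS : ∀ t ∈ Icc a b, Z t ∈ S) {f : E → F} {f' : E → E →L[ℝ] F}
    (hf : ∀ z ∈ S, HasFDerivWithinAt f (f' z) S z) (hf' : ContinuousOn f' S)
    [CompleteSpace E] [CompleteSpace F]
    {μ : ι → Measure ℝ} [∀ i, NullSingletonClass (μ i)] {q : ι → ℝ → E}
    (hq : ∀ i, IntegrableOn (q i) (Icc a b) (μ i))
    (hZq : ∀ t ∈ Icc a b, Z t = Z a + ∑ i, ∫ s in Ioc a t, q i s ∂μ i) :
    f (Z b) - f (Z a) = ∑ i, ∫ s in Ioc a b, f' (Z s) (q i s) ∂μ i := by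
  have hfZ : ContinuousOn (fun s => f' (Z s)) (Icc a b) := hf'.comp hZ hS
  have hint : ∀ i, IntegrableOn (fun s => f' (Z s) (q i s)) (Icc a b) (μ i) :=
    fun i => integrableOn_clm_apply hfZ (hq i)
  have hfc : ContinuousOn (fun t => f (Z t)) (Icc a b) :=
    ContinuousOn.comp (fun z hz => (hf z hz).continuousWithinAt) hZ hS
  -- `Φ` is the defect of the formula and `V` the accumulated size of the driving terms. The
  -- increments of `Φ` to the right of each point are at most `ε` times those of `V`, so `Φ` is
  -- constant. Differentiability is used only between points of the path itself, hence `S` need not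
  -- be convex.
  set Φ : ℝ → F := fun t => f (Z t) - ∑ i, ∫ s in Ioc a t, f' (Z s) (q i s) ∂μ i with hΦ
  set V : ℝ → ℝ := fun t => ∑ i, ∫ s in Ioc a t, ‖q i s‖ ∂μ i with hVdef
  have hΦc : ContinuousOn Φ (Icc a b) := hfc.sub
    (continuousOn_finsetSum _ fun i _ => intervalIntegral.continuousOn_primitive (hint i))
  have hVc : ContinuousOn V (Icc a b) :=
    continuousOn_finsetSum _ fun i _ => intervalIntegral.continuousOn_primitive (hq i).norm
  have key : ∀ ε > 0, ‖Φ b - Φ a‖ ≤ ε * V b := by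
    intro ε hε
    have h0 : V a = 0 := by simp [hVdef]
    have := norm_sub_le_of_forall_right hab hΦc (V := fun t => ε * V t)
      (continuousOn_const.mul hVc) ?_
    · simpa [h0] using this
    intro x hx
    have hxI : x ∈ Icc a b := Ico_subset_Icc_self hx
    have hsub : 𝓝[>] x ≤ 𝓝[Icc a b] x := by
      refine nhdsWithin_le_of_mem ?_
      filter_upwards [Ioc_mem_nhdsGT hx.2] with y hy
      exact ⟨hx.1.trans hy.1.le, hy.2⟩
    have e1 : ∀ᶠ y in 𝓝[>] x, ‖f (Z y) - f (Z x) - f' (Z x) (Z y - Z x)‖ ≤ ε / 2 * ‖Z y - Z x‖ := by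
      have h1 := (hf (Z x) (hS x hxI)).isLittleO.def (half_pos hε)
      have h2 : Tendsto Z (𝓝[>] x) (𝓝[S] (Z x)) := by
        refine tendsto_nhdsWithin_iff.2 ⟨(hZ x hxI).tendsto.mono_left hsub, ?_⟩
        filter_upwards [hsub self_mem_nhdsWithin] with y hy using hS y hy
      exact h2.eventually h1
    have e2 : ∀ᶠ y in 𝓝[>] x, ∀ u ∈ Ioc x y, ‖f' (Z u) - f' (Z x)‖ ≤ ε / 2 := by
      have h1 : ∀ᶠ u in 𝓝[>] x, ‖f' (Z u) - f' (Z x)‖ ≤ ε / 2 := by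
        have := (hfZ x hxI).tendsto.mono_left hsub
        have := (tendsto_iff_norm_sub_tendsto_zero.1 this).eventually (gt_mem_nhds (half_pos hε))
        filter_upwards [this] with u hu using hu.le
      obtain ⟨c, hc, hcs⟩ := (mem_nhdsGT_iff_exists_Ioc_subset).1 h1
      filter_upwards [Ioc_mem_nhdsGT hc] with y hy u hu
      exact hcs ⟨hu.1, hu.2.trans hy.2⟩
    filter_upwards [e1, e2, Ioc_mem_nhdsGT hx.2] with y h1 h2 hy
    have hxy : x ≤ y := hy.1.le
    have hIs : ∀ i, IntegrableOn (q i) (Ioc x y) (μ i) := fun i =>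
      (hq i).mono_set fun s hs => ⟨hx.1.trans hs.1.le, hs.2.trans hy.2⟩
    have hIf : ∀ i, IntegrableOn (fun s => f' (Z s) (q i s)) (Ioc x y) (μ i) := fun i =>
      (hint i).mono_set fun s hs => ⟨hx.1.trans hs.1.le, hs.2.trans hy.2⟩
    have hyI : y ∈ Icc a b := ⟨hx.1.trans hxy, hy.2⟩
    have hZxy : Z y - Z x = ∑ i, ∫ s in Ioc x y, q i s ∂μ i := by
      rw [hZq y hyI, hZq x hxI, sum_setIntegral_Ioc_split hq hx.1 hxy hy.2]; abel
    have hVxy : V y - V x = ∑ i, ∫ s in Ioc x y, ‖q i s‖ ∂μ i := by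
      simp only [hVdef]; rw [sum_setIntegral_Ioc_split (fun i => (hq i).norm) hx.1 hxy hy.2]; abel
    have hΦxy : Φ y - Φ x = (f (Z y) - f (Z x) - f' (Z x) (Z y - Z x)) -
        ∑ i, ∫ s in Ioc x y, (f' (Z s) - f' (Z x)) (q i s) ∂μ i := by
      have : ∑ i, ∫ s in Ioc x y, (f' (Z s) - f' (Z x)) (q i s) ∂μ i =
          ∑ i, ∫ s in Ioc x y, f' (Z s) (q i s) ∂μ i - f' (Z x) (Z y - Z x) := by
        rw [hZxy, map_sum, ← Finset.sum_sub_distrib]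
        refine Finset.sum_congr rfl fun i _ => ?_
        rw [← ContinuousLinearMap.integral_comp_comm _ (hIs i), ← integral_sub (hIf i)]
        · simp
        · exact (f' (Z x)).integrable_comp (hIs i)
      rw [this]
      simp only [hΦ]
      rw [sum_setIntegral_Ioc_split hint hx.1 hxy hy.2]
      abel
    have hnZ : ‖Z y - Z x‖ ≤ V y - V x := by
      rw [hZxy, hVxy]
      exact (norm_sum_le _ _).trans (Finset.sum_le_sum fun i _ => norm_integral_le_integral_norm _)
    have hr : ‖∑ i, ∫ s in Ioc x y, (f' (Z s) - f' (Z x)) (q i s) ∂μ i‖ ≤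
        ε / 2 * (V y - V x) := by
      rw [hVxy, Finset.mul_sum]
      refine (norm_sum_le _ _).trans (Finset.sum_le_sum fun i _ => ?_)
      rw [← integral_const_mul]
      refine norm_integral_le_of_norm_le ((hIs i).norm.const_mul _) ?_
      filter_upwards [ae_restrict_mem measurableSet_Ioc] with s hs
      exact ContinuousLinearMap.le_of_opNorm_le _ (h2 s hs) _
    rw [hΦxy]
    calc _ ≤ _ := norm_sub_le _ _
      _ ≤ ε / 2 * ‖Z y - Z x‖ + ε / 2 * (V y - V x) := add_le_add h1 hr
      _ ≤ ε / 2 * (V y - V x) + ε / 2 * (V y - V x) := by gcongr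
      _ = _ := by ring
  have hzero : ‖Φ b - Φ a‖ ≤ 0 := by
    have h0 : 0 ≤ V b := Finset.sum_nonneg fun i _ => integral_nonneg fun _ => norm_nonneg _
    refine le_of_forall_pos_le_add fun ε hε => ?_
    calc _ ≤ ε / (V b + 1) * V b := key _ (by positivity)
      _ = ε * (V b / (V b + 1)) := by ring
      _ ≤ ε * 1 := by gcongr; rw [div_le_one (by positivity)]; linarith
      _ = _ := by ring
  have := sub_eq_zero.1 (norm_le_zero_iff.1 hzero)
  simp only [hΦ, Ioc_self, Measure.restrict_empty, integral_zero_measure, Finset.sum_const_zero,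
    sub_zero] at this
  rw [← this]; abel

end ChainRule

end WongZakai

namespace WongZakai

/-! ### Geometry of the closed domain: nearest points, interior cone, unique differentiability. -/

section Domain

variable {d : ℕ} {O : Set (EuclideanSpace ℝ (Fin d))}

local notation "𝔼" => EuclideanSpace ℝ (Fin d)

/-- The direction from an outer point to a nearest point of the closure is an inward normal. -/
lemma smul_sub_mem_inwardNormals {y p : 𝔼} (hy : y ∉ closure O) (hp : p ∈ closure O)
    (hmin : ∀ x' ∈ closure O, ‖p - y‖ ≤ ‖x' - y‖) :
    ‖p - y‖⁻¹ • (p - y) ∈ inwardNormals O p := by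
  have hne : p - y ≠ 0 := by
    intro h
    rw [sub_eq_zero] at h
    exact hy (h ▸ hp)
  have hpos : 0 < ‖p - y‖ := norm_pos_iff.2 hne
  refine ⟨norm_smul_inv_norm hne, ‖p - y‖⁻¹ / 2, by positivity, fun x' hx' => ?_⟩
  have h1 := hmin x' hx'
  have h2 : ‖x' - y‖ ^ 2 = ‖x' - p‖ ^ 2 + 2 * inner ℝ (x' - p) (p - y) + ‖p - y‖ ^ 2 := by
    rw [← norm_add_sq_real]; congr 2; abel
  have h3 : ‖p - y‖ ^ 2 ≤ ‖x' - y‖ ^ 2 := by gcongr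
  rw [inner_smul_right, norm_sub_rev p x']
  have : ‖p - y‖⁻¹ * inner ℝ (x' - p) (p - y) + ‖p - y‖⁻¹ / 2 * ‖x' - p‖ ^ 2 =
    ‖p - y‖⁻¹ / 2 * (2 * inner ℝ (x' - p) (p - y) + ‖x' - p‖ ^ 2) := by ring
  rw [this]
  exact mul_nonneg (by positivity) (by linarith)

/-- A nearest point inside the open set could be moved a little towards `y`, which would shorten the
distance. -/
lemma nearest_mem_frontier (hO : IsOpen O) {y p : 𝔼} (hy : y ∉ closure O) (hp : p ∈ closure O)
    (hmin : ∀ x' ∈ closure O, ‖p - y‖ ≤ ‖x' - y‖) : p ∈ frontier O := by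
  rw [hO.frontier_eq]
  refine ⟨hp, fun hpO => ?_⟩
  have hne : p - y ≠ 0 := by
    intro h
    rw [sub_eq_zero] at h
    exact hy (h ▸ hp)
  have hpos : 0 < ‖p - y‖ := norm_pos_iff.2 hne
  have hc : Tendsto (fun s : ℝ => p - s • (p - y)) (𝓝[>] 0) (𝓝 p) := by
    have : Continuous (fun s : ℝ => p - s • (p - y)) := by fun_prop
    simpa using (this.tendsto 0).mono_left nhdsWithin_le_nhds
  have h1 := hc.eventually (hO.mem_nhds hpO)
  obtain ⟨s, hs, hs0⟩ := (h1.and (Ioc_mem_nhdsGT (zero_lt_one' ℝ))).exists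
  have h2 := hmin _ (subset_closure hs)
  have h3 : p - s • (p - y) - y = (1 - s) • (p - y) := by module
  rw [h3, norm_smul, Real.norm_of_nonneg (by linarith [hs0.2])] at h2
  nlinarith [hs0.1]

/-- If all inward normals at boundary points near `x` make a nonnegative angle with `v`, the
closed domain contains the points `x + t v` for small `t`. -/
lemma add_smul_mem_closure (hO : IsOpen O) {x v : 𝔼} {ρ : ℝ} (hx : x ∈ closure O)
    (hv : ∀ p ∈ frontier O, ‖p - x‖ < ρ → ∀ n ∈ inwardNormals O p, 0 ≤ inner ℝ n v)
    {t : ℝ} (ht : 0 ≤ t) (htρ : 2 * (t * ‖v‖) < ρ) : x + t • v ∈ closure O := by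
  have hne : (closure O).Nonempty := ⟨x, hx⟩
  set D : ℝ → ℝ := fun s => Metric.infDist (x + s • v) (closure O) with hD
  -- The cross term in the expanded square has a favourable sign: the vector to the nearest point is
  -- a multiple of an inward normal, which makes a nonnegative product with `v`. Summed over `n`
  -- steps of length `t / n` this gives `D t ^ 2 ≤ t ^ 2 * ‖v‖ ^ 2 / n`, so `D t` vanishes.
  have step : ∀ s h, 0 ≤ s → s ≤ t → 0 ≤ h → D (s + h) ^ 2 ≤ D s ^ 2 + h ^ 2 * ‖v‖ ^ 2 := by
    intro s h hs hst hh
    obtain ⟨p, hp, hpd⟩ := isClosed_closure.exists_infDist_eq_dist hne (x + s • v)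
    have hle : D (s + h) ≤ ‖(x + s • v - p) + h • v‖ := by
      refine (Metric.infDist_le_dist_of_mem hp).trans (le_of_eq ?_)
      rw [dist_eq_norm]; congr 1; module
    have hle2 : D (s + h) ^ 2 ≤ ‖(x + s • v - p) + h • v‖ ^ 2 :=
      pow_le_pow_left₀ Metric.infDist_nonneg hle 2
    have hpy : D s = ‖p - (x + s • v)‖ := by rw [hD, ← dist_eq_norm, dist_comm]; exact hpd
    have hmin : ∀ x' ∈ closure O, ‖p - (x + s • v)‖ ≤ ‖x' - (x + s • v)‖ := by
      intro x' hx'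
      rw [← hpy, ← dist_eq_norm, dist_comm]
      exact Metric.infDist_le_dist_of_mem hx'
    have hinner : 0 ≤ inner ℝ (p - (x + s • v)) v := by
      by_cases hy : x + s • v ∈ closure O
      · have h0 : ‖p - (x + s • v)‖ = 0 := by
          rw [← hpy]; exact Metric.infDist_zero_of_mem hy
        rw [norm_eq_zero.1 h0, inner_zero_left]
      · have hpos : 0 < ‖p - (x + s • v)‖ := by
          refine norm_pos_iff.2 fun h => hy ?_
          rw [← sub_eq_zero.1 h]; exact hp
        have h1 := hv p (nearest_mem_frontier hO hy hp hmin) ?_ _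
          (smul_sub_mem_inwardNormals hy hp hmin)
        · rw [real_inner_smul_left] at h1
          exact nonneg_of_mul_nonneg_right h1 (inv_pos.2 hpos)
        · have h2 : ‖p - (x + s • v)‖ ≤ s * ‖v‖ := by
            refine (hmin x hx).trans (le_of_eq ?_)
            rw [sub_add_cancel_left, norm_neg, norm_smul, Real.norm_of_nonneg hs]
          calc ‖p - x‖ = ‖(p - (x + s • v)) + s • v‖ := by congr 1; abel
            _ ≤ _ := norm_add_le _ _
            _ ≤ s * ‖v‖ + s * ‖v‖ := by
              rw [norm_smul, Real.norm_of_nonneg hs]; gcongr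
            _ ≤ 2 * (t * ‖v‖) := by nlinarith [norm_nonneg v]
            _ < ρ := htρ
    refine hle2.trans ?_
    rw [norm_add_sq_real, hpy, norm_sub_rev, norm_smul, mul_pow, Real.norm_of_nonneg hh,
      inner_smul_right]
    have : inner ℝ (x + s • v - p) v = - inner ℝ (p - (x + s • v)) v := by
      rw [← inner_neg_left, neg_sub]
    rw [this]
    nlinarith
  have hD0 : D 0 = 0 := by simpa [hD] using Metric.infDist_zero_of_mem hx
  have hind : ∀ n : ℕ, ∀ h, 0 ≤ h → n * h ≤ t → D (n * h) ^ 2 ≤ n * (h ^ 2 * ‖v‖ ^ 2) := by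
    intro n h hh
    induction n with
    | zero => intro _; simp [hD0]
    | succ n ih =>
      intro hn
      push_cast at hn ⊢
      have h1 := step (n * h) h (by positivity) (by linarith) hh
      have h2 := ih (by linarith)
      rw [add_mul, one_mul]
      linarith
  have hbd : ∀ n : ℕ, D t ^ 2 ≤ t ^ 2 * ‖v‖ ^ 2 * (1 / ((n : ℝ) + 1)) := by
    intro n
    have hn : ((n + 1 : ℕ) : ℝ) * (t / (n + 1 : ℕ)) = t := by
      field_simp
    have := hind (n + 1) (t / (n + 1 : ℕ)) (by positivity) hn.le
    rw [hn] at this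
    refine this.trans (le_of_eq ?_)
    push_cast
    field_simp
  have hlim : D t ^ 2 ≤ 0 := by
    refine ge_of_tendsto' (x := atTop) (f := fun n : ℕ => t ^ 2 * ‖v‖ ^ 2 * (1 / ((n : ℝ) + 1))) ?_ hbd
    simpa using tendsto_one_div_add_atTop_nhds_zero_nat.const_mul (t ^ 2 * ‖v‖ ^ 2)
  have hDt : D t = 0 := by simpa using le_antisymm hlim (sq_nonneg _)
  exact (isClosed_closure.mem_iff_infDist_zero hne).2 hDt

/-- At a boundary point, all nearby normals have product at least `lam` with some `a i`, so they
have nonnegative product with every `v` in the ball of radius `lam` about `a i`. Short segments in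
these directions remain in the closed domain, and the ball spans the space. -/
theorem uniqueDiffOn_closure (hO : IsAdmissible O) : UniqueDiffOn ℝ (closure O) := by
  intro x hx
  by_cases hxO : x ∈ O
  · exact (hO.isOpen.uniqueDiffWithinAt hxO).mono subset_closure
  have hxf : x ∈ frontier O := by rw [hO.isOpen.frontier_eq]; exact ⟨hx, hxO⟩
  obtain ⟨k, lam, R, a, y, -, hlam, hR, ha, -, hcov, hn⟩ := hO.exists_cover
  obtain ⟨i, hi⟩ := mem_iUnion.1 (hcov hxf)
  -- Chosen so that `2 * (t * ‖v‖) < R` when `‖v‖ ≤ 1 + lam`: only boundary points within `R` of `x`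
  -- matter, and these lie in the ball of radius `2 * R` where the cover controls the normals.
  set t : ℝ := R / (2 * (1 + lam) + 1) with ht
  have hden : 0 < 2 * (1 + lam) + 1 := by positivity
  have htpos : 0 < t := div_pos hR hden
  have hmem : ∀ v ∈ Metric.ball (a i) lam, ∀ s, 0 ≤ s → s ≤ t → x + s • v ∈ closure O := by
    intro v hv s hs hst
    refine add_smul_mem_closure hO.isOpen (ρ := R) hx ?_ hs ?_
    · intro p hp hpx n hnp
      have h1 := hn i p ⟨hp, ?_⟩ n hnp
      · have h2 : inner ℝ n v = inner ℝ n (a i) + inner ℝ n (v - a i) := by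
          rw [← inner_add_right]; congr 1; abel
        have h3 := abs_real_inner_le_norm n (v - a i)
        rw [hnp.1, one_mul] at h3
        have h4 : ‖v - a i‖ < lam := by simpa [dist_eq_norm] using hv
        rw [h2]
        linarith [(abs_le.1 h3).1]
      · rw [Metric.mem_ball] at hi ⊢
        have := dist_triangle p x (y i)
        rw [dist_eq_norm p x] at this
        linarith
    · have h4 : ‖v‖ ≤ 1 + lam := by
        have : ‖v - a i‖ < lam := by simpa [dist_eq_norm] using hv
        calc ‖v‖ = ‖a i + (v - a i)‖ := by congr 1; abel
          _ ≤ _ := norm_add_le _ _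
          _ ≤ _ := by rw [ha i]; linarith
      calc 2 * (s * ‖v‖) ≤ 2 * (t * (1 + lam)) := by gcongr
        _ = R * (2 * (1 + lam)) / (2 * (1 + lam) + 1) := by rw [ht]; ring
        _ < R := by rw [div_lt_iff₀ hden]; nlinarith
  have hcone : ∀ v ∈ Metric.ball (a i) lam, v ∈ Submodule.span ℝ (tangentConeAt ℝ (closure O) x) := by
    intro v hv
    have h1 : (x + t • v) - x ∈ tangentConeAt ℝ (closure O) x := by
      refine mem_tangentConeAt_of_openSegment_subset ?_
      rintro z ⟨α, β, hα, hβ, hαβ, rfl⟩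
      have : α • x + β • (x + t • v) = x + (β * t) • v := by
        rw [← eq_sub_iff_add_eq] at hαβ; rw [hαβ]; module
      rw [this]
      exact hmem v hv _ (by positivity) (by nlinarith)
    have h2 := Submodule.smul_mem _ t⁻¹ (Submodule.subset_span h1)
    have h3 : t⁻¹ • ((x + t • v) - x) = v := by
      rw [add_sub_cancel_left, smul_smul, inv_mul_cancel₀ htpos.ne', one_smul]
    rwa [h3] at h2
  refine ⟨?_, subset_closure hx⟩
  have : Submodule.span ℝ (tangentConeAt ℝ (closure O) x) = ⊤ := by
    refine Submodule.eq_top_of_nonempty_interior' _ ⟨a i, ?_⟩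
    exact mem_interior.2 ⟨_, hcone, Metric.isOpen_ball, Metric.mem_ball_self hlam⟩
  rw [this]
  exact dense_univ

end Domain

end WongZakai

namespace WongZakai

/-! ### Slopes of polygonal paths and their dependence on earlier grid values. -/

section Polygonal

variable {F : Type*} [NormedAddCommGroup F] [NormedSpace ℝ F]

lemma polygonal_grid (N k : ℕ) (w : C(ℝ≥0, F)) :
    polygonal N w ((k : ℝ≥0) / 2 ^ N) = w ((k : ℝ≥0) / 2 ^ N) := by
  have h : (2 : ℝ≥0) ^ N * ((k : ℝ≥0) / 2 ^ N) = k := by field_simp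
  have hf : ⌊(k : ℝ≥0)⌋₊ = k := Nat.floor_natCast k
  change w (_ / _) + _ • _ = _
  rw [h, hf]
  simp

/-- The slope of the polygonal path on the `k`-th dyadic interval. -/
noncomputable def slope (N : ℕ) (w : C(ℝ≥0, F)) (k : ℕ) : F :=
  (2 : ℝ) ^ N • (w (((k + 1 : ℕ) : ℝ≥0) / 2 ^ N) - w ((k : ℝ≥0) / 2 ^ N))

lemma polygonal_eq_of_mem_Ico (N k : ℕ) (w : C(ℝ≥0, F)) {s : ℝ}
    (hs : s ∈ Ico ((k : ℝ) / 2 ^ N) (((k + 1 : ℕ) : ℝ) / 2 ^ N)) :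
    polygonal N w s.toNNReal = w ((k : ℝ≥0) / 2 ^ N) + (s - k / 2 ^ N) • slope N w k := by
  have h2 : (0 : ℝ) < 2 ^ N := by positivity
  have hs0 : 0 ≤ s := le_trans (by positivity) hs.1
  have hc : ((2 ^ N * s.toNNReal : ℝ≥0) : ℝ) = 2 ^ N * s := by
    push_cast; rw [Real.coe_toNNReal s hs0]
  have hf : ⌊(2 : ℝ≥0) ^ N * s.toNNReal⌋₊ = k := by
    rw [Nat.floor_eq_iff (zero_le)]
    have h3 := hs.1
    have h4 := hs.2
    rw [div_le_iff₀ h2] at h3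
    rw [lt_div_iff₀ h2] at h4
    constructor
    · rw [← NNReal.coe_le_coe, hc]; simpa [mul_comm] using h3
    · rw [← NNReal.coe_lt_coe, hc]; push_cast at h4 ⊢; linarith
  change w (_ / _) + _ • _ = _
  rw [hf, hc, slope, smul_smul]
  congr 2
  field_simp

lemma polygonal_eq_of_mem_Icc (N k : ℕ) (w : C(ℝ≥0, F)) {s : ℝ}
    (hs : s ∈ Icc ((k : ℝ) / 2 ^ N) (((k + 1 : ℕ) : ℝ) / 2 ^ N)) :
    polygonal N w s.toNNReal = w ((k : ℝ≥0) / 2 ^ N) + (s - k / 2 ^ N) • slope N w k := by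
  rcases hs.2.eq_or_lt with h | h
  · have hs' : s.toNNReal = ((k + 1 : ℕ) : ℝ≥0) / 2 ^ N := by
      rw [h, ← NNReal.coe_inj, Real.coe_toNNReal _ (by positivity)]; push_cast; rfl
    rw [hs', polygonal_grid, slope, smul_smul, h]
    have : (((k + 1 : ℕ) : ℝ) / 2 ^ N - k / 2 ^ N) * 2 ^ N = 1 := by
      push_cast; field_simp; ring
    rw [this]; simp
  · exact polygonal_eq_of_mem_Ico N k w ⟨hs.1, h⟩

lemma deriv_polygonal (N k : ℕ) (w : C(ℝ≥0, F)) {s : ℝ}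
    (hs : s ∈ Ioo ((k : ℝ) / 2 ^ N) (((k + 1 : ℕ) : ℝ) / 2 ^ N)) :
    deriv (fun u : ℝ => polygonal N w u.toNNReal) s = slope N w k := by
  have h1 : (fun u : ℝ => polygonal N w u.toNNReal) =ᶠ[𝓝 s]
      fun u => w ((k : ℝ≥0) / 2 ^ N) + (u - k / 2 ^ N) • slope N w k := by
    filter_upwards [Ioo_mem_nhds hs.1 hs.2] with u hu
    exact polygonal_eq_of_mem_Ico N k w ⟨hu.1.le, hu.2⟩
  rw [h1.deriv_eq]
  have := (((hasDerivAt_id s).sub_const ((k : ℝ) / 2 ^ N)).smul_const (slope N w k)).const_add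
    (w ((k : ℝ≥0) / 2 ^ N))
  simpa using this.deriv

lemma ae_exists_mem_Ioo_dyadic (N : ℕ) :
    ∀ᵐ s : ℝ, 0 ≤ s → s ∈ Ioo ((⌊2 ^ N * s⌋₊ : ℝ) / 2 ^ N) (((⌊2 ^ N * s⌋₊ + 1 : ℕ) : ℝ) / 2 ^ N) := by
  have h2 : (0 : ℝ) < 2 ^ N := by positivity
  have hc : (range fun k : ℕ => (k : ℝ) / 2 ^ N).Countable := countable_range _
  filter_upwards [hc.ae_notMem volume] with s hs hs0
  have h1 := Nat.floor_le (mul_nonneg h2.le hs0)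
  have h3 := Nat.lt_floor_add_one (2 ^ N * s)
  constructor
  · refine lt_of_le_of_ne ?_ fun h => hs ⟨_, h⟩
    rw [div_le_iff₀ h2]; linarith
  · rw [lt_div_iff₀ h2]; push_cast; linarith

/-- Off the null set of grid points the derivative takes finitely many values up to time `T`. Only
finiteness matters, so the sum of their norms serves as the bound. -/
lemma norm_deriv_polygonal_le (N : ℕ) (w : C(ℝ≥0, F)) (T : ℝ) :
    ∃ C, ∀ᵐ s : ℝ ∂volume.restrict (Icc 0 T),
      ‖deriv (fun u : ℝ => polygonal N w u.toNNReal) s‖ ≤ C := by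
  refine ⟨∑ k ∈ Finset.range (⌊2 ^ N * T⌋₊ + 1), ‖slope N w k‖, ?_⟩
  rw [ae_restrict_iff' measurableSet_Icc]
  filter_upwards [ae_exists_mem_Ioo_dyadic N] with s hs hsI
  rw [deriv_polygonal N _ w (hs hsI.1)]
  refine Finset.single_le_sum (f := fun k => ‖slope N w k‖) (fun _ _ => norm_nonneg _) ?_
  rw [Finset.mem_range, Nat.lt_add_one_iff]
  exact Nat.floor_le_floor (by gcongr; exact hsI.2)

/-- Polygonal paths only depend on the values at earlier grid points. -/
lemma polygonal_congr (N k : ℕ) {w w' : C(ℝ≥0, F)}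
    (h : ∀ u ≤ (k : ℝ≥0) / 2 ^ N, w u = w' u) {t : ℝ≥0} (ht : t ≤ (k : ℝ≥0) / 2 ^ N) :
    polygonal N w t = polygonal N w' t := by
  rcases ht.eq_or_lt with rfl | ht
  · rw [polygonal_grid, polygonal_grid, h _ le_rfl]
  · have h2 : (0 : ℝ≥0) < 2 ^ N := by positivity
    have hk : ⌊2 ^ N * t⌋₊ < k := by
      rw [Nat.floor_lt (zero_le)]
      rw [lt_div_iff₀ h2] at ht
      rwa [mul_comm]
    have e : ∀ j : ℕ, j ≤ k → w ((j : ℝ≥0) / 2 ^ N) = w' ((j : ℝ≥0) / 2 ^ N) := by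
      intro j hj
      refine h _ ?_
      gcongr
    change w (_ / _) + _ • (w _ - w _) = w' (_ / _) + _ • (w' _ - w' _)
    rw [e _ hk.le, e _ hk]

end Polygonal

/-! ### Reflected arcs on a compact interval of real times. -/

section Arc

variable {d : ℕ}

local notation "𝔼" => EuclideanSpace ℝ (Fin d)

/-- The path `x` satisfies `dx = v dt + n dm` on `[a, b]`, where the measure `m` is atomless and
carried by the times at which `x` is in the boundary, and `n` is an inward normal there. -/
structure IsReflectedArc (O : Set 𝔼) (a b : ℝ) (x v n : ℝ → 𝔼) (m : Measure ℝ) : Prop where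
  continuousOn : ContinuousOn x (Icc a b)
  mem : ∀ t ∈ Icc a b, x t ∈ closure O
  integrable_drift : IntegrableOn v (Icc a b)
  nullSingleton : NullSingletonClass m
  measure_lt_top : m (Icc a b) < ∞
  integrable_normal : IntegrableOn n (Icc a b) m
  ae_normal : ∀ᵐ s ∂m.restrict (Icc a b), x s ∈ frontier O ∧ n s ∈ inwardNormals O (x s)
  eq_add : ∀ t ∈ Icc a b, x t = x a + (∫ s in Ioc a t, v s) + ∫ s in Ioc a t, n s ∂m

variable {O : Set (EuclideanSpace ℝ (Fin d))} {a b : ℝ} {x v n : ℝ → EuclideanSpace ℝ (Fin d)}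
  {m : Measure ℝ}

lemma IsReflectedArc.mono (h : IsReflectedArc O a b x v n m) {a' b' : ℝ} (ha : a ≤ a')
    (hb : b' ≤ b) : IsReflectedArc O a' b' x v n m := by
  have hsub : Icc a' b' ⊆ Icc a b := Icc_subset_Icc ha hb
  refine ⟨h.continuousOn.mono hsub, fun t ht => h.mem t (hsub ht), h.integrable_drift.mono_set hsub,
    h.nullSingleton, (measure_mono hsub).trans_lt h.measure_lt_top,
    h.integrable_normal.mono_set hsub, ae_restrict_of_ae_restrict_of_subset hsub h.ae_normal,
    fun t ht => ?_⟩
  have hab' : a' ≤ t := ht.1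
  have htI : t ∈ Icc a b := hsub ht
  have ha' : a' ∈ Icc a b := ⟨ha, hab'.trans htI.2⟩
  have e : ∀ {μ : Measure ℝ} {g : ℝ → EuclideanSpace ℝ (Fin d)}, IntegrableOn g (Icc a b) μ →
      ∫ s in Ioc a t, g s ∂μ = ∫ s in Ioc a a', g s ∂μ + ∫ s in Ioc a' t, g s ∂μ := by
    intro μ g hg
    rw [← Ioc_union_Ioc_eq_Ioc ha hab', setIntegral_union (Ioc_disjoint_Ioc_of_le le_rfl)
      measurableSet_Ioc]
    · exact hg.mono_set fun s hs => ⟨hs.1.le, hs.2.trans ha'.2⟩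
    · exact hg.mono_set fun s hs => ⟨ha.trans hs.1.le, hs.2.trans htI.2⟩
  rw [h.eq_add t htI, h.eq_add a' ha', e h.integrable_drift, e h.integrable_normal]
  abel

lemma IsReflectedArc.congr_drift (h : IsReflectedArc O a b x v n m)
    {v' : ℝ → EuclideanSpace ℝ (Fin d)} (hv : v =ᵐ[volume.restrict (Icc a b)] v') :
    IsReflectedArc O a b x v' n m := by
  refine ⟨h.continuousOn, h.mem, h.integrable_drift.congr hv, h.nullSingleton, h.measure_lt_top,
    h.integrable_normal, h.ae_normal, fun t ht => ?_⟩
  rw [h.eq_add t ht]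
  congr 2
  refine integral_congr_ae (ae_restrict_of_ae_restrict_of_subset ?_ hv)
  exact fun s hs => ⟨hs.1.le, hs.2.trans ht.2⟩

/-- The point at rest needs neither drift nor reflection, even on the boundary. It is the comparison
path in the oscillation estimate. -/
lemma isReflectedArc_const {c : EuclideanSpace ℝ (Fin d)} (hc : c ∈ closure O) :
    IsReflectedArc O a b (fun _ => c) 0 0 0 :=
  ⟨continuousOn_const, fun _ _ => hc, integrableOn_zero, ⟨fun _ => rfl⟩, by simp, integrableOn_zero,
    by simp, by simp⟩

end Arc

/-! ### From solutions of the reflected equation to reflected arcs. -/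

section Bridge

variable {d r : ℕ} {O : Set (EuclideanSpace ℝ (Fin d))}
  {σ : EuclideanSpace ℝ (Fin d) → EuclideanSpace ℝ (Fin r) →L[ℝ] EuclideanSpace ℝ (Fin d)}
  {b : EuclideanSpace ℝ (Fin d) → EuclideanSpace ℝ (Fin d)} {x₀ : EuclideanSpace ℝ (Fin d)}

/-- An atom at `t > 0` would make `ℓ` jump there by the mass of the atom times the unit vector `n
t`, against continuity. At `0` the variation is taken over a single point. -/
lemma measure_singleton_eq_zero_of_isReflectionTerm {x : ℝ≥0 → EuclideanSpace ℝ (Fin d)}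
    {ℓ : C(ℝ≥0, EuclideanSpace ℝ (Fin d))} {m : Measure ℝ≥0}
    {n : ℝ≥0 → EuclideanSpace ℝ (Fin d)}
    (hvar : ∀ t, eVariationOn ℓ (Iic t) ≠ ∞) (hm : ∀ t, m (Iic t) = eVariationOn ℓ (Iic t))
    (hmeas : Measurable n) (hn : ∀ᵐ s ∂m, n s ∈ inwardNormals O (x s))
    (hℓ : ∀ t, ℓ t = ∫ s in Iic t, n s ∂m) (t : ℝ≥0) : m {t} = 0 := by
  have hint : ∀ t, IntegrableOn n (Iic t) m := by
    intro t
    refine Measure.integrableOn_of_bounded (M := 1) (by rw [hm]; exact hvar t)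
      hmeas.aestronglyMeasurable ?_
    exact ae_restrict_of_ae (hn.mono fun s hs => hs.1.le)
  rcases eq_or_ne t 0 with rfl | ht
  · refine measure_mono_null (singleton_subset_iff.2 (mem_Iic.2 le_rfl)) ?_
    rw [hm]
    refine eVariationOn.subsingleton _ ?_
    have : Iic (0 : ℝ≥0) = {0} := by ext; simp
    rw [this]; exact subsingleton_singleton
  · obtain ⟨u, hu, hut, hulim⟩ := exists_seq_strictMono_tendsto' (pos_iff_ne_zero.2 ht)
    have hU : ⋃ k, Iic (u k) = Iio t := by
      ext s
      simp only [mem_iUnion, mem_Iic, mem_Iio]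
      constructor
      · rintro ⟨k, hk⟩; exact hk.trans_lt (hut k).2
      · intro hs
        obtain ⟨k, hk⟩ := (hulim.eventually (lt_mem_nhds hs)).exists
        exact ⟨k, hk.le⟩
    have h1 := tendsto_setIntegral_of_monotone (μ := m) (f := n) (fun k => measurableSet_Iic (a := u k))
      (fun i j hij => Iic_subset_Iic.2 (hu.monotone hij))
      (by rw [hU]; exact (hint t).mono_set Iio_subset_Iic_self)
    rw [hU] at h1
    have h2 : Tendsto (fun k => ℓ (u k)) atTop (𝓝 (ℓ t)) := (ℓ.continuous.tendsto t).comp hulim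
    simp_rw [hℓ] at h2
    have h3 := tendsto_nhds_unique h1 h2
    have h4 : ∫ s in Iic t, n s ∂m = ∫ s in Iio t, n s ∂m + ∫ s in {t}, n s ∂m := by
      rw [← Iio_union_right, setIntegral_union (by simp) (measurableSet_singleton t)]
      · exact (hint t).mono_set Iio_subset_Iic_self
      · exact (hint t).mono_set (by simp)
    have h5 : ∫ s in {t}, n s ∂m = 0 := by
      rw [h4] at h3; simpa using h3
    by_contra h0
    have hfin : m {t} ≠ ∞ := by
      refine ne_top_of_le_ne_top (hvar t) ?_
      rw [← hm]; exact measure_mono (by simp)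
    -- A property that holds almost everywhere holds at an atom.
    have h6 : n t ∈ inwardNormals O (x t) := by
      by_contra h7
      exact h0 (measure_mono_null (by simpa using h7) hn)
    rw [integral_singleton, smul_eq_zero] at h5
    rcases h5 with h5 | h5
    · rw [Measure.real, ENNReal.toReal_eq_zero_iff] at h5
      exact h5.elim h0 hfin
    · have := h6.1; rw [h5] at this; simp at this

lemma continuousOn_clm_slope {x : ℝ → EuclideanSpace ℝ (Fin d)} {T : ℝ} (N : ℕ)
    (w : C(ℝ≥0, EuclideanSpace ℝ (Fin r))) (hσ : ContinuousOn σ (closure O))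
    (hb : ContinuousOn b (closure O)) (hx : ContinuousOn x (Icc 0 T))
    (hxO : ∀ t ∈ Icc 0 T, x t ∈ closure O) :
    IntegrableOn (fun s => σ (x s) (deriv (fun u : ℝ => polygonal N w u.toNNReal) s)) (Icc 0 T) ∧
      IntegrableOn (fun s => b (x s)) (Icc 0 T) := by
  refine ⟨integrableOn_clm_apply (hσ.comp hx hxO) ?_, (hb.comp hx hxO).integrableOn_Icc⟩
  obtain ⟨C, hC⟩ := norm_deriv_polygonal_le N w T
  exact Measure.integrableOn_of_bounded (M := C) (by simp)
    (measurable_deriv _).aestronglyMeasurable hC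

/-- A solution of the reflected equation driven by a polygonal path is a reflected arc. -/
theorem IsReflectedSolution.exists_isReflectedArc {N : ℕ}
    {w : C(ℝ≥0, EuclideanSpace ℝ (Fin r))} {x : C(ℝ≥0, closure O)}
    {ℓ : C(ℝ≥0, EuclideanSpace ℝ (Fin d))}
    (h : IsReflectedSolution O σ b x₀ (polygonal N w) x ℓ)
    (hσ : ContinuousOn σ (closure O)) (hb : ContinuousOn b (closure O)) :
    (x 0 : EuclideanSpace ℝ (Fin d)) = x₀ ∧
    (∀ t : ℝ≥0, (x t : EuclideanSpace ℝ (Fin d)) - ℓ t = x₀ + ∫ s in Ioc (0 : ℝ) t,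
      (σ (x s.toNNReal) (deriv (fun u : ℝ => polygonal N w u.toNNReal) s) + b (x s.toNNReal))) ∧
    ∃ (n : ℝ → EuclideanSpace ℝ (Fin d)) (m : Measure ℝ), ∀ T : ℝ,
      IsReflectedArc O 0 T (fun s => (x s.toNNReal : EuclideanSpace ℝ (Fin d)))
        (fun s => σ (x s.toNNReal) (deriv (fun u : ℝ => polygonal N w u.toNNReal) s) +
          b (x s.toNNReal)) n m := by
  obtain ⟨hvar, m, n, hm, hmeas, hfr, hn, hℓ⟩ := h.reflection
  have hsing : ∀ t, m {t} = 0 :=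
    measure_singleton_eq_zero_of_isReflectionTerm hvar hm hmeas hn hℓ
  have hsing' : NullSingletonClass m := ⟨hsing⟩
  have hxc : Continuous (fun s : ℝ => (x s.toNNReal : EuclideanSpace ℝ (Fin d))) := by fun_prop
  have hI := fun T : ℝ => continuousOn_clm_slope N w hσ hb (T := T) hxc.continuousOn
    (fun t _ => (x t.toNNReal).2)
  have hℓ0 : ℓ 0 = 0 := by
    rw [hℓ]
    have : Iic (0 : ℝ≥0) = {0} := by ext; simp
    rw [this]
    exact setIntegral_measure_zero _ (hsing 0)
  have hx0 : (x 0 : EuclideanSpace ℝ (Fin d)) = x₀ := by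
    have := h.equation 0
    simpa [hℓ0] using this
  have hdr : ∀ t : ℝ≥0, (x t : EuclideanSpace ℝ (Fin d)) - ℓ t = x₀ + ∫ s in Ioc (0 : ℝ) t,
      (σ (x s.toNNReal) (deriv (fun u : ℝ => polygonal N w u.toNNReal) s) + b (x s.toNNReal)) := by
    intro t
    rw [h.equation t, intervalIntegral.integral_of_le (NNReal.coe_nonneg t),
      intervalIntegral.integral_of_le (NNReal.coe_nonneg t),
      integral_add ((hI t).1.mono_set Ioc_subset_Icc_self)
        ((hI t).2.mono_set Ioc_subset_Icc_self)]
    abel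
  refine ⟨hx0, hdr, fun s => n s.toNNReal, m.map ((↑) : ℝ≥0 → ℝ), fun T => ?_⟩
  have hcm : Measurable ((↑) : ℝ≥0 → ℝ) := NNReal.continuous_coe.measurable
  have hnm : Measurable (fun s : ℝ => n s.toNNReal) := hmeas.comp measurable_real_toNNReal
  have hae : ∀ᵐ s ∂m.map ((↑) : ℝ≥0 → ℝ),
      ((x s.toNNReal : EuclideanSpace ℝ (Fin d)) ∈ frontier O ∧
        n s.toNNReal ∈ inwardNormals O (x s.toNNReal : EuclideanSpace ℝ (Fin d))) := by
    have he : MeasurableEmbedding ((↑) : ℝ≥0 → ℝ) := NNReal.isClosedEmbedding_coe.measurableEmbedding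
    rw [he.ae_map_iff]
    filter_upwards [hfr, hn] with s h1 h2
    simpa using ⟨h1, h2⟩
  have hlt : m.map ((↑) : ℝ≥0 → ℝ) (Icc 0 T) < ∞ := by
    rw [Measure.map_apply hcm measurableSet_Icc]
    refine (measure_mono (t := Iic T.toNNReal) ?_).trans_lt ?_
    · intro s hs
      exact NNReal.le_toNNReal_of_coe_le hs.2
    · rw [hm]; exact (hvar _).lt_top
  refine ⟨hxc.continuousOn, fun t _ => (x t.toNNReal).2, (hI T).1.add (hI T).2, ⟨fun t => ?_⟩, hlt,
    ?_, ae_restrict_of_ae hae, fun t ht => ?_⟩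
  · rw [Measure.map_apply hcm (measurableSet_singleton t)]
    rcases lt_or_ge t 0 with h0 | h0
    · convert measure_empty (μ := m)
      ext s
      simp only [mem_preimage, mem_singleton_iff, mem_empty_iff_false, iff_false]
      intro h1
      have := s.2
      rw [← h1] at h0
      exact absurd h0 (not_lt.2 this)
    · convert hsing t.toNNReal
      ext s
      simp only [mem_preimage, mem_singleton_iff]
      constructor
      · rintro rfl; simp
      · rintro rfl; simp [h0]
  · exact Measure.integrableOn_of_bounded (M := 1) hlt.ne hnm.aestronglyMeasurable
      (ae_restrict_of_ae (hae.mono fun s hs => hs.2.1.le))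
  · have e1 : ∫ s in Ioc 0 t, n s.toNNReal ∂m.map ((↑) : ℝ≥0 → ℝ) = ℓ t.toNNReal := by
      rw [setIntegral_map measurableSet_Ioc hnm.aestronglyMeasurable hcm.aemeasurable, hℓ]
      have : ((↑) : ℝ≥0 → ℝ) ⁻¹' Ioc 0 t = Ioc 0 t.toNNReal := by
        ext s
        simp only [mem_preimage, mem_Ioc, NNReal.coe_pos, Real.le_toNNReal_iff_coe_le ht.1]
      rw [this]
      have h2 : Iic t.toNNReal = Icc 0 t.toNNReal := by ext; simp
      rw [h2]
      simp only [Real.toNNReal_coe]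
      -- The time `0` may be dropped from the integral because `m` has no atoms.
      exact setIntegral_congr_set Ioc_ae_eq_Icc
    have e2 := hdr t.toNNReal
    rw [Real.coe_toNNReal t ht.1] at e2
    rw [e1]
    simp only [Real.toNNReal_zero, hx0]
    rw [← e2]
    abel

end Bridge

end WongZakai

namespace WongZakai

/-! ### Stability of reflected arcs under a weighted distance. -/

section Stability

variable {d : ℕ} {O : Set (EuclideanSpace ℝ (Fin d))}

local notation "𝔼" => EuclideanSpace ℝ (Fin d)

lemma IsAdmissible.exists_exterior_ball_closure (hO : IsAdmissible O) :
    ∃ C₀ : ℝ, 0 ≤ C₀ ∧ ∀ x' ∈ closure O, ∀ x ∈ frontier O, ∀ n ∈ inwardNormals O x,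
      0 ≤ inner ℝ (x' - x) n + C₀ * ‖x - x'‖ ^ 2 := by
  obtain ⟨C₀, h0, h⟩ := hO.uniform_exterior_ball
  refine ⟨C₀, h0, fun x' hx' x hx n hn => ?_⟩
  have hc : IsClosed {y : 𝔼 | 0 ≤ inner ℝ (y - x) n + C₀ * ‖x - y‖ ^ 2} :=
    isClosed_le continuous_const (by fun_prop)
  exact closure_minimal (fun y hy => h y hy x hx n hn) hc hx'

lemma hasFDerivAt_weighted_dist {φ : 𝔼 → ℝ} (hφ : Differentiable ℝ φ) (c : ℝ) (p : 𝔼 × 𝔼) :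
    ∃ A : 𝔼 × 𝔼 →L[ℝ] ℝ,
      HasFDerivAt (fun p : 𝔼 × 𝔼 => Real.exp (-c * (φ p.1 + φ p.2)) * ‖p.1 - p.2‖ ^ 2) A p ∧
      ∀ u u' : 𝔼, A (u, u') = Real.exp (-c * (φ p.1 + φ p.2)) *
        (-c * (fderiv ℝ φ p.1 u + fderiv ℝ φ p.2 u') * ‖p.1 - p.2‖ ^ 2 +
          2 * inner ℝ (p.1 - p.2) (u - u')) := by
  have h1 : HasFDerivAt (fun p : 𝔼 × 𝔼 => φ p.1) _ p :=
    (hφ p.1).hasFDerivAt.comp p (hasFDerivAt_fst (𝕜 := ℝ) (p := p))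
  have h2 : HasFDerivAt (fun p : 𝔼 × 𝔼 => φ p.2) _ p :=
    (hφ p.2).hasFDerivAt.comp p (hasFDerivAt_snd (𝕜 := ℝ) (p := p))
  have h3 : HasFDerivAt (fun p : 𝔼 × 𝔼 => ‖p.1 - p.2‖ ^ 2) _ p :=
    ((hasFDerivAt_fst (𝕜 := ℝ) (p := p)).sub (hasFDerivAt_snd (𝕜 := ℝ) (p := p))).norm_sq
  refine ⟨_, (((h1.add h2).const_mul (-c)).exp).mul h3, fun u u' => ?_⟩
  simp [inner_sub_left, inner_sub_right]
  ring

/-- A push along an inward normal at `x` can increase ‖x - x'‖² at a rate of at most 2 C₀ ‖x - x'‖²,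
by the exterior ball condition. Meanwhile the weight exp(-c (φ(x) + φ(x'))) decreases at relative
rate at least c α. With c α = 2 C₀ reflection never increases the weighted distance, so only the
drifts contribute. -/
theorem IsAdmissible.exists_stability (hO : IsAdmissible O) (hObdd : Bornology.IsBounded O) :
    ∃ C : ℝ, 0 ≤ C ∧ ∀ (a b : ℝ) (x v n x' v' n' : ℝ → 𝔼) (m m' : Measure ℝ), a ≤ b →
      IsReflectedArc O a b x v n m → IsReflectedArc O a b x' v' n' m' →
      ‖x b - x' b‖ ^ 2 ≤ C * (‖x a - x' a‖ ^ 2 + ∫ s in Ioc a b,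
        ((‖v s‖ + ‖v' s‖) * ‖x s - x' s‖ ^ 2 + ‖x s - x' s‖ * ‖v s - v' s‖)) := by
  have hK : IsCompact (closure O) := hObdd.isCompact_closure
  obtain ⟨C₀, hC₀, hball⟩ := hO.exists_exterior_ball_closure
  obtain ⟨φ, α, hφ, hα, hφα⟩ := hO.exists_function
  obtain ⟨M, hM⟩ := hK.exists_bound_of_continuousOn hφ.continuous.continuousOn
  have hφd : ContDiff ℝ 1 φ := hφ.of_le one_le_two
  obtain ⟨M', hM'⟩ := hK.exists_bound_of_continuousOn
    (hφd.continuous_fderiv one_ne_zero).continuousOn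
  obtain ⟨x₁, hx₁⟩ := hO.isConnected.nonempty
  have hM0 : 0 ≤ M := (norm_nonneg _).trans (hM _ (subset_closure hx₁))
  have hM'0 : 0 ≤ M' := (norm_nonneg _).trans (hM' _ (subset_closure hx₁))
  set c : ℝ := 2 * C₀ / α with hc
  have hc0 : 0 ≤ c := by positivity
  have hcα : c * α = 2 * C₀ := by rw [hc]; field_simp
  -- One exponential bounds the weight from above, the other undoes its lower bound. In the last
  -- factor, `2` comes from differentiating the squared distance and `c * M'` from differentiating
  -- the weight.
  refine ⟨Real.exp (2 * c * M) * (Real.exp (2 * c * M) * (2 + c * M')), by positivity, ?_⟩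
  intro a b x v n x' v' n' m m' hab hx hx'
  set f : 𝔼 × 𝔼 → ℝ := fun p => Real.exp (-c * (φ p.1 + φ p.2)) * ‖p.1 - p.2‖ ^ 2 with hf
  have hfdiff : ContDiff ℝ 1 f := by
    have h1 : ContDiff ℝ 1 (fun p : 𝔼 × 𝔼 => φ p.1) := hφd.comp contDiff_fst
    have h2 : ContDiff ℝ 1 (fun p : 𝔼 × 𝔼 => φ p.2) := hφd.comp contDiff_snd
    exact ((contDiff_const.mul (h1.add h2)).exp).mul ((contDiff_fst.sub contDiff_snd).norm_sq ℝ)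
  have hfder : ∀ p u u', fderiv ℝ f p (u, u') = Real.exp (-c * (φ p.1 + φ p.2)) *
        (-c * (fderiv ℝ φ p.1 u + fderiv ℝ φ p.2 u') * ‖p.1 - p.2‖ ^ 2 +
          2 * inner ℝ (p.1 - p.2) (u - u')) := by
    intro p u u'
    obtain ⟨A, hA, hAu⟩ := hasFDerivAt_weighted_dist (hφd.differentiable one_ne_zero) c p
    rw [hA.fderiv, hAu]
  -- The pair of arcs is driven by Lebesgue measure for the two drifts together and by one measure
  -- for each reflection.
  set μ : Fin 3 → Measure ℝ := ![volume, m, m'] with hμ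
  set q : Fin 3 → ℝ → 𝔼 × 𝔼 := ![fun s => (v s, v' s), fun s => (n s, 0), fun s => (0, n' s)] with hq
  have := hx.nullSingleton
  have := hx'.nullSingleton
  have hatom : ∀ i, NullSingletonClass (μ i) := by
    intro i; fin_cases i
    · exact (inferInstance : NullSingletonClass (volume : Measure ℝ))
    · exact hx.nullSingleton
    · exact hx'.nullSingleton
  have hqi : ∀ i, IntegrableOn (q i) (Icc a b) (μ i) := by
    intro i; fin_cases i
    · exact hx.integrable_drift.prodMk hx'.integrable_drift
    · exact hx.integrable_normal.prodMk (integrable_zero _ _ _)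
    · exact (integrable_zero _ _ _).prodMk hx'.integrable_normal
  have hchain := chain_rule hab (Z := fun t => (x t, x' t))
    (hx.continuousOn.prodMk hx'.continuousOn) (S := univ) (fun _ _ => mem_univ _) (f := f)
    (f' := fderiv ℝ f)
    (fun z _ => ((hfdiff.differentiable one_ne_zero) z).hasFDerivAt.hasFDerivWithinAt)
    (hfdiff.continuous_fderiv one_ne_zero).continuousOn (μ := μ) (q := q) hqi ?_
  swap
  · intro t ht
    have hsub : Ioc a t ⊆ Icc a b := fun s hs => ⟨hs.1.le, hs.2.trans ht.2⟩
    simp only [Fin.sum_univ_three, hμ, hq, Matrix.cons_val_zero, Matrix.cons_val_one,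
      Matrix.cons_val]
    rw [integral_pair (hx.integrable_drift.mono_set hsub) (hx'.integrable_drift.mono_set hsub),
      integral_pair (hx.integrable_normal.mono_set hsub) (integrable_zero _ _ _),
      integral_pair (integrable_zero _ _ _) (hx'.integrable_normal.mono_set hsub),
      hx.eq_add t ht, hx'.eq_add t ht]
    simp [add_assoc]
  have hexp : ∀ p : 𝔼 × 𝔼, p.1 ∈ closure O → p.2 ∈ closure O →
      Real.exp (-(2 * c * M)) ≤ Real.exp (-c * (φ p.1 + φ p.2)) ∧
      Real.exp (-c * (φ p.1 + φ p.2)) ≤ Real.exp (2 * c * M) := by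
    intro p h1 h2
    have h3 := abs_le.1 (hM _ h1)
    have h4 := abs_le.1 (hM _ h2)
    constructor <;> apply Real.exp_le_exp.2 <;> nlinarith
  simp only [Fin.sum_univ_three, hμ, hq, Matrix.cons_val_zero, Matrix.cons_val_one,
      Matrix.cons_val] at hchain
  have hn1 : ∫ s in Ioc a b, fderiv ℝ f (x s, x' s) (n s, 0) ∂m ≤ 0 := by
    refine integral_nonpos_of_ae ?_
    filter_upwards [ae_restrict_of_ae_restrict_of_subset Ioc_subset_Icc_self hx.ae_normal,
      ae_restrict_mem measurableSet_Ioc] with s hs hsI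
    have h1 := hball (x' s) (hx'.mem s ⟨hsI.1.le, hsI.2⟩) (x s) hs.1 (n s) hs.2
    have h2 := hφα (x s) hs.1 (n s) hs.2
    rw [hfder]
    refine mul_nonpos_of_nonneg_of_nonpos (Real.exp_pos _).le ?_
    have h3 : inner ℝ (x s - x' s) (n s - 0) = - inner ℝ (x' s - x s) (n s) := by
      rw [← inner_neg_left, neg_sub, sub_zero]
    simp only [map_zero, add_zero, h3]
    have h4 : c * α * ‖x s - x' s‖ ^ 2 ≤ c * (fderiv ℝ φ (x s)) (n s) * ‖x s - x' s‖ ^ 2 := by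
      gcongr
    rw [hcα] at h4
    linarith
  have hn2 : ∫ s in Ioc a b, fderiv ℝ f (x s, x' s) (0, n' s) ∂m' ≤ 0 := by
    refine integral_nonpos_of_ae ?_
    filter_upwards [ae_restrict_of_ae_restrict_of_subset Ioc_subset_Icc_self hx'.ae_normal,
      ae_restrict_mem measurableSet_Ioc] with s hs hsI
    have h1 := hball (x s) (hx.mem s ⟨hsI.1.le, hsI.2⟩) (x' s) hs.1 (n' s) hs.2
    have h2 := hφα (x' s) hs.1 (n' s) hs.2
    rw [hfder]
    refine mul_nonpos_of_nonneg_of_nonpos (Real.exp_pos _).le ?_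
    have h3 : inner ℝ (x s - x' s) (0 - n' s) = - inner ℝ (x s - x' s) (n' s) := by
      rw [← inner_neg_right, zero_sub]
    simp only [map_zero, zero_add, h3]
    have h4 : c * α * ‖x s - x' s‖ ^ 2 ≤ c * (fderiv ℝ φ (x' s)) (n' s) * ‖x s - x' s‖ ^ 2 := by
      gcongr
    rw [hcα] at h4
    rw [norm_sub_rev] at h1
    linarith
  have hDc : ContinuousOn (fun s => ‖x s - x' s‖) (Icc a b) :=
    (hx.continuousOn.sub hx'.continuousOn).norm
  have hint : IntegrableOn (fun s => (‖v s‖ + ‖v' s‖) * ‖x s - x' s‖ ^ 2 +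
      ‖x s - x' s‖ * ‖v s - v' s‖) (Ioc a b) := by
    refine IntegrableOn.mono_set ?_ Ioc_subset_Icc_self
    refine Integrable.add ?_ ?_
    · exact IntegrableOn.mul_continuousOn (hx.integrable_drift.norm.add hx'.integrable_drift.norm)
        (hDc.pow 2) isCompact_Icc
    · exact IntegrableOn.continuousOn_mul hDc (hx.integrable_drift.sub hx'.integrable_drift).norm
        isCompact_Icc
  set J : ℝ := ∫ s in Ioc a b, ((‖v s‖ + ‖v' s‖) * ‖x s - x' s‖ ^ 2 +
      ‖x s - x' s‖ * ‖v s - v' s‖) with hJ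
  have hn0 : ∫ s in Ioc a b, fderiv ℝ f (x s, x' s) (v s, v' s) ≤
      Real.exp (2 * c * M) * (2 + c * M') * J := by
    rw [hJ, ← integral_const_mul]
    refine setIntegral_mono_on ?_ (hint.const_mul _) measurableSet_Ioc fun s hs => ?_
    · exact (integrableOn_clm_apply (((hfdiff.continuous_fderiv one_ne_zero).continuousOn (s := univ)).comp
        (hx.continuousOn.prodMk hx'.continuousOn) fun _ _ => mem_univ _) (hqi 0)).mono_set
        Ioc_subset_Icc_self
    · have hsI : s ∈ Icc a b := ⟨hs.1.le, hs.2⟩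
      rw [hfder]
      have h1 := (abs_le.1 ((fderiv ℝ φ (x s)).le_of_opNorm_le (hM' _ (hx.mem s hsI)) (v s))).1
      have h2 := (abs_le.1 ((fderiv ℝ φ (x' s)).le_of_opNorm_le (hM' _ (hx'.mem s hsI)) (v' s))).1
      have h3 := (abs_le.1 (abs_real_inner_le_norm (x s - x' s) (v s - v' s))).2
      have h4 := (hexp (x s, x' s) (hx.mem s hsI) (hx'.mem s hsI)).2
      simp only at h4 ⊢
      have h5 : -c * ((fderiv ℝ φ (x s)) (v s) + (fderiv ℝ φ (x' s)) (v' s)) * ‖x s - x' s‖ ^ 2 ≤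
          c * M' * ((‖v s‖ + ‖v' s‖) * ‖x s - x' s‖ ^ 2) := by
        have : -c * ((fderiv ℝ φ (x s)) (v s) + (fderiv ℝ φ (x' s)) (v' s)) ≤
          c * M' * (‖v s‖ + ‖v' s‖) := by nlinarith
        nlinarith [sq_nonneg ‖x s - x' s‖]
      have h6 : 0 ≤ (‖v s‖ + ‖v' s‖) * ‖x s - x' s‖ ^ 2 := by positivity
      have h7 : 0 ≤ ‖x s - x' s‖ * ‖v s - v' s‖ := by positivity
      have h8 : 0 ≤ c * M' := by positivity
      calc _ ≤ Real.exp (-c * (φ (x s) + φ (x' s))) * ((2 + c * M') * ((‖v s‖ + ‖v' s‖) *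
            ‖x s - x' s‖ ^ 2 + ‖x s - x' s‖ * ‖v s - v' s‖)) := by
            refine mul_le_mul_of_nonneg_left ?_ (Real.exp_pos _).le
            nlinarith
        _ ≤ Real.exp (2 * c * M) * ((2 + c * M') * ((‖v s‖ + ‖v' s‖) *
            ‖x s - x' s‖ ^ 2 + ‖x s - x' s‖ * ‖v s - v' s‖)) :=
            mul_le_mul_of_nonneg_right h4 (by positivity)
        _ = _ := by ring
  have hJ0 : 0 ≤ J := integral_nonneg fun s => by positivity
  have hfb : Real.exp (-(2 * c * M)) * ‖x b - x' b‖ ^ 2 ≤ f (x b, x' b) :=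
    mul_le_mul_of_nonneg_right (hexp (x b, x' b) (hx.mem b ⟨hab, le_rfl⟩)
      (hx'.mem b ⟨hab, le_rfl⟩)).1 (by positivity)
  have hfa : f (x a, x' a) ≤ Real.exp (2 * c * M) * ‖x a - x' a‖ ^ 2 :=
    mul_le_mul_of_nonneg_right (hexp (x a, x' a) (hx.mem a ⟨le_rfl, hab⟩)
      (hx'.mem a ⟨le_rfl, hab⟩)).2 (by positivity)
  have hfa' : Real.exp (2 * c * M) * ‖x a - x' a‖ ^ 2 ≤
      Real.exp (2 * c * M) * (2 + c * M') * ‖x a - x' a‖ ^ 2 := by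
    have : 0 ≤ c * M' := by positivity
    rw [mul_assoc (Real.exp _)]
    refine mul_le_mul_of_nonneg_left ?_ (Real.exp_pos _).le
    nlinarith [sq_nonneg ‖x a - x' a‖]
  have hfin : Real.exp (-(2 * c * M)) * ‖x b - x' b‖ ^ 2 ≤
      Real.exp (2 * c * M) * (2 + c * M') * (‖x a - x' a‖ ^ 2 + J) := by
    rw [mul_add]; linarith
  calc ‖x b - x' b‖ ^ 2 = Real.exp (2 * c * M) * (Real.exp (-(2 * c * M)) * ‖x b - x' b‖ ^ 2) := by
        rw [← mul_assoc, ← Real.exp_add]; simp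
    _ ≤ Real.exp (2 * c * M) * (Real.exp (2 * c * M) * (2 + c * M') * (‖x a - x' a‖ ^ 2 + J)) := by
        gcongr
    _ = _ := by ring

end Stability

end WongZakai

namespace WongZakai

/-! ### Uniqueness, oscillation, and variation of the reflection term. -/

section Consequences

variable {d r : ℕ} {O : Set (EuclideanSpace ℝ (Fin d))}
  {σ : EuclideanSpace ℝ (Fin d) → EuclideanSpace ℝ (Fin r) →L[ℝ] EuclideanSpace ℝ (Fin d)}
  {b : EuclideanSpace ℝ (Fin d) → EuclideanSpace ℝ (Fin d)} {Kσ Kb : ℝ≥0}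

/-- Uniqueness for the reflected equation with a bounded driving velocity. -/
theorem IsReflectedArc.eq_of_drift_eq (hO : IsAdmissible O) (hObdd : Bornology.IsBounded O)
    (hσ : LipschitzOnWith Kσ σ (closure O)) (hb : LipschitzOnWith Kb b (closure O))
    {T G : ℝ} {g : ℝ → EuclideanSpace ℝ (Fin r)} {x n x' n' : ℝ → EuclideanSpace ℝ (Fin d)}
    {m m' : Measure ℝ} (hg : ∀ᵐ s ∂volume.restrict (Icc 0 T), ‖g s‖ ≤ G)
    (hx : IsReflectedArc O 0 T x (fun s => σ (x s) (g s) + b (x s)) n m)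
    (hx' : IsReflectedArc O 0 T x' (fun s => σ (x' s) (g s) + b (x' s)) n' m')
    (hxc : Continuous x) (hxc' : Continuous x') (h0 : x 0 = x' 0) {t : ℝ} (ht : t ∈ Icc 0 T) :
    x t = x' t := by
  have hK : IsCompact (closure O) := hObdd.isCompact_closure
  obtain ⟨C, hC, hstab⟩ := hO.exists_stability hObdd
  obtain ⟨Sσ, hSσ⟩ := hK.exists_bound_of_continuousOn hσ.continuousOn
  obtain ⟨Sb, hSb⟩ := hK.exists_bound_of_continuousOn hb.continuousOn
  set G' : ℝ := max G 0
  have hG' : 0 ≤ G' := le_max_right _ _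
  -- Twice a bound for the velocity, for the term with both drifts, plus its Lipschitz constant in
  -- the position, for the difference of the drifts.
  set A : ℝ := 2 * (Sσ * G' + Sb) + (Kσ * G' + Kb) with hA
  set U : ℝ → ℝ := fun s => ‖x s - x' s‖ ^ 2 with hU
  have hUc : Continuous U := ((hxc.sub hxc').norm).pow 2
  have hle : ∀ s ∈ Icc 0 T, U s ≤ C * (A * ∫ u in (0 : ℝ)..s, U u) := by
    intro s hs
    have h1 := hstab 0 s x _ n x' _ n' m m' hs.1 (hx.mono le_rfl hs.2) (hx'.mono le_rfl hs.2)
    rw [h0, sub_self, norm_zero, zero_pow two_ne_zero, zero_add] at h1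
    refine h1.trans (mul_le_mul_of_nonneg_left ?_ hC)
    rw [intervalIntegral.integral_of_le hs.1, ← integral_const_mul]
    refine integral_mono_of_nonneg (ae_of_all _ fun u => by positivity)
      ((hUc.const_mul A).integrableOn_Icc.mono_set Ioc_subset_Icc_self) ?_
    have hsub : Ioc 0 s ⊆ Icc 0 T := fun u hu => ⟨hu.1.le, hu.2.trans hs.2⟩
    filter_upwards [ae_restrict_of_ae_restrict_of_subset hsub hg,
      ae_restrict_mem measurableSet_Ioc] with u hu huI
    have hu1 := hx.mem u (hsub huI)
    have hu2 := hx'.mem u (hsub huI)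
    have hgu : ‖g u‖ ≤ G' := hu.trans (le_max_left _ _)
    have bd : ∀ y ∈ closure O, ‖σ y (g u) + b y‖ ≤ Sσ * G' + Sb := by
      intro y hy
      have h2 : 0 ≤ Sσ := (norm_nonneg _).trans (hSσ y hy)
      calc _ ≤ ‖σ y (g u)‖ + ‖b y‖ := norm_add_le _ _
        _ ≤ Sσ * ‖g u‖ + Sb := add_le_add ((σ y).le_of_opNorm_le (hSσ y hy) _) (hSb y hy)
        _ ≤ _ := by gcongr
    have hdiff : ‖(σ (x u) (g u) + b (x u)) - (σ (x' u) (g u) + b (x' u))‖ ≤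
        (Kσ * G' + Kb) * ‖x u - x' u‖ := by
      have e : (σ (x u) (g u) + b (x u)) - (σ (x' u) (g u) + b (x' u)) =
        (σ (x u) - σ (x' u)) (g u) + (b (x u) - b (x' u)) := by
        rw [_root_.sub_apply]; abel
      rw [e]
      calc _ ≤ ‖(σ (x u) - σ (x' u)) (g u)‖ + ‖b (x u) - b (x' u)‖ := norm_add_le _ _
        _ ≤ Kσ * ‖x u - x' u‖ * ‖g u‖ + Kb * ‖x u - x' u‖ :=
          add_le_add (ContinuousLinearMap.le_of_opNorm_le _ (hσ.norm_sub_le hu1 hu2) _)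
            (hb.norm_sub_le hu1 hu2)
        _ ≤ Kσ * ‖x u - x' u‖ * G' + Kb * ‖x u - x' u‖ := by gcongr
        _ = _ := by ring
    have h3 := bd _ hu1
    have h4 := bd _ hu2
    simp only [hU, hA]
    calc _ ≤ ((Sσ * G' + Sb) + (Sσ * G' + Sb)) * ‖x u - x' u‖ ^ 2 +
          ‖x u - x' u‖ * ((Kσ * G' + Kb) * ‖x u - x' u‖) := by gcongr
      _ = _ := by ring
  have hA0 : 0 ≤ A := by
    have hm := hx.mem t ht
    have h2 : 0 ≤ Sσ := (norm_nonneg _).trans (hSσ _ hm)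
    have h3 : 0 ≤ Sb := (norm_nonneg _).trans (hSb _ hm)
    positivity
  have hU0 : ∀ s, 0 ≤ U s := fun s => by positivity
  have hder : ∀ s, HasDerivAt (fun s => ∫ u in (0 : ℝ)..s, U u) (U s) s := fun s =>
    intervalIntegral.integral_hasDerivAt_right (hUc.intervalIntegrable _ _)
      (hUc.stronglyMeasurableAtFilter _ _) hUc.continuousAt
  -- Grönwall is applied to the primitive of `U`: the stability estimate bounds `U`, its derivative,
  -- by a multiple of the primitive, and the initial value is zero.
  have hgr := norm_le_gronwallBound_of_norm_deriv_right_le (f := fun s => ∫ u in (0 : ℝ)..s, U u)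
    (f' := U) (δ := 0) (K := C * A) (ε := 0) (a := 0) (b := T)
    (fun s _ => (hder s).continuousAt.continuousWithinAt) (fun s _ => (hder s).hasDerivWithinAt)
    (by simp) (fun s hs => by
      have h1 := hle s (Ico_subset_Icc_self hs)
      have h2 : 0 ≤ ∫ u in (0 : ℝ)..s, U u := intervalIntegral.integral_nonneg hs.1 fun u _ => hU0 u
      rw [Real.norm_of_nonneg (hU0 s), Real.norm_of_nonneg h2]
      linarith) t ht
  simp only [gronwallBound_ε0, zero_mul] at hgr
  have h1 := hle t ht
  rw [norm_le_zero_iff.1 hgr] at h1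
  have h2 : ‖x t - x' t‖ ^ 2 = 0 := le_antisymm (by simpa [hU] using h1) (sq_nonneg _)
  exact sub_eq_zero.1 (norm_eq_zero.1 (pow_eq_zero_iff two_ne_zero |>.1 h2))

/-- The oscillation of a reflected arc is controlled by the drift alone. -/
theorem IsAdmissible.exists_oscillation (hO : IsAdmissible O) (hObdd : Bornology.IsBounded O) :
    ∃ C : ℝ, 0 ≤ C ∧ ∀ (a b g : ℝ) (x v n : ℝ → EuclideanSpace ℝ (Fin d)) (m : Measure ℝ),
      IsReflectedArc O a b x v n m → (∀ s ∈ Icc a b, ‖v s‖ ≤ g) → ∀ t ∈ Icc a b,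
        ‖x t - x a‖ ≤ C * (g * (b - a)) := by
  obtain ⟨C, hC, hstab⟩ := hO.exists_stability hObdd
  obtain ⟨M, hM⟩ := hObdd.isCompact_closure.exists_bound_of_continuousOn continuousOn_id
  refine ⟨C * (2 * |M| + 1), by positivity, fun a b g x v n m hx hv t ht => ?_⟩
  have hab : a ≤ b := ht.1.trans ht.2
  have haI : a ∈ Icc a b := ⟨le_rfl, hab⟩
  have hg : 0 ≤ g := (norm_nonneg _).trans (hv a haI)
  -- The arc is compared with the point at rest up to the time of largest distance `D`. Since `D ≤ 2
  -- * |M|`, the quadratic term of the estimate is linear in `D` as well; thus `D ^ 2` is at most a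
  -- constant times `D`, and one factor cancels.
  obtain ⟨s, hs, hmax⟩ := isCompact_Icc.exists_isMaxOn (nonempty_Icc.2 hab)
    (f := fun u => ‖x u - x a‖) (hx.continuousOn.sub continuousOn_const).norm
  set D : ℝ := ‖x s - x a‖ with hD
  have hle : ∀ u ∈ Icc a b, ‖x u - x a‖ ≤ D := fun u hu => hmax hu
  have hDM : D ≤ 2 * |M| := by
    have h1 := (hM _ (hx.mem s hs)).trans (le_abs_self M)
    have h2 := (hM _ (hx.mem a haI)).trans (le_abs_self M)
    have := norm_sub_le (x s) (x a)
    simp only [id] at h1 h2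
    linarith
  have hD0 : 0 ≤ D := norm_nonneg _
  have h1 := hstab a s x v n (fun _ => x a) 0 0 m 0 hs.1 (hx.mono le_rfl hs.2)
    (isReflectedArc_const (hx.mem a haI))
  simp only [sub_self, norm_zero, zero_pow two_ne_zero, zero_add, Pi.zero_apply, add_zero,
    sub_zero] at h1
  have h2 : ∫ u in Ioc a s, (‖v u‖ * ‖x u - x a‖ ^ 2 + ‖x u - x a‖ * ‖v u‖) ≤
      (2 * |M| + 1) * (g * (b - a)) * D := by
    calc _ ≤ ∫ u in Ioc a s, (2 * |M| + 1) * g * D := by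
          refine integral_mono_of_nonneg (ae_of_all _ fun u => by positivity)
            (integrableOn_const (by simp)) ?_
          filter_upwards [ae_restrict_mem measurableSet_Ioc] with u hu
          have huI : u ∈ Icc a b := ⟨hu.1.le, hu.2.trans hs.2⟩
          have h3 := hle u huI
          have h4 := hv u huI
          have h5 : ‖x u - x a‖ ^ 2 ≤ 2 * |M| * D := by
            rw [sq]; gcongr; linarith
          calc _ ≤ g * (2 * |M| * D) + D * g := by gcongr
            _ = _ := by ring
      _ = (s - a) * ((2 * |M| + 1) * g * D) := by
          rw [setIntegral_const]; simp [hs.1]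
      _ ≤ (b - a) * ((2 * |M| + 1) * g * D) := by
          gcongr; exact hs.2
      _ = _ := by ring
  refine (hle t ht).trans ?_
  have h3 : D ^ 2 ≤ C * ((2 * |M| + 1) * (g * (b - a)) * D) :=
    h1.trans (mul_le_mul_of_nonneg_left h2 hC)
  rcases hD0.eq_or_lt with h | h
  · rw [← h]
    have : 0 ≤ b - a := sub_nonneg.2 hab
    positivity
  · refine le_of_mul_le_mul_right ?_ h
    calc D * D = D ^ 2 := by ring
      _ ≤ _ := h3
      _ = _ := by ring

/-- Oscillation over an interval on which the driving path is affine with slope `ξ`. -/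
theorem exists_oscillation_affine (hO : IsAdmissible O) (hObdd : Bornology.IsBounded O)
    (hσ : ContinuousOn σ (closure O)) (hb : ContinuousOn b (closure O)) :
    ∃ C : ℝ, 0 ≤ C ∧ ∀ (a a' : ℝ) (ξ : EuclideanSpace ℝ (Fin r))
      (x n : ℝ → EuclideanSpace ℝ (Fin d)) (m : Measure ℝ),
      IsReflectedArc O a a' x (fun s => σ (x s) ξ + b (x s)) n m →
      (∀ s ∈ Icc a a', ‖σ (x s) ξ + b (x s)‖ * (a' - a) ≤ C * (‖(a' - a) • ξ‖ + (a' - a))) ∧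
      ∀ t ∈ Icc a a', ‖x t - x a‖ ≤ C * (‖(a' - a) • ξ‖ + (a' - a)) := by
  have hK : IsCompact (closure O) := hObdd.isCompact_closure
  obtain ⟨C, hC, hosc⟩ := hO.exists_oscillation hObdd
  obtain ⟨Sσ, hSσ⟩ := hK.exists_bound_of_continuousOn hσ
  obtain ⟨Sb, hSb⟩ := hK.exists_bound_of_continuousOn hb
  refine ⟨(C + 1) * (|Sσ| + |Sb|), by positivity, fun a a' ξ x n m hx => ?_⟩
  have hv : ∀ s ∈ Icc a a', ‖σ (x s) ξ + b (x s)‖ ≤ |Sσ| * ‖ξ‖ + |Sb| := fun s hs =>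
    (norm_add_le _ _).trans (add_le_add ((σ (x s)).le_of_opNorm_le
      ((hSσ _ (hx.mem s hs)).trans (le_abs_self _)) _)
      ((hSb _ (hx.mem s hs)).trans (le_abs_self _)))
  have key : a ≤ a' → (|Sσ| * ‖ξ‖ + |Sb|) * (a' - a) ≤
      (|Sσ| + |Sb|) * (‖(a' - a) • ξ‖ + (a' - a)) := by
    intro h
    have h0 : 0 ≤ a' - a := sub_nonneg.2 h
    rw [norm_smul, Real.norm_of_nonneg h0]
    have h1 : 0 ≤ |Sσ| * (a' - a) := by positivity
    have h2 : 0 ≤ |Sb| * ((a' - a) * ‖ξ‖) := by positivity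
    nlinarith
  constructor
  · intro s hs
    have h := hs.1.trans hs.2
    have h0 : 0 ≤ a' - a := sub_nonneg.2 h
    have h3 : 0 ≤ C * ((|Sσ| + |Sb|) * (‖(a' - a) • ξ‖ + (a' - a))) := by positivity
    have h4 := mul_le_mul_of_nonneg_right (hv s hs) h0
    have h5 := key h
    linarith
  · intro t ht
    have h := ht.1.trans ht.2
    have h0 : 0 ≤ a' - a := sub_nonneg.2 h
    have h1 := hosc a a' _ x _ n m hx hv t ht
    have h2 := mul_le_mul_of_nonneg_left (key h) hC
    have h3 : 0 ≤ (|Sσ| + |Sb|) * (‖(a' - a) • ξ‖ + (a' - a)) := by positivity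
    linarith

/-- The closed domain need not be convex, so the mean value inequality for the derivative of `φ` is
used on a ball that contains it. -/
lemma exists_lipschitz_clm_comp (hObdd : Bornology.IsBounded O)
    (hσ : LipschitzOnWith Kσ σ (closure O)) {φ : EuclideanSpace ℝ (Fin d) → ℝ}
    (hφ : ContDiff ℝ 2 φ) : ∃ K : ℝ, 0 ≤ K ∧ ∀ x ∈ closure O, ∀ x' ∈ closure O,
      ‖(fderiv ℝ φ x).comp (σ x) - (fderiv ℝ φ x').comp (σ x')‖ ≤ K * ‖x - x'‖ := by
  obtain ⟨ρ, hρ⟩ := hObdd.closure.subset_closedBall 0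
  have hK : IsCompact (closure O) := hObdd.isCompact_closure
  have hφ1 : ContDiff ℝ 1 (fderiv ℝ φ) := hφ.fderiv_right (by norm_num)
  obtain ⟨Sσ, hSσ⟩ := hK.exists_bound_of_continuousOn hσ.continuousOn
  obtain ⟨S1, hS1⟩ := hK.exists_bound_of_continuousOn hφ1.continuous.continuousOn
  obtain ⟨S2, hS2⟩ := (isCompact_closedBall (0 : EuclideanSpace ℝ (Fin d)) ρ).exists_bound_of_continuousOn
    (hφ1.continuous_fderiv one_ne_zero).continuousOn
  refine ⟨|S2| * |Sσ| + |S1| * Kσ, by positivity, fun x hx x' hx' => ?_⟩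
  have h1 : ‖fderiv ℝ φ x - fderiv ℝ φ x'‖ ≤ |S2| * ‖x - x'‖ :=
    (convex_closedBall _ _).norm_image_sub_le_of_norm_fderiv_le
      (fun z _ => (hφ1.differentiable one_ne_zero) z)
      (fun z hz => (hS2 z hz).trans (le_abs_self _)) (hρ hx') (hρ hx)
  have e : (fderiv ℝ φ x).comp (σ x) - (fderiv ℝ φ x').comp (σ x') =
      (fderiv ℝ φ x - fderiv ℝ φ x').comp (σ x) + (fderiv ℝ φ x').comp (σ x - σ x') := by
    rw [ContinuousLinearMap.sub_comp, ContinuousLinearMap.comp_sub]; abel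
  rw [e]
  calc _ ≤ _ := norm_add_le _ _
    _ ≤ _ := add_le_add (ContinuousLinearMap.opNorm_comp_le _ _)
      (ContinuousLinearMap.opNorm_comp_le _ _)
    _ ≤ (|S2| * ‖x - x'‖) * |Sσ| + |S1| * (Kσ * ‖x - x'‖) := by
      gcongr
      · exact (hSσ x hx).trans (le_abs_self _)
      · exact (hS1 x' hx').trans (le_abs_self _)
      · exact hσ.norm_sub_le hx hx'
    _ = _ := by ring

/-- The variation of the reflection term over an interval on which the driving path is affine. -/
theorem exists_variation_affine (hO : IsAdmissible O) (hObdd : Bornology.IsBounded O)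
    (hσ : LipschitzOnWith Kσ σ (closure O)) (hb : LipschitzOnWith Kb b (closure O)) :
    ∃ (φ : EuclideanSpace ℝ (Fin d) → ℝ) (α C : ℝ), ContDiff ℝ 2 φ ∧ 0 < α ∧ 0 ≤ C ∧
      ∀ (a a' : ℝ) (ξ : EuclideanSpace ℝ (Fin r)) (x n : ℝ → EuclideanSpace ℝ (Fin d))
      (m : Measure ℝ), a ≤ a' → a' - a ≤ 1 →
      IsReflectedArc O a a' x (fun s => σ (x s) ξ + b (x s)) n m →
      α * m.real (Ioc a a') ≤ φ (x a') - φ (x a) -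
        fderiv ℝ φ (x a) (σ (x a) ((a' - a) • ξ)) + C * (‖(a' - a) • ξ‖ ^ 2 + (a' - a)) := by
  have hK : IsCompact (closure O) := hObdd.isCompact_closure
  obtain ⟨φ, α, hφ, hα, hφα⟩ := hO.exists_function
  obtain ⟨K, hK0, hKL⟩ := exists_lipschitz_clm_comp hObdd hσ hφ
  obtain ⟨C, hC0, hC⟩ := exists_oscillation_affine hO hObdd hσ.continuousOn hb.continuousOn
  have hφd : ContDiff ℝ 1 φ := hφ.of_le one_le_two
  have hφc : Continuous (fderiv ℝ φ) := hφd.continuous_fderiv one_ne_zero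
  obtain ⟨B, hB⟩ := hK.exists_bound_of_continuousOn
    (f := fun z => fderiv ℝ φ z (b z)) (hφc.continuousOn.clm_apply hb.continuousOn)
  refine ⟨φ, α, 2 * K * C + |B|, hφ, hα, by positivity, fun a a' ξ x n m hab hab1 hx => ?_⟩
  have := hx.nullSingleton
  set τ := a' - a with hτ
  have hτ0 : 0 ≤ τ := sub_nonneg.2 hab
  set μ : Fin 2 → Measure ℝ := ![volume, m] with hμ
  set q : Fin 2 → ℝ → EuclideanSpace ℝ (Fin d) := ![fun s => σ (x s) ξ + b (x s), n] with hq
  have hatom : ∀ i, NullSingletonClass (μ i) := by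
    intro i; fin_cases i
    · exact (inferInstance : NullSingletonClass (volume : Measure ℝ))
    · exact hx.nullSingleton
  have hqi : ∀ i, IntegrableOn (q i) (Icc a a') (μ i) := by
    intro i; fin_cases i
    · exact hx.integrable_drift
    · exact hx.integrable_normal
  have hchain := chain_rule hab hx.continuousOn (S := univ) (fun _ _ => mem_univ _) (f := φ)
    (f' := fderiv ℝ φ)
    (fun z _ => ((hφd.differentiable one_ne_zero) z).hasFDerivAt.hasFDerivWithinAt)
    hφc.continuousOn (μ := μ) (q := q) hqi (fun t ht => by
      rw [hx.eq_add t ht]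
      simp [Fin.sum_univ_two, hμ, hq, add_assoc])
  simp only [Fin.sum_univ_two, hμ, hq, Matrix.cons_val_zero, Matrix.cons_val_one] at hchain
  have hcont : ContinuousOn (fun s => fderiv ℝ φ (x s)) (Icc a a') :=
    hφc.comp_continuousOn hx.continuousOn
  -- Each unit of reflection raises `φ` by at least `α`, so the total reflection is paid for by the
  -- increment of `φ` minus the contribution of the drift.
  have hm : α * m.real (Ioc a a') ≤ ∫ s in Ioc a a', fderiv ℝ φ (x s) (n s) ∂m := by
    have h1 : ∫ _ in Ioc a a', α ∂m = α * m.real (Ioc a a') := by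
      rw [setIntegral_const, smul_eq_mul, mul_comm]
    rw [← h1]
    refine integral_mono_ae (integrableOn_const ?_) ?_ ?_
    · exact ((measure_mono Ioc_subset_Icc_self).trans_lt hx.measure_lt_top).ne
    · exact (integrableOn_clm_apply hcont hx.integrable_normal).mono_set Ioc_subset_Icc_self
    · filter_upwards [ae_restrict_of_ae_restrict_of_subset Ioc_subset_Icc_self hx.ae_normal]
        with s hs
      exact hφα _ hs.1 _ hs.2
  -- Freezing the coefficient of the noise at the left endpoint costs its Lipschitz constant times
  -- the oscillation, of order `‖Δ‖ + τ`, times `‖Δ‖`.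
  set Δ := τ • ξ with hΔ
  have hdr : fderiv ℝ φ (x a) (σ (x a) Δ) - (2 * K * C + |B|) * (‖Δ‖ ^ 2 + τ) ≤
      ∫ s in Ioc a a', fderiv ℝ φ (x s) (σ (x s) ξ + b (x s)) := by
    have hpt : ∀ s ∈ Ioc a a', fderiv ℝ φ (x a) (σ (x a) ξ) - K * (C * (‖Δ‖ + τ)) * ‖ξ‖ - |B| ≤
        fderiv ℝ φ (x s) (σ (x s) ξ + b (x s)) := by
      intro s hs
      have hsI : s ∈ Icc a a' := ⟨hs.1.le, hs.2⟩
      have h1 := hKL _ (hx.mem s hsI) _ (hx.mem a ⟨le_rfl, hab⟩)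
      have h2 := (hC a a' ξ x n m hx).2 s hsI
      have h3 := (abs_le.1 (ContinuousLinearMap.le_of_opNorm_le _
        (h1.trans (mul_le_mul_of_nonneg_left h2 hK0)) ξ)).1
      have h4 := (abs_le.1 ((hB _ (hx.mem s hsI)).trans (le_abs_self _))).1
      simp only [_root_.sub_apply, ContinuousLinearMap.comp_apply] at h3
      rw [map_add]
      linarith
    have h5 : ∫ _ in Ioc a a', (fderiv ℝ φ (x a) (σ (x a) ξ) - K * (C * (‖Δ‖ + τ)) * ‖ξ‖ - |B|) ≤
        ∫ s in Ioc a a', fderiv ℝ φ (x s) (σ (x s) ξ + b (x s)) := by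
      refine setIntegral_mono_on (integrableOn_const (by simp)) ?_ measurableSet_Ioc hpt
      exact (integrableOn_clm_apply hcont hx.integrable_drift).mono_set Ioc_subset_Icc_self
    refine le_trans ?_ h5
    rw [setIntegral_const]
    have h6 : volume.real (Ioc a a') = τ := by simp [hab, hτ]
    have h7 : ‖Δ‖ = τ * ‖ξ‖ := by rw [hΔ, norm_smul, Real.norm_of_nonneg hτ0]
    rw [h6, smul_eq_mul, hΔ, map_smul, map_smul, smul_eq_mul, ← hΔ]
    have h8 : τ * (K * (C * (‖Δ‖ + τ)) * ‖ξ‖) = K * C * ((‖Δ‖ + τ) * ‖Δ‖) := by rw [h7]; ring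
    -- The restriction to steps of length at most one serves to absorb the product `τ * ‖Δ‖`.
    have h9 : (‖Δ‖ + τ) * ‖Δ‖ ≤ 2 * (‖Δ‖ ^ 2 + τ) := by
      nlinarith [sq_nonneg (‖Δ‖ - τ)]
    have h10 : 0 ≤ K * C := by positivity
    have h11 := mul_le_mul_of_nonneg_left h9 h10
    have h12 : 0 ≤ |B| * ‖Δ‖ ^ 2 := by positivity
    nlinarith
  linarith

end Consequences

end WongZakai

namespace WongZakai

/-! ### The lifted process and its expansion over one affine step. -/

section OneStep

variable {d r : ℕ}

local notation "𝔼" => EuclideanSpace ℝ (Fin d)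
local notation "𝔽" => EuclideanSpace ℝ (Fin r)
local notation "𝕊" => EuclideanSpace ℝ (Fin d) × (EuclideanSpace ℝ (Fin d) × EuclideanSpace ℝ (Fin r))

/-- The diagonal embedding `x ↦ (x, x, 0)`. -/
noncomputable def diagIncl (d r : ℕ) : EuclideanSpace ℝ (Fin d) →L[ℝ]
    EuclideanSpace ℝ (Fin d) × (EuclideanSpace ℝ (Fin d) × EuclideanSpace ℝ (Fin r)) :=
  (ContinuousLinearMap.id ℝ _).prod ((ContinuousLinearMap.id ℝ _).prod 0)

/-- The diffusion coefficient `(σ(x), σ(x), 1)` of the process `(X, X - L, W)`. -/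
noncomputable def liftDiffusion (σ : 𝔼 → 𝔽 →L[ℝ] 𝔼) (z : 𝕊) : 𝔽 →L[ℝ] 𝕊 :=
  (diagIncl d r).comp (σ z.1) +
    (0 : 𝔽 →L[ℝ] 𝔼).prod ((0 : 𝔽 →L[ℝ] 𝔼).prod (ContinuousLinearMap.id ℝ _))

/-- The drift coefficient `(b(x), b(x), 0)` of the process `(X, X - L, W)`. -/
noncomputable def liftDrift (b : 𝔼 → 𝔼) (z : 𝕊) : 𝕊 := diagIncl d r (b z.1)

lemma diagIncl_apply (x : 𝔼) : diagIncl d r x = (x, (x, 0)) := rfl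

lemma liftDiffusion_apply (σ : 𝔼 → 𝔽 →L[ℝ] 𝔼) (z : 𝕊) (ξ : 𝔽) :
    liftDiffusion σ z ξ = (σ z.1 ξ, (σ z.1 ξ, ξ)) := by
  simp [liftDiffusion, diagIncl]

lemma norm_diagIncl_apply (x : 𝔼) : ‖diagIncl d r x‖ = ‖x‖ := by
  simp [diagIncl_apply, Prod.norm_def]

/-- The first-order coefficient of `dW` in `dH(X, X - L, W)`. -/
noncomputable def gradNoise (σ : 𝔼 → 𝔽 →L[ℝ] 𝔼) (H : 𝕊 → ℝ) (z : 𝕊) : 𝔽 →L[ℝ] ℝ :=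
  (fderiv ℝ H z).comp (liftDiffusion σ z)

/-- The second-order coefficient of `dW` in `dH(X, X - L, W)`. -/
noncomputable def hessNoise (O : Set 𝔼) (σ : 𝔼 → 𝔽 →L[ℝ] 𝔼) (H : 𝕊 → ℝ) (z : 𝕊) :
    𝔽 →L[ℝ] 𝔽 →L[ℝ] ℝ :=
  (fderivWithin ℝ (gradNoise σ H) (closure O ×ˢ univ) z).comp (liftDiffusion σ z)

/-- The trace of a bilinear form. -/
noncomputable def bilinTrace (A : 𝔽 →L[ℝ] 𝔽 →L[ℝ] ℝ) : ℝ :=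
  ∑ i, A (EuclideanSpace.single i 1) (EuclideanSpace.single i 1)

/-- The generator of the process `(X, X - L, W)`. -/
noncomputable def liftGen (O : Set 𝔼) (σ : 𝔼 → 𝔽 →L[ℝ] 𝔼) (b : 𝔼 → 𝔼) (H : 𝕊 → ℝ) (z : 𝕊) : ℝ :=
  (1 / 2 : ℝ) * bilinTrace (hessNoise O σ H z) + fderiv ℝ H z (liftDrift b z)

lemma bilinTrace_sub (A B : 𝔽 →L[ℝ] 𝔽 →L[ℝ] ℝ) :
    bilinTrace (A - B) = bilinTrace A - bilinTrace B := by
  simp [bilinTrace, Finset.sum_sub_distrib]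

lemma abs_bilinTrace_le (A : 𝔽 →L[ℝ] 𝔽 →L[ℝ] ℝ) : |bilinTrace A| ≤ r * ‖A‖ := by
  refine (Finset.abs_sum_le_sum_abs _ _).trans ?_
  calc _ ≤ ∑ _i : Fin r, ‖A‖ := Finset.sum_le_sum fun i _ => by
        have := A.le_opNorm₂ (EuclideanSpace.single i 1) (EuclideanSpace.single i 1)
        simpa using this
    _ = _ := by simp

lemma continuous_bilinTrace : Continuous (bilinTrace (r := r)) := by
  unfold bilinTrace; fun_prop

variable {O : Set (EuclideanSpace ℝ (Fin d))}
  {σ : EuclideanSpace ℝ (Fin d) → EuclideanSpace ℝ (Fin r) →L[ℝ] EuclideanSpace ℝ (Fin d)}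
  {b : EuclideanSpace ℝ (Fin d) → EuclideanSpace ℝ (Fin d)}
  {H : EuclideanSpace ℝ (Fin d) × (EuclideanSpace ℝ (Fin d) × EuclideanSpace ℝ (Fin r)) → ℝ}

lemma contDiffOn_liftDiffusion (hσ : ContDiffOn ℝ 1 σ (closure O)) :
    ContDiffOn ℝ 1 (liftDiffusion σ) (closure O ×ˢ (univ : Set (𝔼 × 𝔽))) := by
  have h1 : ContDiffOn ℝ 1 (fun z : 𝕊 => σ z.1) (closure O ×ˢ univ) :=
    hσ.comp contDiff_fst.contDiffOn fun z hz => hz.1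
  exact (contDiffOn_const.clm_comp h1).add contDiffOn_const

lemma contDiffOn_gradNoise (hσ : ContDiffOn ℝ 1 σ (closure O)) (hH : ContDiff ℝ 2 H) :
    ContDiffOn ℝ 1 (gradNoise σ H) (closure O ×ˢ univ) :=
  (hH.fderiv_right (by norm_num)).contDiffOn.clm_comp (contDiffOn_liftDiffusion hσ)

lemma uniqueDiffOn_closure_prod (hO : IsAdmissible O) :
    UniqueDiffOn ℝ (closure O ×ˢ (univ : Set (𝔼 × 𝔽))) :=
  (uniqueDiffOn_closure hO).prod uniqueDiffOn_univ

lemma continuousOn_fderivWithin_gradNoise (hO : IsAdmissible O) (hσ : ContDiffOn ℝ 1 σ (closure O))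
    (hH : ContDiff ℝ 2 H) :
    ContinuousOn (fderivWithin ℝ (gradNoise σ H) (closure O ×ˢ univ)) (closure O ×ˢ univ) :=
  (contDiffOn_gradNoise hσ hH).continuousOn_fderivWithin (uniqueDiffOn_closure_prod hO) le_rfl

lemma continuousOn_hessNoise (hO : IsAdmissible O) (hσ : ContDiffOn ℝ 1 σ (closure O))
    (hH : ContDiff ℝ 2 H) : ContinuousOn (hessNoise O σ H) (closure O ×ˢ univ) :=
  (continuousOn_fderivWithin_gradNoise hO hσ hH).clm_comp
    (contDiffOn_liftDiffusion hσ).continuousOn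

lemma continuousOn_liftGen (hO : IsAdmissible O) (hσ : ContDiffOn ℝ 1 σ (closure O))
    (hb : ContinuousOn b (closure O)) (hH : ContDiff ℝ 2 H) :
    ContinuousOn (liftGen O σ b H) (closure O ×ˢ univ) := by
  have h1 : ContinuousOn (fun z : 𝕊 => b z.1) (closure O ×ˢ univ) :=
    hb.comp continuousOn_fst fun z hz => hz.1
  refine (continuousOn_const.mul (continuous_bilinTrace.comp_continuousOn
    (continuousOn_hessNoise hO hσ hH))).add ?_
  exact (hH.continuous_fderiv two_ne_zero).continuousOn.clm_apply
    ((diagIncl d r).continuous.comp_continuousOn h1)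

/-- Source of the Stratonovich factor ½: when the coefficient of the noise grows linearly along the
step, its integral carries half of the square of the step. -/
lemma integral_affine {a a' : ℝ} (h : a ≤ a') (c₀ c₁ : ℝ) :
    ∫ u in Ioc a a', (c₀ + (u - a) * c₁) = (a' - a) * c₀ + (a' - a) ^ 2 / 2 * c₁ := by
  rw [← intervalIntegral.integral_of_le h]
  have hd : ∀ u ∈ uIcc a a', HasDerivAt (fun u => c₀ * u + (u - a) ^ 2 / 2 * c₁)
      (c₀ + (u - a) * c₁) u := by
    intro u _
    have h1 : HasDerivAt (fun u => (u - a) ^ 2 / 2 * c₁) ((u - a) * c₁) u :=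
      (((((hasDerivAt_id u).sub_const a).pow 2).div_const 2).mul_const c₁).congr_deriv (by simp)
    exact (((hasDerivAt_id u).const_mul c₀).add h1).congr_deriv (by simp)
  rw [intervalIntegral.integral_eq_sub_of_hasDerivAt hd
    (Continuous.intervalIntegrable (by fun_prop) _ _)]
  ring

/-- The second-order expansion of `H(X, X - L, W)` over an interval on which `W` is affine. -/
theorem one_step_expansion (hO : IsAdmissible O) (hσ : ContDiffOn ℝ 1 σ (closure O))
    (hb : ContinuousOn b (closure O)) (hH : ContDiff ℝ 2 H)
    (hn : ∀ x ∈ frontier O, ∀ n ∈ inwardNormals O x, ∀ p, 0 ≤ fderiv ℝ H (x, p) (n, 0))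
    {M B : ℝ} (hM : ∀ z ∈ closure O ×ˢ univ,
      ‖fderivWithin ℝ (gradNoise σ H) (closure O ×ˢ univ) z‖ ≤ M)
    (hB : ∀ x ∈ closure O, ‖b x‖ ≤ B) {a a' ω : ℝ} (hab : a ≤ a') {ξ : 𝔽}
    {x n y : ℝ → 𝔼} {w : ℝ → 𝔽} {m : Measure ℝ}
    (hx : IsReflectedArc O a a' x (fun s => σ (x s) ξ + b (x s)) n m)
    (hy : ∀ t ∈ Icc a a', y t = y a + ∫ s in Ioc a t, (σ (x s) ξ + b (x s)))
    (hw : ∀ t ∈ Icc a a', w t = w a + (t - a) • ξ)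
    (hω : ∀ s ∈ Icc a a', ‖hessNoise O σ H (x s, (y s, w s)) -
      hessNoise O σ H (x a, (y a, w a))‖ ≤ ω) :
    gradNoise σ H (x a, (y a, w a)) ((a' - a) • ξ) +
      (1 / 2 : ℝ) * (hessNoise O σ H (x a, (y a, w a)) ((a' - a) • ξ) ((a' - a) • ξ) -
        (a' - a) * bilinTrace (hessNoise O σ H (x a, (y a, w a)))) -
      (M * B * ((a' - a) * ‖(a' - a) • ξ‖) + M * (‖(a' - a) • ξ‖ * m.real (Ioc a a')) +
        ω * (‖(a' - a) • ξ‖ ^ 2 + r * (a' - a))) ≤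
      H (x a', (y a', w a')) - H (x a, (y a, w a)) -
        ∫ s in Ioc a a', liftGen O σ b H (x s, (y s, w s)) := by
  have := hx.nullSingleton
  have haI : a ∈ Icc a a' := ⟨le_rfl, hab⟩
  set z : ℝ → 𝕊 := fun s => (x s, (y s, w s)) with hz
  set v : ℝ → 𝔼 := fun s => σ (x s) ξ + b (x s) with hv
  have hvI : IntegrableOn v (Icc a a') := hx.integrable_drift
  have hsub : ∀ t ∈ Icc a a', Ioc a t ⊆ Icc a a' := fun t ht s hs => ⟨hs.1.le, hs.2.trans ht.2⟩
  have hyc : ContinuousOn y (Icc a a') :=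
    (continuousOn_const.add (intervalIntegral.continuousOn_primitive hvI)).congr hy
  have hwc : ContinuousOn w (Icc a a') := by
    refine ContinuousOn.congr (f := fun t => w a + (t - a) • ξ) ?_ hw
    fun_prop
  have hzc : ContinuousOn z (Icc a a') := hx.continuousOn.prodMk (hyc.prodMk hwc)
  have hzS : ∀ s ∈ Icc a a', z s ∈ closure O ×ˢ (univ : Set (𝔼 × 𝔽)) :=
    fun s hs => ⟨hx.mem s hs, mem_univ _⟩
  have hM0 : 0 ≤ M := le_trans (norm_nonneg
    (fderivWithin ℝ (gradNoise σ H) (closure O ×ˢ univ) (z a))) (hM _ (hzS a haI))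
  set μ : Fin 2 → Measure ℝ := ![volume, m] with hμ
  -- The reflection moves the first component only; X - L and W do not see the measure `m`.
  set q : Fin 2 → ℝ → 𝕊 := ![fun s => (v s, (v s, ξ)), fun s => (n s, 0)] with hq
  have hatom : ∀ i, NullSingletonClass (μ i) := by
    intro i; fin_cases i
    · exact (inferInstance : NullSingletonClass (volume : Measure ℝ))
    · exact hx.nullSingleton
  have hq0 : IntegrableOn (fun s => (v s, (v s, ξ))) (Icc a a') :=
    hvI.prodMk (hvI.prodMk (integrableOn_const (by simp)))
  have hq1 : IntegrableOn (fun s => (n s, (0 : 𝔼 × 𝔽))) (Icc a a') m :=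
    hx.integrable_normal.prodMk (integrable_zero _ _ _)
  have hqi : ∀ i, IntegrableOn (q i) (Icc a a') (μ i) := by
    intro i; fin_cases i
    · exact hq0
    · exact hq1
  have hZq : ∀ t ∈ Icc a a', z t = z a + ∑ i, ∫ s in Ioc a t, q i s ∂μ i := by
    intro t ht
    have e0 := hvI.mono_set (hsub t ht)
    have e2 : IntegrableOn (fun _ : ℝ => ξ) (Ioc a t) := integrableOn_const (by simp)
    simp only [Fin.sum_univ_two, hμ, hq, Matrix.cons_val_zero, Matrix.cons_val_one]
    rw [integral_pair e0 (e0.prodMk e2), integral_pair e0 e2,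
      integral_pair (hx.integrable_normal.mono_set (hsub t ht)) (integrable_zero _ _ _)]
    simp only [hz]
    rw [hx.eq_add t ht, hy t ht, hw t ht]
    simp [add_assoc, ht.1]
  have hqz : ∀ s, (v s, (v s, ξ)) = liftDiffusion σ (z s) ξ + liftDrift b (z s) := by
    intro s
    simp [liftDiffusion_apply, liftDrift, diagIncl_apply, hz, hv]
  -- first-order expansion
  have hHc : Continuous (fderiv ℝ H) := hH.continuous_fderiv two_ne_zero
  have hfirst := chain_rule hab hzc (S := univ) (fun _ _ => mem_univ _) (f := H)
    (f' := fderiv ℝ H)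
    (fun p _ => ((hH.differentiable two_ne_zero) p).hasFDerivAt.hasFDerivWithinAt)
    hHc.continuousOn (μ := μ) (q := q) hqi hZq
  simp only [Fin.sum_univ_two, hμ, hq, Matrix.cons_val_zero, Matrix.cons_val_one] at hfirst
  have hpos : 0 ≤ ∫ s in Ioc a a', fderiv ℝ H (z s) (n s, 0) ∂m := by
    refine integral_nonneg_of_ae ?_
    filter_upwards [ae_restrict_of_ae_restrict_of_subset Ioc_subset_Icc_self hx.ae_normal]
      with s hs
    exact hn _ hs.1 _ hs.2 _
  have hGc : ContinuousOn (fun s => gradNoise σ H (z s)) (Icc a a') :=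
    (contDiffOn_gradNoise hσ hH).continuousOn.comp hzc hzS
  have hAc : ContinuousOn (fun s => hessNoise O σ H (z s)) (Icc a a') :=
    (continuousOn_hessNoise hO hσ hH).comp hzc hzS
  have hgen : IntegrableOn (fun s => liftGen O σ b H (z s)) (Ioc a a') :=
    (((continuousOn_liftGen hO hσ hb hH).comp hzc hzS).integrableOn_Icc).mono_set
      Ioc_subset_Icc_self
  have hI1 : IntegrableOn (fun s => fderiv ℝ H (z s) (v s, (v s, ξ))) (Ioc a a') :=
    (integrableOn_clm_apply (hHc.comp_continuousOn hzc) hq0).mono_set Ioc_subset_Icc_self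
  -- The drift cancels against the first-order part of the generator, and the reflection integral is
  -- dropped by its sign. This is where the boundary condition on `H` enters.
  have hred : ∫ s in Ioc a a', (gradNoise σ H (z s) ξ -
      (1 / 2 : ℝ) * bilinTrace (hessNoise O σ H (z s))) ≤
      H (z a') - H (z a) - ∫ s in Ioc a a', liftGen O σ b H (z s) := by
    rw [hfirst, add_sub_right_comm, ← integral_sub hI1 hgen]
    refine le_add_of_le_of_nonneg (le_of_eq (integral_congr_ae (ae_of_all _ fun s => ?_))) hpos
    simp only [hqz, map_add, liftGen, gradNoise, ContinuousLinearMap.comp_apply]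
    ring
  refine le_trans ?_ hred
  -- expansion of the coefficient of the noise
  set A₀ := hessNoise O σ H (z a) with hA₀
  have hcoef : ∀ u ∈ Icc a a', gradNoise σ H (z a) ξ + (u - a) * (A₀ ξ ξ - ω * ‖ξ‖ ^ 2) -
      (a' - a) * (M * B * ‖ξ‖) - M * ‖ξ‖ * m.real (Ioc a a') ≤ gradNoise σ H (z u) ξ := by
    intro u hu
    have husub : Icc a u ⊆ Icc a a' := Icc_subset_Icc le_rfl hu.2
    -- The coefficient involves σ, so its derivative is taken within the closed domain. Its
    -- reflection term has no sign and is bounded by `M * ‖ξ‖` times the variation; this produces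
    -- the delicate error.
    have hch := chain_rule hu.1 (hzc.mono husub) (S := closure O ×ˢ univ)
      (fun s hs => hzS s (husub hs)) (f := gradNoise σ H)
      (f' := fderivWithin ℝ (gradNoise σ H) (closure O ×ˢ univ))
      (fun p hp => ((contDiffOn_gradNoise hσ hH).differentiableOn one_ne_zero p hp).hasFDerivWithinAt)
      (continuousOn_fderivWithin_gradNoise hO hσ hH) (μ := μ) (q := q)
      (fun i => (hqi i).mono_set husub) (fun t ht => hZq t (husub ht))
    simp only [Fin.sum_univ_two, hμ, hq, Matrix.cons_val_zero, Matrix.cons_val_one] at hch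
    set D := fderivWithin ℝ (gradNoise σ H) (closure O ×ˢ univ) with hD
    have hDc : ContinuousOn (fun s => D (z s)) (Icc a a') :=
      (continuousOn_fderivWithin_gradNoise hO hσ hH).comp hzc hzS
    have i0 : IntegrableOn (fun s => D (z s) (v s, (v s, ξ))) (Ioc a u) :=
      (integrableOn_clm_apply hDc hq0).mono_set (hsub u hu)
    have i1 : IntegrableOn (fun s => D (z s) (n s, 0)) (Ioc a u) m :=
      (integrableOn_clm_apply hDc hq1).mono_set (hsub u hu)
    have hch' : gradNoise σ H (z u) ξ - gradNoise σ H (z a) ξ =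
        (∫ s in Ioc a u, D (z s) (v s, (v s, ξ)) ξ) + ∫ s in Ioc a u, D (z s) (n s, 0) ξ ∂m := by
      have e0 := ContinuousLinearMap.integral_apply i0 ξ
      have e1 := ContinuousLinearMap.integral_apply i1 ξ
      rw [← _root_.sub_apply, hch, _root_.add_apply, e0, e1]
    have b0 : (u - a) * (A₀ ξ ξ - ω * ‖ξ‖ ^ 2 - M * B * ‖ξ‖) ≤
        ∫ s in Ioc a u, D (z s) (v s, (v s, ξ)) ξ := by
      have : ∫ _ in Ioc a u, (A₀ ξ ξ - ω * ‖ξ‖ ^ 2 - M * B * ‖ξ‖) =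
          (u - a) * (A₀ ξ ξ - ω * ‖ξ‖ ^ 2 - M * B * ‖ξ‖) := by
        rw [setIntegral_const]; simp [hu.1]
      rw [← this]
      refine setIntegral_mono_on (integrableOn_const (by simp))
        ((ContinuousLinearMap.apply ℝ ℝ ξ).integrable_comp i0) measurableSet_Ioc fun s hs => ?_
      have hsI := hsub u hu hs
      have h1 : D (z s) (v s, (v s, ξ)) ξ = hessNoise O σ H (z s) ξ ξ +
          D (z s) (liftDrift b (z s)) ξ := by
        rw [hqz, map_add, _root_.add_apply]; rfl
      have h2 := (abs_le.1 ((hessNoise O σ H (z s) - A₀).le_of_opNorm₂_le_of_le (hω s hsI)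
        le_rfl le_rfl : |(hessNoise O σ H (z s) - A₀) ξ ξ| ≤ ω * ‖ξ‖ * ‖ξ‖)).1
      have h3 := (abs_le.1 ((D (z s)).le_of_opNorm₂_le_of_le (hM _ (hzS s hsI))
        (le_of_eq_of_le (norm_diagIncl_apply _) (hB _ (hx.mem s hsI))) le_rfl :
          |D (z s) (liftDrift b (z s)) ξ| ≤ M * B * ‖ξ‖)).1
      rw [h1]
      simp only [_root_.sub_apply] at h2
      linarith
    have b1 : -(M * ‖ξ‖ * m.real (Ioc a a')) ≤ ∫ s in Ioc a u, D (z s) (n s, 0) ξ ∂m := by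
      have hfin : m (Ioc a a') < ∞ := (measure_mono Ioc_subset_Icc_self).trans_lt hx.measure_lt_top
      have hmu : m.real (Ioc a u) ≤ m.real (Ioc a a') :=
        measureReal_mono (Ioc_subset_Ioc_right hu.2) hfin.ne
      have h1 : ‖∫ s in Ioc a u, D (z s) (n s, 0) ξ ∂m‖ ≤ M * ‖ξ‖ * m.real (Ioc a u) := by
        refine norm_setIntegral_le_of_norm_le_const_ae
          ((measure_mono (Ioc_subset_Ioc_right hu.2)).trans_lt hfin) ?_
        filter_upwards [ae_restrict_of_ae_restrict_of_subset (hsub u hu) hx.ae_normal,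
          ae_restrict_mem measurableSet_Ioc] with s hs hsI
        have h2 : ‖(n s, (0 : 𝔼 × 𝔽))‖ ≤ 1 := by
          simp [Prod.norm_def, hs.2.1]
        have h3 := (D (z s)).le_of_opNorm₂_le_of_le (hM _ (hzS s (hsub u hu hsI))) h2 (le_refl ‖ξ‖)
        simpa using h3
      have h2 := (abs_le.1 h1).1
      have : M * ‖ξ‖ * m.real (Ioc a u) ≤ M * ‖ξ‖ * m.real (Ioc a a') := by gcongr
      linarith
    have hB0 : 0 ≤ B := (norm_nonneg _).trans (hB _ (hx.mem a haI))
    have h4 : (u - a) * (M * B * ‖ξ‖) ≤ (a' - a) * (M * B * ‖ξ‖) := by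
      have := hu.2
      gcongr
    linarith
  have hω0 : 0 ≤ ω := le_trans (norm_nonneg (hessNoise O σ H (z a) - A₀)) (hω a haI)
  have htr : ∀ u ∈ Icc a a', bilinTrace (hessNoise O σ H (z u)) ≤ bilinTrace A₀ + r * ω := by
    intro u hu
    have h1 := (abs_le.1 (abs_bilinTrace_le (hessNoise O σ H (z u) - A₀))).2
    rw [bilinTrace_sub] at h1
    have h2 : (r : ℝ) * ‖hessNoise O σ H (z u) - A₀‖ ≤ r * ω := by
      gcongr; exact hω u hu
    linarith
  have hint : ∫ u in Ioc a a', ((gradNoise σ H (z a) ξ - (a' - a) * (M * B * ‖ξ‖) -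
      M * ‖ξ‖ * m.real (Ioc a a') - (1 / 2 : ℝ) * (bilinTrace A₀ + r * ω)) +
      (u - a) * (A₀ ξ ξ - ω * ‖ξ‖ ^ 2)) ≤
      ∫ s in Ioc a a', (gradNoise σ H (z s) ξ -
      (1 / 2 : ℝ) * bilinTrace (hessNoise O σ H (z s))) := by
    refine setIntegral_mono_on ?_ ?_ measurableSet_Ioc fun u hu => ?_
    · exact (Continuous.integrableOn_Icc (by fun_prop)).mono_set Ioc_subset_Icc_self
    · refine (ContinuousOn.integrableOn_Icc ?_).mono_set Ioc_subset_Icc_self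
      exact (hGc.clm_apply continuousOn_const).sub
        (continuousOn_const.mul (continuous_bilinTrace.comp_continuousOn hAc))
    · have h1 := hcoef u (Ioc_subset_Icc_self hu)
      have h2 := htr u (Ioc_subset_Icc_self hu)
      linarith
  refine le_trans ?_ hint
  rw [integral_affine hab]
  have hτ : 0 ≤ a' - a := sub_nonneg.2 hab
  set τ := a' - a with hτd
  have hnorm : ‖τ • ξ‖ = τ * ‖ξ‖ := by rw [norm_smul, Real.norm_of_nonneg hτ]
  rw [hnorm]
  simp only [map_smul, _root_.smul_apply, smul_eq_mul]
  have h1 : 0 ≤ ω * (τ * ‖ξ‖) ^ 2 := by positivity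
  have h2 : 0 ≤ ω * (r * τ) := by positivity
  change _ + (1 / 2 : ℝ) * (τ * (τ * A₀ ξ ξ) - τ * bilinTrace A₀) - _ ≤ _
  change τ * gradNoise σ H (z a) ξ + _ - _ ≤ _
  nlinarith

end OneStep

end WongZakai

namespace WongZakai

/-! ### Independence and moments of Wiener increments. -/

section Wiener

/-- Past and future of one coordinate become a family over `Bool`, the form in which
`iIndepFun_uncurry'` combines them with the independence across coordinates. -/
lemma iIndepFun_bool {Ω β : Type*} {mΩ : MeasurableSpace Ω} {mβ : MeasurableSpace β}
    {μ : Measure Ω} [IsProbabilityMeasure μ] {f : Bool → Ω → β}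
    (h : IndepFun (f true) (f false) μ) : iIndepFun f μ := by
  rw [iIndepFun_iff_measure_inter_preimage_eq_mul]
  intro S sets hS
  rw [indepFun_iff_measure_inter_preimage_eq_mul] at h
  obtain rfl | rfl | rfl | rfl : S = ∅ ∨ S = {true} ∨ S = {false} ∨ S = {true, false} := by
    clear hS h; revert S; decide
  · simp
  · simp
  · simp
  · have := h (sets true) (sets false) (hS _ (by simp)) (hS _ (by simp))
    simp only [Finset.mem_insert, Finset.mem_singleton, iInter_iInter_eq_or_left,
      iInter_iInter_eq_left]
    rw [this, Finset.prod_pair (by simp)]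

variable {r : ℕ}

local notation "𝔽" => EuclideanSpace ℝ (Fin r)
local notation "ℂ₀" => C(ℝ≥0, EuclideanSpace ℝ (Fin r))

/-- The values of a path along a dense sequence of times. -/
noncomputable def denseEval (r : ℕ) (w : C(ℝ≥0, EuclideanSpace ℝ (Fin r))) (n : ℕ) : EuclideanSpace ℝ (Fin r) :=
  w (TopologicalSpace.denseSeq ℝ≥0 n)

/-- An injective Borel map out of a Polish space is a measurable embedding (Lusin–Souslin). So the
Borel field of the path space is generated by countably many evaluations, and independence and
measurability can be checked on them. -/
lemma measurableEmbedding_denseEval : MeasurableEmbedding (denseEval r) := by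
  refine Measurable.measurableEmbedding ?_ ?_
  · exact measurable_pi_lambda _ fun n => (continuous_eval_const _).measurable
  · intro w w' h
    refine DFunLike.coe_injective ((TopologicalSpace.denseRange_denseSeq ℝ≥0).equalizer
      w.continuous w'.continuous ?_)
    exact h

/-- The path stopped at time `a`. -/
def stopPath {Y : Type*} [TopologicalSpace Y] (a : ℝ≥0) (w : C(ℝ≥0, Y)) : C(ℝ≥0, Y) :=
  w.comp ⟨fun u => min u a, by fun_prop⟩

lemma stopPath_apply {Y : Type*} [TopologicalSpace Y] (a : ℝ≥0) (w : C(ℝ≥0, Y)) (u : ℝ≥0) :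
    stopPath a w u = w (min u a) := rfl

lemma continuous_stopPath {Y : Type*} [TopologicalSpace Y] (a : ℝ≥0) :
    Continuous (stopPath (Y := Y) a) := ContinuousMap.continuous_precomp _

/-- The increments of the path after time `a`. -/
def futurePath (a : ℝ≥0) (w : C(ℝ≥0, EuclideanSpace ℝ (Fin r))) : C(ℝ≥0, EuclideanSpace ℝ (Fin r)) :=
  w.comp ⟨fun u => max u a, by fun_prop⟩ - ContinuousMap.const _ (w a)

lemma futurePath_apply (a : ℝ≥0) (w : ℂ₀) (u : ℝ≥0) : futurePath a w u = w (max u a) - w a := rfl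

lemma continuous_futurePath (a : ℝ≥0) : Continuous (futurePath (r := r) a) :=
  (ContinuousMap.continuous_precomp _).sub
    (ContinuousMap.continuous_const'.comp (continuous_eval_const a))

lemma stopPath_add_futurePath (a : ℝ≥0) (w : ℂ₀) : stopPath a w + futurePath a w = w := by
  ext1 u
  rw [ContinuousMap.add_apply, stopPath_apply, futurePath_apply]
  rcases le_total u a with h | h <;> simp [h]

variable {𝕎 : Measure C(ℝ≥0, EuclideanSpace ℝ (Fin r))} [IsProbabilityMeasure 𝕎]

/-- The pasts and futures of all coordinates are jointly independent; the two blocks are then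
grouped. -/
lemma IsWienerMeasure.indepFun_coordinates (h𝕎 : IsWienerMeasure 𝕎) (a : ℝ≥0) :
    IndepFun (fun (w : ℂ₀) (i : Fin r) (t : ℝ≥0) => w (min t a) i)
      (fun (w : ℂ₀) (i : Fin r) (t : ℝ≥0) => w (a + t) i - w a i) 𝕎 := by
  set X : Fin r → Bool → ℂ₀ → (ℝ≥0 → ℝ) := fun i j w t =>
    if j then w (min t a) i else w (a + t) i - w a i with hX
  have hev : ∀ (i : Fin r) (t : ℝ≥0), Measurable fun w : ℂ₀ => w t i := fun i t => by
    have : Continuous fun w : ℂ₀ => w t i := by fun_prop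
    exact this.measurable
  have mX : ∀ i j, Measurable (X i j) := by
    intro i j
    refine measurable_pi_lambda _ fun t => ?_
    cases j
    · exact (hev i _).sub (hev i _)
    · simpa [hX] using hev i _
  have h1 : ProbabilityTheory.iIndepFun (fun i w x => X i x w) 𝕎 := by
    have hi := h𝕎.iIndepFun
    refine hi.comp (fun _ (p : ℝ≥0 → ℝ) (j : Bool) (t : ℝ≥0) =>
      if j then p (min t a) else p (a + t) - p a) fun i => ?_
    refine measurable_pi_lambda _ fun j => measurable_pi_lambda _ fun t => ?_
    cases j
    · have h : Measurable fun p : ℝ≥0 → ℝ => p (a + t) - p a := by fun_prop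
      simpa using h
    · simpa using measurable_pi_apply (X := fun _ : ℝ≥0 => ℝ) (min t a)
  have h2 : ∀ i, ProbabilityTheory.iIndepFun (X i) 𝕎 := by
    intro i
    refine iIndepFun_bool ?_
    have h3 := ((h𝕎.isBrownianReal i).toIsPreBrownianReal.indepFun_shift a).symm
    have h4 := h3.comp (φ := fun (p : Iic a → ℝ) (t : ℝ≥0) => p ⟨min t a, mem_Iic.2 (min_le_right _ _)⟩)
      (ψ := id) (measurable_pi_lambda _ fun t =>
        measurable_pi_apply (X := fun _ : Iic a => ℝ) ⟨min t a, mem_Iic.2 (min_le_right _ _)⟩) measurable_id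
    exact h4
  have h3 := iIndepFun_uncurry' mX h1 h2
  have h4 := h3.indepFun_finset (Finset.univ ×ˢ {true}) (Finset.univ ×ˢ {false})
    (by rw [Finset.disjoint_product]; right; simp) (fun p => mX p.1 p.2)
  refine h4.comp
    (φ := fun p i t => p ⟨(i, true), by simp⟩ t) (ψ := fun p i t => p ⟨(i, false), by simp⟩ t) ?_ ?_
  · exact measurable_pi_lambda _ fun i => measurable_pi_lambda _ fun t =>
      (measurable_pi_apply t).comp (measurable_pi_apply _)
  · exact measurable_pi_lambda _ fun i => measurable_pi_lambda _ fun t =>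
      (measurable_pi_apply t).comp (measurable_pi_apply _)

/-- Past and future of a Wiener path are independent. -/
lemma IsWienerMeasure.indepFun_stopPath_futurePath (h𝕎 : IsWienerMeasure 𝕎) (a : ℝ≥0) :
    IndepFun (stopPath a) (futurePath a) 𝕎 := by
  have h1 := (h𝕎.indepFun_coordinates a).comp
    (φ := fun (p : Fin r → ℝ≥0 → ℝ) (n : ℕ) =>
      (WithLp.toLp 2 fun i => p i (TopologicalSpace.denseSeq ℝ≥0 n) : 𝔽))
    (ψ := fun (p : Fin r → ℝ≥0 → ℝ) (n : ℕ) =>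
      (WithLp.toLp 2 fun i => p i (TopologicalSpace.denseSeq ℝ≥0 n - a) : 𝔽))
    (measurable_pi_lambda _ fun n => (WithLp.measurable_toLp 2 _).comp
      (measurable_pi_lambda _ fun i => (measurable_pi_apply _).comp (measurable_pi_apply i)))
    (measurable_pi_lambda _ fun n => (WithLp.measurable_toLp 2 _).comp
      (measurable_pi_lambda _ fun i => (measurable_pi_apply _).comp (measurable_pi_apply i)))
  have h2 : IndepFun (denseEval r ∘ stopPath a) (denseEval r ∘ futurePath a) 𝕎 := by
    convert h1 using 1
    · rfl
    funext w n
    ext i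
    simp only [Function.comp_apply, denseEval, futurePath_apply, PiLp.sub_apply]
    rw [add_comm a, tsub_add_eq_max]
  rw [IndepFun_iff_Indep] at h2 ⊢
  rwa [← MeasurableSpace.comap_comp, ← MeasurableSpace.comap_comp,
    measurableEmbedding_denseEval.comap_eq] at h2

/-- Follow the first path up to time `a` and the increments of the second one afterwards. -/
def splice (a : ℝ≥0) (p : C(ℝ≥0, EuclideanSpace ℝ (Fin r)) × C(ℝ≥0, EuclideanSpace ℝ (Fin r))) :
    C(ℝ≥0, EuclideanSpace ℝ (Fin r)) :=
  stopPath a p.1 + futurePath a p.2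

lemma splice_apply_of_le {a u : ℝ≥0} (h : u ≤ a) (p : ℂ₀ × ℂ₀) : splice a p u = p.1 u := by
  rw [splice, ContinuousMap.add_apply, stopPath_apply, futurePath_apply]; simp [h]

lemma splice_sub_splice {a a' : ℝ≥0} (h : a ≤ a') (p : ℂ₀ × ℂ₀) :
    splice a p a' - splice a p a = p.2 a' - p.2 a := by
  rw [splice_apply_of_le le_rfl, splice, ContinuousMap.add_apply, stopPath_apply, futurePath_apply]
  simp [h]

/-- Stopped path and later increments are independent and add up to the path, so the increments may
be replaced by those of an independent copy. -/
lemma IsWienerMeasure.measurePreserving_splice (h𝕎 : IsWienerMeasure 𝕎) (a : ℝ≥0) :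
    MeasurePreserving (splice a) (𝕎.prod 𝕎) 𝕎 := by
  have m1 : Measurable (stopPath (Y := 𝔽) a) := (continuous_stopPath a).measurable
  have m2 : Measurable (futurePath (r := r) a) := (continuous_futurePath a).measurable
  have m3 : Measurable (fun p : ℂ₀ × ℂ₀ => p.1 + p.2) := continuous_add.measurable
  refine ⟨m3.comp (m1.prodMap m2), ?_⟩
  have e : splice (r := r) a = (fun p : ℂ₀ × ℂ₀ => p.1 + p.2) ∘ Prod.map (stopPath a) (futurePath a) :=
    rfl
  rw [e, ← Measure.map_map m3 (m1.prodMap m2), ← Measure.map_prod_map _ _ m1 m2,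
    ← (indepFun_iff_map_prod_eq_prod_map_map m1.aemeasurable m2.aemeasurable).1
      (h𝕎.indepFun_stopPath_futurePath a), Measure.map_map m3 (m1.prodMk m2)]
  have : ((fun p : ℂ₀ × ℂ₀ => p.1 + p.2) ∘ fun w => (stopPath a w, futurePath a w)) = id := by
    funext w; exact stopPath_add_futurePath a w
  rw [this, Measure.map_id]

/-- A functional of the path only depends on the restriction to `[0, a]`. -/
def DependsOnPast {α : Type*} (a : ℝ≥0) (Φ : C(ℝ≥0, EuclideanSpace ℝ (Fin r)) → α) : Prop :=
  ∀ w w', (∀ u ≤ a, w u = w' u) → Φ w = Φ w'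

variable {a a' : ℝ≥0} {Φ : C(ℝ≥0, EuclideanSpace ℝ (Fin r)) → ℝ} {ψ : EuclideanSpace ℝ (Fin r) → ℝ}

/-- On a spliced path a functional of the past reads the first path only and the increment reads the
second only. Together with Fubini, this pointwise factorisation replaces measurability with respect
to the past. -/
lemma DependsOnPast.mul_comp_splice (hΦ : DependsOnPast a Φ) (h : a ≤ a') (p : ℂ₀ × ℂ₀) :
    Φ (splice a p) * ψ (splice a p a' - splice a p a) = Φ p.1 * ψ (p.2 a' - p.2 a) := by
  rw [splice_sub_splice h, hΦ (splice a p) p.1 fun u hu => splice_apply_of_le hu p]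

lemma measurable_comp_increment (hψ : Measurable ψ) :
    Measurable fun w : ℂ₀ => ψ (w a' - w a) := by
  refine hψ.comp (Continuous.measurable ?_); fun_prop

/-- The increments of a Wiener path are independent of functionals of the past; no measurability
with respect to the past is required. -/
theorem IsWienerMeasure.integral_mul_increment (h𝕎 : IsWienerMeasure 𝕎) (h : a ≤ a')
    (hΦ : DependsOnPast a Φ) (hΦm : AEStronglyMeasurable Φ 𝕎) (hψ : Measurable ψ) :
    ∫ w, Φ w * ψ (w a' - w a) ∂𝕎 = (∫ w, Φ w ∂𝕎) * ∫ w, ψ (w a' - w a) ∂𝕎 := by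
  have hm : AEStronglyMeasurable (fun w : ℂ₀ => Φ w * ψ (w a' - w a)) 𝕎 :=
    hΦm.mul (measurable_comp_increment hψ).aestronglyMeasurable
  have hs := h𝕎.measurePreserving_splice a
  rw [← integral_prod_mul, ← hs.map_eq, integral_map hs.measurable.aemeasurable
    (by rwa [hs.map_eq]), hs.map_eq]
  exact integral_congr_ae (ae_of_all _ fun p => hΦ.mul_comp_splice h p)

theorem IsWienerMeasure.integrable_mul_increment (h𝕎 : IsWienerMeasure 𝕎) (h : a ≤ a')
    (hΦ : DependsOnPast a Φ) (hΦi : Integrable Φ 𝕎) (hψ : Measurable ψ)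
    (hψi : Integrable (fun w : ℂ₀ => ψ (w a' - w a)) 𝕎) :
    Integrable (fun w : ℂ₀ => Φ w * ψ (w a' - w a)) 𝕎 := by
  have hm : AEStronglyMeasurable (fun w : ℂ₀ => Φ w * ψ (w a' - w a)) 𝕎 :=
    hΦi.1.mul (measurable_comp_increment hψ).aestronglyMeasurable
  have hs := h𝕎.measurePreserving_splice a
  rw [← hs.integrable_comp hm]
  refine (hΦi.mul_prod hψi).congr (ae_of_all _ fun p => ?_)
  exact (hΦ.mul_comp_splice h p).symm

/-- By scaling. Only the order `v ^ 2` matters, so the constant is left unevaluated. -/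
lemma integral_pow_four_gaussianReal (v : ℝ≥0) :
    ∫ x, x ^ 4 ∂gaussianReal 0 v = v ^ 2 * ∫ x, x ^ 4 ∂gaussianReal 0 1 := by
  have h := gaussianReal_map_const_mul (μ := 0) (v := 1) (√v)
  have e : gaussianReal (√v * 0) (NNReal.mk (√v ^ 2) (sq_nonneg _) * 1) = gaussianReal 0 v := by
    congr 1
    · simp
    · rw [mul_one]; ext; simp
  rw [e] at h
  rw [← h, integral_map (by fun_prop) (by fun_prop), ← integral_const_mul]
  congr 1
  ext x
  rw [mul_pow]
  congr 1
  rw [show (4 : ℕ) = 2 * 2 by norm_num, pow_mul, Real.sq_sqrt (NNReal.coe_nonneg v)]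

section Moments

lemma IsWienerMeasure.hasLaw_increment (h𝕎 : IsWienerMeasure 𝕎) (h : a ≤ a') (i : Fin r) :
    HasLaw (fun w : ℂ₀ => (w a' - w a) i) (gaussianReal 0 (a' - a)) 𝕎 := by
  have h1 := (h𝕎.isBrownianReal i).toIsPreBrownianReal.hasLaw_sub a' a
  have e : nndist a'.1 a.1 = a' - a := by
    ext
    rw [coe_nndist, Real.dist_eq, NNReal.coe_sub h]
    exact abs_of_nonneg (sub_nonneg.2 h)
  rw [e] at h1
  exact h1

lemma IsWienerMeasure.integral_increment (h𝕎 : IsWienerMeasure 𝕎) (h : a ≤ a') (i : Fin r) :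
    ∫ w : ℂ₀, (w a' - w a) i ∂𝕎 = 0 := by
  rw [(h𝕎.hasLaw_increment h i).integral_eq]; exact integral_id_gaussianReal

lemma IsWienerMeasure.memLp_increment (h𝕎 : IsWienerMeasure 𝕎) (h : a ≤ a') (i : Fin r)
    (p : ℝ≥0) : MemLp (fun w : ℂ₀ => (w a' - w a) i) p 𝕎 := by
  have h1 := h𝕎.hasLaw_increment h i
  have h2 := memLp_id_gaussianReal (μ := 0) (v := a' - a) p
  rw [← h1.map_eq] at h2
  exact (memLp_map_measure_iff aestronglyMeasurable_id h1.aemeasurable).1 h2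

lemma IsWienerMeasure.integral_increment_sq (h𝕎 : IsWienerMeasure 𝕎) (h : a ≤ a') (i : Fin r) :
    ∫ w : ℂ₀, (w a' - w a) i ^ 2 ∂𝕎 = a' - a := by
  have h1 := h𝕎.hasLaw_increment h i
  have h2 : ∫ w : ℂ₀, (w a' - w a) i ^ 2 ∂𝕎 = ∫ x, x ^ 2 ∂gaussianReal 0 (a' - a) := by
    rw [← h1.map_eq, integral_map h1.aemeasurable (by fun_prop)]
  have h3 := variance_fun_id_gaussianReal (μ := 0) (v := a' - a)
  rw [variance_of_integral_eq_zero (by fun_prop) integral_id_gaussianReal] at h3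
  rw [h2, h3, NNReal.coe_sub h]

lemma IsWienerMeasure.integral_increment_mul (h𝕎 : IsWienerMeasure 𝕎) (h : a ≤ a') (i j : Fin r) :
    ∫ w : ℂ₀, (w a' - w a) i * (w a' - w a) j ∂𝕎 = if i = j then (a' : ℝ) - a else 0 := by
  split_ifs with hij
  · subst hij
    simp_rw [← sq]
    exact h𝕎.integral_increment_sq h i
  · have h1 := (h𝕎.iIndepFun.indepFun hij).comp (φ := fun p => p a' - p a)
      (ψ := fun p => p a' - p a) (by fun_prop) (by fun_prop)
    have h2 := h1.integral_fun_mul_eq_mul_integral (h𝕎.hasLaw_increment h i).aemeasurable.aestronglyMeasurable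
      (h𝕎.hasLaw_increment h j).aemeasurable.aestronglyMeasurable
    refine h2.trans ?_
    have := h𝕎.integral_increment h i
    simp only [PiLp.sub_apply] at this
    simp [this]

lemma norm_pow_four_le (ξ : 𝔽) : ‖ξ‖ ^ 4 ≤ r * ∑ i, ξ i ^ 4 := by
  have h1 : ‖ξ‖ ^ 2 = ∑ i, ξ i ^ 2 := by
    rw [EuclideanSpace.norm_sq_eq]; simp
  calc ‖ξ‖ ^ 4 = (∑ i, ξ i ^ 2) ^ 2 := by rw [← h1]; ring
    _ ≤ _ := by
      have := sq_sum_le_card_mul_sum_sq (s := Finset.univ) (f := fun i => ξ i ^ 2)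
      simpa [← pow_mul] using this

/-- The fourth moment of a one-dimensional standard normal variable, up to the square of the
dimension. -/
noncomputable def fourthMoment (r : ℕ) : ℝ := r * (r * ∫ x, x ^ 4 ∂gaussianReal 0 1)

lemma fourthMoment_nonneg : 0 ≤ fourthMoment r := by
  unfold fourthMoment
  have : 0 ≤ ∫ x, x ^ 4 ∂gaussianReal 0 1 := integral_nonneg fun x => by positivity
  positivity

lemma IsWienerMeasure.memLp_norm_increment (h𝕎 : IsWienerMeasure 𝕎) (h : a ≤ a')
    (p : ℝ≥0) : MemLp (fun w : ℂ₀ => ‖w a' - w a‖) p 𝕎 := by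
  have h1 : MemLp (fun w : ℂ₀ => ∑ i, ‖(w a' - w a) i‖) p 𝕎 :=
    memLp_finsetSum _ fun i _ => (h𝕎.memLp_increment h i p).norm
  refine h1.mono' ?_ (ae_of_all _ fun w => ?_)
  · exact (measurable_comp_increment measurable_norm).aestronglyMeasurable
  · rw [norm_norm]
    have e : ‖w a' - w a‖ = √(∑ i, ‖(w a' - w a) i‖ ^ 2) := EuclideanSpace.norm_eq _
    rw [e]
    refine Real.sqrt_le_iff.2 ⟨by positivity, ?_⟩
    exact Finset.sum_sq_le_sq_sum_of_nonneg fun i _ => norm_nonneg _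

lemma IsWienerMeasure.integral_norm_increment_sq (h𝕎 : IsWienerMeasure 𝕎) (h : a ≤ a') :
    ∫ w : ℂ₀, ‖w a' - w a‖ ^ 2 ∂𝕎 = r * (a' - a) := by
  have e : ∀ w : ℂ₀, ‖w a' - w a‖ ^ 2 = ∑ i, (w a' - w a) i ^ 2 := fun w => by
    rw [EuclideanSpace.norm_sq_eq]; simp
  simp_rw [e]
  rw [integral_finsetSum _ fun i _ => (h𝕎.memLp_increment h i 2).integrable_sq]
  simp_rw [h𝕎.integral_increment_sq h]
  simp
  ring

lemma IsWienerMeasure.integral_norm_increment_pow_four_le (h𝕎 : IsWienerMeasure 𝕎) (h : a ≤ a') :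
    ∫ w : ℂ₀, ‖w a' - w a‖ ^ 4 ∂𝕎 ≤ fourthMoment r * (a' - a) ^ 2 := by
  have hi : ∀ i, Integrable (fun w : ℂ₀ => (w a' - w a) i ^ 4) 𝕎 := fun i => by
    have := (h𝕎.memLp_increment h i 4).integrable_norm_pow (p := 4) (by norm_num)
    refine this.congr (ae_of_all _ fun w => ?_)
    simp only [Real.norm_eq_abs]
    exact (by decide : Even 4).pow_abs _
  have h4 : ∀ i, ∫ w : ℂ₀, (w a' - w a) i ^ 4 ∂𝕎 =
      (a' - a) ^ 2 * ∫ x, x ^ 4 ∂gaussianReal 0 1 := fun i => by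
    have h1 := h𝕎.hasLaw_increment h i
    have h2 : ∫ w : ℂ₀, (w a' - w a) i ^ 4 ∂𝕎 = ∫ x, x ^ 4 ∂gaussianReal 0 (a' - a) := by
      rw [← h1.map_eq, integral_map h1.aemeasurable (by fun_prop)]
    rw [h2, integral_pow_four_gaussianReal, NNReal.coe_sub h]
  calc _ ≤ ∫ w : ℂ₀, r * ∑ i, (w a' - w a) i ^ 4 ∂𝕎 :=
        integral_mono_of_nonneg (ae_of_all _ fun w => by positivity)
          ((integrable_finsetSum _ fun i _ => hi i).const_mul _)
          (ae_of_all _ fun w => norm_pow_four_le _)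
    _ = _ := by
      rw [integral_const_mul, integral_finsetSum _ fun i _ => hi i]
      simp_rw [h4]
      simp [fourthMoment]
      ring

end Moments

end Wiener

end WongZakai

namespace WongZakai

/-! ### Calculus of error terms that vanish after summation over the steps. -/

section Negligible

/-- Error terms, in terms of the size `D` of the increment of the noise and the length `τ` of the
time step, that are negligible in the sum over all time steps. -/
def IsNegligible (f : ℝ → ℝ → ℝ) : Prop :=
  ∀ η : ℝ, 0 < η → ∃ K : ℝ, 0 ≤ K ∧ ∀ D τ : ℝ, 0 ≤ D → 0 ≤ τ → τ ≤ 1 →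
    f D τ ≤ η * (D ^ 2 + τ) + K * (D ^ 4 + τ ^ 2)

lemma IsNegligible.add {f g : ℝ → ℝ → ℝ} (hf : IsNegligible f) (hg : IsNegligible g) :
    IsNegligible fun D τ => f D τ + g D τ := by
  intro η hη
  obtain ⟨K, hK, h1⟩ := hf (η / 2) (half_pos hη)
  obtain ⟨K', hK', h2⟩ := hg (η / 2) (half_pos hη)
  refine ⟨K + K', add_nonneg hK hK', fun D τ hD hτ hτ1 => ?_⟩
  have := h1 D τ hD hτ hτ1
  have := h2 D τ hD hτ hτ1
  linarith

lemma IsNegligible.const_mul {f : ℝ → ℝ → ℝ} (hf : IsNegligible f) {c : ℝ} (hc : 0 ≤ c) :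
    IsNegligible fun D τ => c * f D τ := by
  intro η hη
  obtain ⟨K, hK, h1⟩ := hf (η / (c + 1)) (by positivity)
  refine ⟨c * K, by positivity, fun D τ hD hτ hτ1 => ?_⟩
  have h2 := mul_le_mul_of_nonneg_left (h1 D τ hD hτ hτ1) hc
  have h3 : c * (η / (c + 1)) ≤ η := by
    rw [mul_div_assoc', div_le_iff₀ (by positivity)]; nlinarith
  have h4 := mul_le_mul_of_nonneg_right h3 (by positivity : 0 ≤ D ^ 2 + τ)
  linarith

lemma isNegligible_quartic : IsNegligible fun D τ => D ^ 4 + τ ^ 2 := fun η hη =>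
  ⟨1, zero_le_one, fun D τ hD hτ _ => by
    have : 0 ≤ η * (D ^ 2 + τ) := by positivity
    linarith⟩

/-- Young's inequality with parameter `η` gives `τ * D ≤ η * τ + τ * D ^ 2 / (4 * η)`, and the last
product is bounded by `D ^ 4 + τ ^ 2`. -/
lemma isNegligible_time_mul : IsNegligible fun D τ => τ * D := by
  intro η hη
  refine ⟨1 / (4 * η), by positivity, fun D τ hD hτ hτ1 => ?_⟩
  have h1 : D ≤ η + D ^ 2 / (4 * η) := by
    rw [← sub_nonneg]
    have : η + D ^ 2 / (4 * η) - D = (2 * η - D) ^ 2 / (4 * η) := by field_simp; ring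
    rw [this]; positivity
  have h2 : τ * D ≤ τ * η + τ * D ^ 2 / (4 * η) := by
    have := mul_le_mul_of_nonneg_left h1 hτ
    rwa [mul_add, ← mul_div_assoc] at this
  have h3 : τ * D ^ 2 / (4 * η) ≤ 1 / (4 * η) * (D ^ 4 + τ ^ 2) := by
    rw [div_mul_eq_mul_div, one_mul]
    gcongr
    nlinarith [sq_nonneg (D ^ 2 - τ), sq_nonneg (D ^ 2), sq_nonneg τ]
  have : 0 ≤ η * D ^ 2 := by positivity
  linarith

lemma isNegligible_cube : IsNegligible fun D _ => D ^ 3 := by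
  intro η hη
  refine ⟨1 / (4 * η), by positivity, fun D τ hD hτ hτ1 => ?_⟩
  have h1 : D ^ 3 ≤ η * D ^ 2 + D ^ 4 / (4 * η) := by
    rw [← sub_nonneg]
    have : η * D ^ 2 + D ^ 4 / (4 * η) - D ^ 3 = D ^ 2 * (2 * η - D) ^ 2 / (4 * η) := by
      field_simp; ring
    rw [this]; positivity
  have h2 : D ^ 4 / (4 * η) ≤ 1 / (4 * η) * (D ^ 4 + τ ^ 2) := by
    rw [div_mul_eq_mul_div, one_mul]
    gcongr
    nlinarith
  have : 0 ≤ η * τ := by positivity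
  linarith

end Negligible

/-! ### Bounds and moduli of continuity for functions with bounded support in the second variable.
-/

section CompactSupport

variable {d : ℕ} {E' Y : Type*} [NormedAddCommGroup E'] [ProperSpace E'] [NormedAddCommGroup Y]
  {K : Set (EuclideanSpace ℝ (Fin d))}

lemma exists_bound_of_eq_zero (hK : IsCompact K) {f : EuclideanSpace ℝ (Fin d) × E' → Y}
    (hf : ContinuousOn f (K ×ˢ univ)) {ρ : ℝ} (hρ : ∀ z, ρ < ‖z.2‖ → f z = 0) :
    ∃ C : ℝ, 0 ≤ C ∧ ∀ z ∈ K ×ˢ univ, ‖f z‖ ≤ C := by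
  have hQ : IsCompact (K ×ˢ Metric.closedBall (0 : E') ρ) := hK.prod (isCompact_closedBall 0 ρ)
  obtain ⟨C, hC⟩ := hQ.exists_bound_of_continuousOn (hf.mono (prod_mono_right (subset_univ _)))
  refine ⟨|C|, abs_nonneg _, fun z hz => ?_⟩
  rcases lt_or_ge ρ ‖z.2‖ with h | h
  · rw [hρ z h]; simp
  · exact (hC z ⟨hz.1, by simpa using h⟩).trans (le_abs_self _)

/-- Uniform continuity handles close points and boundedness distant ones. A quadratic modulus suits
the use: multiplied by a squared increment of the noise it is of fourth order, hence negligible. -/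
lemma exists_modulus_of_eq_zero (hK : IsCompact K) {f : EuclideanSpace ℝ (Fin d) × E' → Y}
    (hf : ContinuousOn f (K ×ˢ univ)) {ρ : ℝ} (hρ : ∀ z, ρ < ‖z.2‖ → f z = 0) {ε : ℝ}
    (hε : 0 < ε) : ∃ C : ℝ, 0 ≤ C ∧ ∀ z ∈ K ×ˢ univ, ∀ z' ∈ K ×ˢ univ,
      ‖f z - f z'‖ ≤ ε + C * ‖z - z'‖ ^ 2 := by
  obtain ⟨S, hS0, hS⟩ := exists_bound_of_eq_zero hK hf hρ
  -- With the extra `1`, two points at distance less than one either both lie in this set or both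
  -- lie where `f` vanishes.
  have hQ : IsCompact (K ×ˢ Metric.closedBall (0 : E') (ρ + 1)) :=
    hK.prod (isCompact_closedBall 0 _)
  obtain ⟨δ, hδ, h⟩ := Metric.uniformContinuousOn_iff.1 (hQ.uniformContinuousOn_of_continuous
    (hf.mono (prod_mono_right (subset_univ _)))) ε hε
  refine ⟨2 * S / (min δ 1) ^ 2, by positivity, fun z hz z' hz' => ?_⟩
  rcases lt_or_ge ‖z - z'‖ (min δ 1) with h1 | h1
  · have h0 : 0 ≤ 2 * S / (min δ 1) ^ 2 * ‖z - z'‖ ^ 2 := by positivity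
    refine le_add_of_le_of_nonneg ?_ h0
    have h2 : ‖z.2 - z'.2‖ < 1 := (norm_snd_le (z - z')).trans_lt (h1.trans_le (min_le_right _ _))
    have h3 := norm_sub_norm_le z.2 z'.2
    have h4 := norm_sub_norm_le z'.2 z.2
    rw [norm_sub_rev] at h4
    rcases le_or_gt ‖z.2‖ (ρ + 1) with h5 | h5
    · rcases le_or_gt ‖z'.2‖ (ρ + 1) with h6 | h6
      · have := h z ⟨hz.1, by simpa using h5⟩ z' ⟨hz'.1, by simpa using h6⟩
          (by rw [dist_eq_norm]; exact h1.trans_le (min_le_left _ _))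
        rw [dist_eq_norm] at this
        exact this.le
      · rw [hρ z' (by linarith), hρ z (by linarith)]; simpa using hε.le
    · rw [hρ z' (by linarith), hρ z (by linarith)]; simpa using hε.le
  · have h2 : ‖f z - f z'‖ ≤ 2 * S := by
      have := norm_sub_le (f z) (f z')
      have := hS z hz
      have := hS z' hz'
      linarith
    have h3 : 2 * S ≤ 2 * S / (min δ 1) ^ 2 * ‖z - z'‖ ^ 2 := by
      rw [div_mul_eq_mul_div, le_div_iff₀ (by positivity)]
      gcongr
    linarith

end CompactSupport

end WongZakai

namespace WongZakai

/-! ### The step bound, with a corrector for the variation of the reflection. -/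

section StepBound

variable {d r : ℕ}

local notation "𝔼" => EuclideanSpace ℝ (Fin d)
local notation "𝔽" => EuclideanSpace ℝ (Fin r)
local notation "𝕊" => EuclideanSpace ℝ (Fin d) × (EuclideanSpace ℝ (Fin d) × EuclideanSpace ℝ (Fin r))

variable {O : Set (EuclideanSpace ℝ (Fin d))}
  {σ : EuclideanSpace ℝ (Fin d) → EuclideanSpace ℝ (Fin r) →L[ℝ] EuclideanSpace ℝ (Fin d)}
  {b : EuclideanSpace ℝ (Fin d) → EuclideanSpace ℝ (Fin d)}
  {H : EuclideanSpace ℝ (Fin d) × (EuclideanSpace ℝ (Fin d) × EuclideanSpace ℝ (Fin r)) → ℝ}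

/-- The first component already lives in a compact set, so a cutoff in `z.2` suffices. Vanishing on
an open set passes to every derivative occurring in the generator. -/
lemma eventually_eq_zero_of_cutoff {ρ : ℝ} (hρ : ∀ z, ρ < ‖z.2‖ → H z = 0) {z : 𝕊}
    (hz : ρ < ‖z.2‖) : H =ᶠ[𝓝 z] fun _ => 0 := by
  have hopen : IsOpen {z : 𝕊 | ρ < ‖z.2‖} := isOpen_lt continuous_const (by fun_prop)
  filter_upwards [hopen.mem_nhds hz] with z' hz' using hρ z' hz'

lemma fderiv_eq_zero_of_cutoff {ρ : ℝ} (hρ : ∀ z, ρ < ‖z.2‖ → H z = 0) {z : 𝕊}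
    (hz : ρ < ‖z.2‖) : fderiv ℝ H z = 0 := by
  rw [(eventually_eq_zero_of_cutoff hρ hz).fderiv_eq]; simp

lemma gradNoise_eq_zero_of_cutoff {ρ : ℝ} (hρ : ∀ z, ρ < ‖z.2‖ → H z = 0) {z : 𝕊}
    (hz : ρ < ‖z.2‖) : gradNoise σ H z = 0 := by
  rw [gradNoise, fderiv_eq_zero_of_cutoff hρ hz, ContinuousLinearMap.zero_comp]

lemma fderivWithin_gradNoise_eq_zero_of_cutoff {ρ : ℝ} (hρ : ∀ z, ρ < ‖z.2‖ → H z = 0) {z : 𝕊}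
    (hz : ρ < ‖z.2‖) : fderivWithin ℝ (gradNoise σ H) (closure O ×ˢ univ) z = 0 := by
  have hopen : IsOpen {z : 𝕊 | ρ < ‖z.2‖} := isOpen_lt continuous_const (by fun_prop)
  have h : gradNoise σ H =ᶠ[𝓝 z] fun _ => 0 := by
    filter_upwards [hopen.mem_nhds hz] with z' hz' using gradNoise_eq_zero_of_cutoff hρ hz'
  rw [h.fderivWithin_eq_of_nhds]; simp

lemma hessNoise_eq_zero_of_cutoff {ρ : ℝ} (hρ : ∀ z, ρ < ‖z.2‖ → H z = 0) {z : 𝕊}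
    (hz : ρ < ‖z.2‖) : hessNoise O σ H z = 0 := by
  rw [hessNoise, fderivWithin_gradNoise_eq_zero_of_cutoff hρ hz, ContinuousLinearMap.zero_comp]

/-- The oscillation of `(X, X - L, W)` over an interval on which `W` is affine. -/
lemma exists_oscillation_lift (hO : IsAdmissible O) (hObdd : Bornology.IsBounded O)
    (hσ : ContinuousOn σ (closure O)) (hb : ContinuousOn b (closure O)) :
    ∃ C : ℝ, 0 ≤ C ∧ ∀ (a a' : ℝ) (ξ : 𝔽) (x n y : ℝ → 𝔼) (w : ℝ → 𝔽) (m : Measure ℝ), a ≤ a' →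
      IsReflectedArc O a a' x (fun s => σ (x s) ξ + b (x s)) n m →
      (∀ t ∈ Icc a a', y t = y a + ∫ s in Ioc a t, (σ (x s) ξ + b (x s))) →
      (∀ t ∈ Icc a a', w t = w a + (t - a) • ξ) →
      ∀ s ∈ Icc a a', ‖(x s, (y s, w s)) - (x a, (y a, w a))‖ ≤
        C * (‖(a' - a) • ξ‖ + (a' - a)) := by
  obtain ⟨C, hC, h⟩ := exists_oscillation_affine hO hObdd hσ hb
  refine ⟨C + 1, by positivity, fun a a' ξ x n y w m hab hx hy hw s hs => ?_⟩
  obtain ⟨h1, h2⟩ := h a a' ξ x n m hx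
  have hτ : 0 ≤ a' - a := sub_nonneg.2 hab
  set R := ‖(a' - a) • ξ‖ + (a' - a) with hR
  have hR0 : 0 ≤ R := by positivity
  have hle : C * R ≤ (C + 1) * R := by nlinarith
  have h3 : ‖y s - y a‖ ≤ C * R := by
    rw [hy s hs, add_sub_cancel_left]
    rcases hτ.eq_or_lt with h0 | h0
    · have : s = a := le_antisymm (by linarith [hs.2]) hs.1
      rw [this]; simp; positivity
    · refine (norm_setIntegral_le_of_norm_le_const (C := C * R / (a' - a)) (by simp)
        fun u hu => ?_).trans ?_
      · rw [le_div_iff₀ h0]; exact h1 u ⟨hu.1.le, hu.2.trans hs.2⟩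
      · rw [Measure.real, Real.volume_Ioc, ENNReal.toReal_ofReal (by linarith [hs.1]),
          div_mul_eq_mul_div, div_le_iff₀ h0]
        have := hs.2
        gcongr
  have h4 : ‖w s - w a‖ ≤ R := by
    rw [hw s hs, add_sub_cancel_left, norm_smul, Real.norm_of_nonneg (sub_nonneg.2 hs.1)]
    rw [norm_smul, Real.norm_of_nonneg hτ] at hR
    have : (s - a) * ‖ξ‖ ≤ (a' - a) * ‖ξ‖ := by
      have := hs.2
      gcongr
    linarith
  have h5 : R ≤ (C + 1) * R := by nlinarith
  simp only [Prod.mk_sub_mk, Prod.norm_def]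
  exact max_le ((h2 s hs).trans hle) (max_le (h3.trans hle) (h4.trans h5))

variable {Kσ Kb : ℝ≥0}

/-- The variation of the reflection term over an interval on which `W` is affine. -/
lemma exists_variation_bound (hO : IsAdmissible O) (hObdd : Bornology.IsBounded O)
    (hσ : LipschitzOnWith Kσ σ (closure O)) (hb : LipschitzOnWith Kb b (closure O)) :
    ∃ (φ : 𝔼 → ℝ) (S C : ℝ) (g : 𝔼 → 𝔽 →L[ℝ] ℝ), ContinuousOn φ (closure O) ∧
      (∀ x ∈ closure O, |φ x| ≤ S) ∧ 0 ≤ S ∧ 0 ≤ C ∧ ContinuousOn g (closure O) ∧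
      (∀ x ∈ closure O, ‖g x‖ ≤ S) ∧
      ∀ (a a' : ℝ) (ξ : 𝔽) (x n : ℝ → 𝔼) (m : Measure ℝ), a ≤ a' → a' - a ≤ 1 →
      IsReflectedArc O a a' x (fun s => σ (x s) ξ + b (x s)) n m →
      m.real (Ioc a a') ≤ φ (x a') - φ (x a) - g (x a) ((a' - a) • ξ) +
        C * (‖(a' - a) • ξ‖ ^ 2 + (a' - a)) ∧
      m.real (Ioc a a') ≤ C * (‖(a' - a) • ξ‖ + ‖(a' - a) • ξ‖ ^ 2 + (a' - a)) := by
  have hK : IsCompact (closure O) := hObdd.isCompact_closure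
  obtain ⟨φ, α, C, hφ, hα, hC, h⟩ := exists_variation_affine hO hObdd hσ hb
  obtain ⟨C', hC', hosc⟩ := exists_oscillation_affine hO hObdd hσ.continuousOn hb.continuousOn
  have hφ1 : ContDiff ℝ 1 φ := hφ.of_le one_le_two
  obtain ⟨R, hR⟩ := hK.isBounded.subset_closedBall 0
  obtain ⟨Kφ, hKφ⟩ : ∃ K, LipschitzOnWith K φ (Metric.closedBall 0 R) :=
    hφ1.contDiffOn.exists_lipschitzOnWith one_ne_zero (convex_closedBall 0 R)
      (isCompact_closedBall 0 R)
  set g : 𝔼 → 𝔽 →L[ℝ] ℝ := fun x => α⁻¹ • (fderiv ℝ φ x).comp (σ x) with hg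
  have hgc : ContinuousOn g (closure O) :=
    (((hφ1.continuous_fderiv one_ne_zero).continuousOn).clm_comp hσ.continuousOn).const_smul α⁻¹
  obtain ⟨S₁, hS₁⟩ := hK.exists_bound_of_continuousOn hgc
  obtain ⟨S₂, hS₂⟩ := hK.exists_bound_of_continuousOn
    ((hφ1.continuous.continuousOn (s := closure O)).const_smul α⁻¹)
  refine ⟨fun x => α⁻¹ * φ x, |S₁| + |S₂|, α⁻¹ * C + α⁻¹ * Kφ * C' + |S₁|, g,
    continuousOn_const.mul hφ1.continuous.continuousOn,
    fun x hx => (hS₂ x hx).trans ((le_abs_self _).trans (le_add_of_nonneg_left (abs_nonneg _))),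
    by positivity, by positivity, hgc,
    fun x hx => (hS₁ x hx).trans ((le_abs_self _).trans (le_add_of_nonneg_right (abs_nonneg _))),
    fun a a' ξ x n m hab hτ1 hx => ?_⟩
  have haI : a ∈ Icc a a' := ⟨le_rfl, hab⟩
  have haI' : a' ∈ Icc a a' := ⟨hab, le_rfl⟩
  have h1 := h a a' ξ x n m hab hτ1 hx
  have h2 := (hosc a a' ξ x n m hx).2 a' haI'
  set D := (a' - a) • ξ with hD
  have hτ : 0 ≤ a' - a := sub_nonneg.2 hab
  have h3 : m.real (Ioc a a') ≤ α⁻¹ * φ (x a') - α⁻¹ * φ (x a) - g (x a) D +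
      α⁻¹ * C * (‖D‖ ^ 2 + (a' - a)) := by
    have := mul_le_mul_of_nonneg_left h1 (inv_nonneg.2 hα.le)
    rw [inv_mul_cancel_left₀ hα.ne'] at this
    have e : g (x a) D = α⁻¹ * fderiv ℝ φ (x a) (σ (x a) D) := rfl
    rw [e]; linarith
  have h4 : |φ (x a') - φ (x a)| ≤ Kφ * ‖x a' - x a‖ := by
    have := hKφ.dist_le_mul _ (hR (hx.mem a' haI')) _ (hR (hx.mem a haI))
    rwa [dist_eq_norm, dist_eq_norm] at this
  have h5 : |g (x a) D| ≤ |S₁| * ‖D‖ :=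
    (g (x a)).le_of_opNorm_le ((hS₁ _ (hx.mem a haI)).trans (le_abs_self _)) D
  have hDn := norm_nonneg D
  have hn2 : 0 ≤ ‖D‖ ^ 2 := by positivity
  have hα' : 0 ≤ α⁻¹ := inv_nonneg.2 hα.le
  have e1 : 0 ≤ α⁻¹ * Kφ * C' := by positivity
  have e2 : 0 ≤ α⁻¹ * C := by positivity
  -- The first bound is the sharp one: apart from its remainder it telescopes or is linear in the
  -- noise. The second is crude but pathwise, from the Lipschitz bound for φ and the oscillation
  -- estimate.
  constructor
  · refine h3.trans ?_
    have : 0 ≤ (α⁻¹ * Kφ * C' + |S₁|) * (‖D‖ ^ 2 + (a' - a)) := by positivity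
    change _ ≤ α⁻¹ * φ (x a') - α⁻¹ * φ (x a) - g (x a) D + _
    linarith
  · refine h3.trans ?_
    have h6 : α⁻¹ * φ (x a') - α⁻¹ * φ (x a) ≤ α⁻¹ * Kφ * C' * (‖D‖ + (a' - a)) := by
      rw [← mul_sub]
      have := (le_abs_self _).trans (h4.trans (mul_le_mul_of_nonneg_left h2 Kφ.2))
      have := mul_le_mul_of_nonneg_left this hα'
      linarith
    have h7 := (abs_le.1 h5).1
    have e3 := abs_nonneg S₁
    have e4 : 0 ≤ α⁻¹ * C * ‖D‖ := by positivity
    have e5 : 0 ≤ α⁻¹ * Kφ * C' * ‖D‖ ^ 2 := by positivity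
    have e6 : 0 ≤ |S₁| * (‖D‖ ^ 2 + (a' - a)) := by positivity
    linarith

/-- Treatment of the delicate error: after `D * q ≤ δ * q + D ^ 2 / (4 * δ) * q`, the sharp bound
goes into the first term, where `δ` is small, and the crude bound into the second, which becomes of
third order. -/
lemma mul_mul_variation_le {M δ C₄ D τ q v : ℝ} (hM0 : 0 ≤ M) (hδ : 0 < δ) (hC₄ : 0 ≤ C₄)
    (hq0 : 0 ≤ q) (hv1 : q ≤ v + C₄ * (D ^ 2 + τ))
    (hv2 : q ≤ C₄ * (D + D ^ 2 + τ)) :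
    M * (D * q) ≤ M * δ * (v + C₄ * (D ^ 2 + τ)) +
      M * C₄ / (4 * δ) * (D ^ 3 + 2 * (D ^ 4 + τ ^ 2)) := by
  have h1 : D ≤ δ + D ^ 2 / (4 * δ) := by
    rw [← sub_nonneg]
    have : δ + D ^ 2 / (4 * δ) - D = (2 * δ - D) ^ 2 / (4 * δ) := by field_simp; ring
    rw [this]; positivity
  have h2 : D * q ≤ δ * q + D ^ 2 / (4 * δ) * q := by
    rw [← add_mul]; gcongr
  have h3 : δ * q ≤ δ * (v + C₄ * (D ^ 2 + τ)) := by gcongr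
  have h4 : D ^ 2 / (4 * δ) * q ≤ D ^ 2 / (4 * δ) * (C₄ * (D + D ^ 2 + τ)) := by gcongr
  have h5 : D ^ 2 / (4 * δ) * (C₄ * (D + D ^ 2 + τ)) =
      C₄ / (4 * δ) * (D ^ 3 + (D ^ 4 + D ^ 2 * τ)) := by ring
  have h6 : C₄ / (4 * δ) * (D ^ 3 + (D ^ 4 + D ^ 2 * τ)) ≤
      C₄ / (4 * δ) * (D ^ 3 + 2 * (D ^ 4 + τ ^ 2)) := by
    gcongr
    nlinarith [sq_nonneg (D ^ 2 - τ), sq_nonneg (D ^ 2), sq_nonneg τ]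
  have h7 := mul_le_mul_of_nonneg_left
    (h2.trans (add_le_add h3 (h4.trans (h5.trans_le h6)))) hM0
  refine h7.trans (le_of_eq ?_)
  ring

/-- The constant part of the modulus is small enough to absorb the dimension; the squared
oscillation times `D ^ 2 + r * τ` is of fourth order. -/
lemma modulus_mul_le {ε ε' C₅ C₃ D τ : ℝ} (r : ℕ) (hε' : 0 ≤ ε') (hε'r : ε' * (1 + r) ≤ ε / 3)
    (hC₅ : 0 ≤ C₅) (hτ : 0 ≤ τ) (hτ1 : τ ≤ 1) :
    (ε' + C₅ * (C₃ * (D + τ)) ^ 2) * (D ^ 2 + r * τ) ≤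
      ε / 3 * (D ^ 2 + τ) + 4 * (1 + r) * C₅ * C₃ ^ 2 * (D ^ 4 + τ ^ 2) := by
  have hr : (0 : ℝ) ≤ r := Nat.cast_nonneg r
  have h1 : D ^ 2 + r * τ ≤ (1 + r) * (D ^ 2 + τ) := by nlinarith [sq_nonneg D, mul_nonneg hr (sq_nonneg D)]
  have h2 : (D + τ) ^ 2 ≤ 2 * (D ^ 2 + τ) := by nlinarith [sq_nonneg (D - τ)]
  have h3 : (D ^ 2 + τ) * (D ^ 2 + τ) ≤ 2 * (D ^ 4 + τ ^ 2) := by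
    nlinarith [sq_nonneg (D ^ 2 - τ)]
  have h4 : (ε' + C₅ * (C₃ * (D + τ)) ^ 2) * (D ^ 2 + r * τ) ≤
      (ε' + C₅ * (C₃ ^ 2 * (2 * (D ^ 2 + τ)))) * ((1 + r) * (D ^ 2 + τ)) := by
    rw [mul_pow]; gcongr
  have h5 : ε' * (1 + r) * (D ^ 2 + τ) ≤ ε / 3 * (D ^ 2 + τ) := by gcongr
  have h6 : 2 * (1 + r) * C₅ * C₃ ^ 2 * ((D ^ 2 + τ) * (D ^ 2 + τ)) ≤
      2 * (1 + r) * C₅ * C₃ ^ 2 * (2 * (D ^ 4 + τ ^ 2)) := by gcongr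
  linarith

/-- A lower bound for the increment of `H(X, X - L, W)`, in excess of the generator, over an
interval on which `W` is affine. -/
theorem exists_step_bound (hO : IsAdmissible O) (hObdd : Bornology.IsBounded O)
    (hσ : LipschitzOnWith Kσ σ (closure O)) (hσ1 : ContDiffOn ℝ 1 σ (closure O))
    (hb : LipschitzOnWith Kb b (closure O)) (hH : ContDiff ℝ 2 H)
    (hn : ∀ x ∈ frontier O, ∀ n ∈ inwardNormals O x, ∀ p, 0 ≤ fderiv ℝ H (x, p) (n, 0))
    {ρ : ℝ} (hρ : ∀ z, ρ < ‖z.2‖ → H z = 0) {ε : ℝ} (hε : 0 < ε) :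
    ∃ (Φ : 𝔼 → ℝ) (G : 𝕊 → 𝔽 →L[ℝ] ℝ) (C : ℝ), ContinuousOn Φ (closure O) ∧
      (∀ x ∈ closure O, |Φ x| ≤ ε) ∧ ContinuousOn G (closure O ×ˢ univ) ∧ 0 ≤ C ∧
      (∀ z ∈ closure O ×ˢ univ, ‖G z‖ ≤ C) ∧
      (∀ z ∈ closure O ×ˢ univ, ‖hessNoise O σ H z‖ ≤ C) ∧
      ∀ (a a' : ℝ) (ξ : 𝔽) (x n y : ℝ → 𝔼) (w : ℝ → 𝔽) (m : Measure ℝ), a ≤ a' → a' - a ≤ 1 →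
      IsReflectedArc O a a' x (fun s => σ (x s) ξ + b (x s)) n m →
      (∀ t ∈ Icc a a', y t = y a + ∫ s in Ioc a t, (σ (x s) ξ + b (x s))) →
      (∀ t ∈ Icc a a', w t = w a + (t - a) • ξ) →
      Φ (x a) - Φ (x a') + G (x a, (y a, w a)) ((a' - a) • ξ) +
        (1 / 2 : ℝ) * (hessNoise O σ H (x a, (y a, w a)) ((a' - a) • ξ) ((a' - a) • ξ) -
          (a' - a) * bilinTrace (hessNoise O σ H (x a, (y a, w a)))) -
        (ε * (‖(a' - a) • ξ‖ ^ 2 + (a' - a)) + C * (‖(a' - a) • ξ‖ ^ 4 + (a' - a) ^ 2)) ≤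
      H (x a', (y a', w a')) - H (x a, (y a, w a)) -
        ∫ s in Ioc a a', liftGen O σ b H (x s, (y s, w s)) := by
  have hK : IsCompact (closure O) := hObdd.isCompact_closure
  obtain ⟨M, hM0, hM⟩ := exists_bound_of_eq_zero (ρ := ρ)
    (f := fderivWithin ℝ (gradNoise σ H) (closure O ×ˢ univ)) hK (continuousOn_fderivWithin_gradNoise hO hσ1 hH)
    fun z hz => fderivWithin_gradNoise_eq_zero_of_cutoff hρ hz
  obtain ⟨C₁, hC₁0, hC₁⟩ := exists_bound_of_eq_zero (ρ := ρ) (f := hessNoise O σ H) hK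
    (continuousOn_hessNoise hO hσ1 hH)
    fun z hz => hessNoise_eq_zero_of_cutoff hρ hz
  obtain ⟨C₂, hC₂0, hC₂⟩ := exists_bound_of_eq_zero (ρ := ρ) (f := gradNoise σ H) hK
    (contDiffOn_gradNoise hσ1 hH).continuousOn
    fun z hz => gradNoise_eq_zero_of_cutoff hρ hz
  obtain ⟨B', hB'⟩ := hK.exists_bound_of_continuousOn hb.continuousOn
  obtain ⟨B, hB0, hB⟩ : ∃ B, 0 ≤ B ∧ ∀ x ∈ closure O, ‖b x‖ ≤ B :=
    ⟨|B'|, abs_nonneg _, fun x hx => (hB' x hx).trans (le_abs_self _)⟩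
  obtain ⟨C₃, hC₃0, hosc⟩ := exists_oscillation_lift hO hObdd hσ.continuousOn hb.continuousOn
  obtain ⟨φ, S, C₄, g, hφc, hφS, hS0, hC₄, hgc, hgS, hvar⟩ := exists_variation_bound hO hObdd hσ hb
  obtain ⟨ε', hε', hε'r⟩ : ∃ ε' : ℝ, 0 < ε' ∧ ε' * (1 + r) ≤ ε / 3 :=
    ⟨ε / 3 / (1 + r), by positivity, by rw [div_mul_cancel₀]; positivity⟩
  obtain ⟨C₅, hC₅, hmod⟩ := exists_modulus_of_eq_zero (ρ := ρ) (f := hessNoise O σ H) hK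
    (continuousOn_hessNoise hO hσ1 hH)
    (fun z hz => hessNoise_eq_zero_of_cutoff hρ hz) hε'
  -- The first condition keeps the corrector below `ε`, the second its remainder below a third of
  -- the error allowance. The other two thirds go to the modulus of continuity and to the negligible
  -- terms.
  obtain ⟨δ, hδ, hδS, hδC⟩ : ∃ δ : ℝ, 0 < δ ∧ M * δ * S ≤ ε ∧ M * δ * C₄ ≤ ε / 3 := by
    refine ⟨ε / 3 / (M * (S + C₄) + 1), by positivity, ?_, ?_⟩
    · rw [mul_assoc, mul_comm, div_mul_eq_mul_div, div_mul_eq_mul_div,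
        div_le_iff₀ (by positivity)]
      nlinarith [mul_nonneg hM0 hS0, mul_nonneg hM0 hC₄]
    · rw [mul_assoc, mul_comm, div_mul_eq_mul_div, div_mul_eq_mul_div,
        div_le_iff₀ (by positivity)]
      nlinarith [mul_nonneg hM0 hS0, mul_nonneg hM0 hC₄]
  have hneg : IsNegligible fun D τ => M * B * (τ * D) + (M * C₄ / (4 * δ) * D ^ 3 +
      (2 * (M * C₄ / (4 * δ)) + 4 * (1 + r) * C₅ * C₃ ^ 2) * (D ^ 4 + τ ^ 2)) :=
    (isNegligible_time_mul.const_mul (by positivity)).add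
      ((isNegligible_cube.const_mul (by positivity)).add
        (isNegligible_quartic.const_mul (by positivity)))
  obtain ⟨C₆, hC₆, hsmall⟩ := hneg (ε / 3) (by positivity)
  -- The sharp variation bound times `M * δ` splits in three: its telescoping part is `Φ`, its noise
  -- part joins the gradient in `G`, and its remainder joins the errors.
  refine ⟨fun x => M * δ * φ x, fun z => gradNoise σ H z + (M * δ) • g z.1,
    C₂ + M * δ * S + C₁ + C₆, continuousOn_const.mul hφc, fun x hx => ?_, ?_, by positivity,
    fun z hz => ?_, fun z hz => ?_, fun a a' ξ x n y w m hab hτ1 hx hy hw => ?_⟩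
  · rw [abs_mul, abs_of_nonneg (by positivity)]
    exact (mul_le_mul_of_nonneg_left (hφS x hx) (by positivity)).trans hδS
  · exact (contDiffOn_gradNoise hσ1 hH).continuousOn.add
      ((hgc.comp continuousOn_fst fun z hz => hz.1).const_smul (M * δ))
  · refine (norm_add_le _ _).trans ?_
    have h1 := hC₂ z hz
    have h2 : ‖(M * δ) • g z.1‖ ≤ M * δ * S := by
      rw [norm_smul, Real.norm_of_nonneg (by positivity)]
      have := hgS z.1 hz.1
      gcongr
    linarith
  · have := hC₁ z hz
    have : 0 ≤ M * δ * S := by positivity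
    linarith
  obtain ⟨hv1, hv2⟩ := hvar a a' ξ x n m hab hτ1 hx
  have hosc' := hosc a a' ξ x n y w m hab hx hy hw
  have hτ : 0 ≤ a' - a := sub_nonneg.2 hab
  have haI : a ∈ Icc a a' := ⟨le_rfl, hab⟩
  have key := one_step_expansion (ω := ε' + C₅ * (C₃ * (‖(a' - a) • ξ‖ + (a' - a))) ^ 2)
    hO hσ1 hb.continuousOn hH hn hM hB hab hx hy hw fun s hs => by
      refine (hmod _ ⟨hx.mem s hs, mem_univ _⟩ _ ⟨hx.mem a haI, mem_univ _⟩).trans ?_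
      have := hosc' s hs
      gcongr
  refine le_trans ?_ key
  have hs := hsmall ‖(a' - a) • ξ‖ (a' - a) (norm_nonneg _) hτ hτ1
  have hq0 : 0 ≤ m.real (Ioc a a') := measureReal_nonneg
  generalize m.real (Ioc a a') = q at *
  simp only [_root_.add_apply, _root_.smul_apply, smul_eq_mul]
  generalize gradNoise σ H (x a, (y a, w a)) ((a' - a) • ξ) = G at *
  generalize (hessNoise O σ H (x a, (y a, w a)) ((a' - a) • ξ) ((a' - a) • ξ) -
          (a' - a) * bilinTrace (hessNoise O σ H (x a, (y a, w a)))) = A at *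
  generalize g (x a) ((a' - a) • ξ) = g₀ at *
  generalize ‖(a' - a) • ξ‖ = D at *
  generalize a' - a = τ at *
  have t1 := mul_mul_variation_le hM0 hδ hC₄ hq0 hv1 hv2
  have t2 := modulus_mul_le (C₃ := C₃) (D := D) r hε'.le hε'r hC₅ hτ hτ1
  have t3 : M * δ * C₄ * (D ^ 2 + τ) ≤ ε / 3 * (D ^ 2 + τ) := by gcongr
  have t4 : 0 ≤ (C₂ + M * δ * S + C₁) * (D ^ 4 + τ ^ 2) := by positivity
  linarith

end StepBound

end WongZakai

namespace WongZakai

/-! ### Means of linear and quadratic forms in an increment with coefficients from the past. -/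

section PastIncrements

variable {r : ℕ}

local notation "𝔽" => EuclideanSpace ℝ (Fin r)
local notation "ℂ₀" => C(ℝ≥0, EuclideanSpace ℝ (Fin r))

lemma clm_apply_eq_sum {Y : Type*} [NormedAddCommGroup Y] [NormedSpace ℝ Y] (g : 𝔽 →L[ℝ] Y)
    (ξ : 𝔽) : g ξ = ∑ i, ξ i • g (EuclideanSpace.single i 1) := by
  conv_lhs => rw [← (EuclideanSpace.basisFun (Fin r) ℝ).sum_repr ξ]
  simp

lemma bilin_apply_eq_sum (A : 𝔽 →L[ℝ] 𝔽 →L[ℝ] ℝ) (ξ : 𝔽) : A ξ ξ =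
    ∑ i, ∑ j, A (EuclideanSpace.single i 1) (EuclideanSpace.single j 1) * (ξ i * ξ j) := by
  rw [clm_apply_eq_sum A ξ, _root_.sum_apply]
  refine Finset.sum_congr rfl fun i _ => ?_
  rw [_root_.smul_apply, clm_apply_eq_sum _ ξ, Finset.smul_sum]
  refine Finset.sum_congr rfl fun j _ => ?_
  simp only [smul_eq_mul]; ring

variable {𝕎 : Measure C(ℝ≥0, EuclideanSpace ℝ (Fin r))} [IsProbabilityMeasure 𝕎] {a a' : ℝ≥0}

lemma DependsOnPast.comp {α β : Type*} {Φ : ℂ₀ → α} (h : DependsOnPast a Φ) (g : α → β) :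
    DependsOnPast a fun w => g (Φ w) := fun w w' hw => congrArg g (h w w' hw)

lemma IsWienerMeasure.integral_clm_increment (h𝕎 : IsWienerMeasure 𝕎) (h : a ≤ a')
    {g : ℂ₀ → 𝔽 →L[ℝ] ℝ} (hg : DependsOnPast a g) (hgm : AEStronglyMeasurable g 𝕎) {C : ℝ}
    (hC : ∀ w, ‖g w‖ ≤ C) :
    Integrable (fun w => g w (w a' - w a)) 𝕎 ∧ ∫ w, g w (w a' - w a) ∂𝕎 = 0 := by
  have hgi : Integrable g 𝕎 := .of_bound hgm C (ae_of_all _ hC)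
  have hi : ∀ i, Integrable (fun w => g w (EuclideanSpace.single i 1)) 𝕎 := fun i =>
    (ContinuousLinearMap.apply ℝ ℝ (EuclideanSpace.single i (1 : ℝ))).integrable_comp hgi
  have hψ : ∀ i : Fin r, Measurable fun ξ : 𝔽 => ξ i := fun i => by fun_prop
  have e : ∀ w : ℂ₀, g w (w a' - w a) =
      ∑ i, g w (EuclideanSpace.single i 1) * (w a' - w a) i := fun w => by
    rw [clm_apply_eq_sum]; simp only [smul_eq_mul, mul_comm]
  have h1 : ∀ i, Integrable (fun w => g w (EuclideanSpace.single i 1) * (w a' - w a) i) 𝕎 := fun i =>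
    h𝕎.integrable_mul_increment h (hg.comp fun q => q (EuclideanSpace.single i 1)) (hi i) (hψ i)
      ((h𝕎.memLp_increment h i 1).integrable le_rfl)
  simp_rw [e]
  refine ⟨integrable_finsetSum _ fun i _ => h1 i, ?_⟩
  rw [integral_finsetSum _ fun i _ => h1 i]
  refine Finset.sum_eq_zero fun i _ => ?_
  rw [h𝕎.integral_mul_increment h (hg.comp fun q => q (EuclideanSpace.single i 1)) (hi i).1 (hψ i),
    h𝕎.integral_increment h, mul_zero]

/-- In coordinates each product factorises, and the covariance `(a' - a) δᵢⱼ` leaves the trace. This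
centres the quadratic term of the expansion. -/
lemma IsWienerMeasure.integral_bilin_increment (h𝕎 : IsWienerMeasure 𝕎) (h : a ≤ a')
    {A : ℂ₀ → 𝔽 →L[ℝ] 𝔽 →L[ℝ] ℝ} (hA : DependsOnPast a A) (hAm : AEStronglyMeasurable A 𝕎) {C : ℝ}
    (hC : ∀ w, ‖A w‖ ≤ C) :
    Integrable (fun w => A w (w a' - w a) (w a' - w a)) 𝕎 ∧
      Integrable (fun w => bilinTrace (A w)) 𝕎 ∧
      ∫ w, A w (w a' - w a) (w a' - w a) ∂𝕎 = ((a' : ℝ) - a) * ∫ w, bilinTrace (A w) ∂𝕎 := by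
  have hi : ∀ i j : Fin r, Integrable
      (fun w => A w (EuclideanSpace.single i 1) (EuclideanSpace.single j 1)) 𝕎 := fun i j =>
    .of_bound ((by fun_prop : Continuous fun q : 𝔽 →L[ℝ] 𝔽 →L[ℝ] ℝ =>
      q (EuclideanSpace.single i 1) (EuclideanSpace.single j 1)).comp_aestronglyMeasurable hAm) C
      (ae_of_all _ fun w => by
        have := (A w).le_of_opNorm₂_le_of_le (hC w) (x := EuclideanSpace.single i 1)
          (y := EuclideanSpace.single j 1) (by simp : _ ≤ (1 : ℝ)) (by simp : _ ≤ (1 : ℝ))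
        simpa using this)
  have hψ : ∀ i j : Fin r, Measurable fun ξ : 𝔽 => ξ i * ξ j := fun i j => by fun_prop
  have hψi : ∀ i j : Fin r, Integrable (fun w : ℂ₀ => (w a' - w a) i * (w a' - w a) j) 𝕎 :=
    fun i j => by
      have h2 : ∀ i, MemLp (fun w : ℂ₀ => (w a' - w a) i) 2 𝕎 := fun i => by
        exact_mod_cast h𝕎.memLp_increment h i 2
      exact (h2 i).integrable_mul (h2 j)
  have hd : ∀ i j : Fin r, DependsOnPast a
      fun w => A w (EuclideanSpace.single i 1) (EuclideanSpace.single j 1) := fun i j =>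
    hA.comp fun q => q (EuclideanSpace.single i 1) (EuclideanSpace.single j 1)
  have h1 : ∀ i j, Integrable (fun w => A w (EuclideanSpace.single i 1)
      (EuclideanSpace.single j 1) * ((w a' - w a) i * (w a' - w a) j)) 𝕎 := fun i j =>
    h𝕎.integrable_mul_increment h (hd i j) (hi i j) (hψ i j) (hψi i j)
  simp_rw [bilin_apply_eq_sum]
  refine ⟨integrable_finsetSum _ fun i _ => integrable_finsetSum _ fun j _ => h1 i j,
    integrable_finsetSum _ fun i _ => hi i i, ?_⟩
  rw [integral_finsetSum _ fun i _ => integrable_finsetSum _ fun j _ => h1 i j]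
  unfold bilinTrace
  rw [integral_finsetSum _ fun i _ => hi i i, Finset.mul_sum]
  refine Finset.sum_congr rfl fun i _ => ?_
  rw [integral_finsetSum _ fun j _ => h1 i j]
  have h2 : ∀ j, ∫ w, A w (EuclideanSpace.single i 1) (EuclideanSpace.single j 1) *
      ((w a' - w a) i * (w a' - w a) j) ∂𝕎 =
      (∫ w, A w (EuclideanSpace.single i 1) (EuclideanSpace.single j 1) ∂𝕎) *
        if i = j then (a' : ℝ) - a else 0 := fun j => by
    rw [← h𝕎.integral_increment_mul h i j]
    exact h𝕎.integral_mul_increment h (hd i j) (hi i j).1 (hψ i j)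
  simp_rw [h2]
  simp [mul_comm]

end PastIncrements

/-! ### The lifted process on path space and its continuity. -/

section LiftPath

variable {d r : ℕ}

local notation "𝔼" => EuclideanSpace ℝ (Fin d)
local notation "𝔽" => EuclideanSpace ℝ (Fin r)
local notation "𝕊" => EuclideanSpace ℝ (Fin d) × (EuclideanSpace ℝ (Fin d) × EuclideanSpace ℝ (Fin r))

variable {O : Set (EuclideanSpace ℝ (Fin d))}
  {σ : EuclideanSpace ℝ (Fin d) → EuclideanSpace ℝ (Fin r) →L[ℝ] EuclideanSpace ℝ (Fin d)}
  {b : EuclideanSpace ℝ (Fin d) → EuclideanSpace ℝ (Fin d)}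
  {H : EuclideanSpace ℝ (Fin d) × (EuclideanSpace ℝ (Fin d) × EuclideanSpace ℝ (Fin r)) → ℝ}

/-- The process `(X, X - L, W)`. -/
def liftPath (ω : PathSpace r O) (t : ℝ≥0) : 𝕊 := (ω.1 t, ((ω.1 t : 𝔼) - ω.2.1 t, ω.2.2 t))

lemma liftPath_mem (ω : PathSpace r O) (t : ℝ≥0) :
    liftPath ω t ∈ closure O ×ˢ (univ : Set (𝔼 × 𝔽)) := ⟨(ω.1 t).2, mem_univ _⟩

lemma continuous_liftPath : Continuous fun p : PathSpace r O × ℝ≥0 => liftPath p.1 p.2 := by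
  unfold liftPath; fun_prop

/-- The increment of `H(X, X - L, W)` in excess of the integral of the generator. -/
noncomputable def liftIncrement (σ : 𝔼 → 𝔽 →L[ℝ] 𝔼) (b : 𝔼 → 𝔼) (H : 𝕊 → ℝ) (s t : ℝ≥0)
    (ω : PathSpace r O) : ℝ :=
  H (liftPath ω t) - H (liftPath ω s) -
    ∫ u in (s : ℝ)..t, liftGen O σ b H (liftPath ω u.toNNReal)

/-- The trajectories stopped at time `s`. -/
def stopTriple (s : ℝ≥0) (ω : PathSpace r O) : PathSpace r O :=
  (stopPath s ω.1, (stopPath s ω.2.1, stopPath s ω.2.2))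

lemma continuous_stopTriple (s : ℝ≥0) : Continuous (stopTriple (r := r) (O := O) s) :=
  ((continuous_stopPath s).comp continuous_fst).prodMk
    (((continuous_stopPath s).comp (continuous_fst.comp continuous_snd)).prodMk
      ((continuous_stopPath s).comp (continuous_snd.comp continuous_snd)))

variable (hg : ContinuousOn (liftGen O σ b H) (closure O ×ˢ univ)) (hH : Continuous H)

include hg in
lemma continuous_liftGen_liftPath :
    Continuous fun p : PathSpace r O × ℝ => liftGen O σ b H (liftPath p.1 p.2.toNNReal) :=
  hg.comp_continuous (f := fun p : PathSpace r O × ℝ => liftPath p.1 p.2.toNNReal)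
    (continuous_liftPath.comp (by fun_prop : Continuous fun p : PathSpace r O × ℝ =>
      (p.1, p.2.toNNReal))) fun p => liftPath_mem _ _

include hg in
lemma intervalIntegrable_liftGen_liftPath (ω : PathSpace r O) (s t : ℝ) :
    IntervalIntegrable (fun u => liftGen O σ b H (liftPath ω u.toNNReal)) volume s t :=
  ((continuous_liftGen_liftPath hg).comp (Continuous.prodMk_right ω)).intervalIntegrable _ _

include hg hH in
lemma continuous_liftIncrement (s t : ℝ≥0) :
    Continuous (liftIncrement (O := O) σ b H s t) := by
  have h1 : ∀ t : ℝ≥0, Continuous fun ω : PathSpace r O => H (liftPath ω t) := fun t =>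
    hH.comp (continuous_liftPath.comp (Continuous.prodMk_left t))
  exact ((h1 t).sub (h1 s)).sub
    (intervalIntegral.continuous_parametric_intervalIntegral_of_continuous'
      (continuous_liftGen_liftPath hg) _ _)

include hg in
lemma liftIncrement_add (ω : PathSpace r O) (s t u : ℝ≥0) :
    liftIncrement σ b H s t ω + liftIncrement σ b H t u ω = liftIncrement σ b H s u ω := by
  unfold liftIncrement
  rw [← intervalIntegral.integral_add_adjacent_intervals
    (intervalIntegrable_liftGen_liftPath hg ω s t) (intervalIntegrable_liftGen_liftPath hg ω t u)]
  ring

lemma abs_liftIncrement_le {C : ℝ} (h1 : ∀ z ∈ closure O ×ˢ univ, |H z| ≤ C)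
    (h2 : ∀ z ∈ closure O ×ˢ univ, |liftGen O σ b H z| ≤ C) (s t : ℝ≥0) (ω : PathSpace r O) :
    |liftIncrement σ b H s t ω| ≤ 2 * C + C * |(t : ℝ) - s| := by
  have h3 := intervalIntegral.norm_integral_le_of_norm_le_const (a := (s : ℝ)) (b := t)
    (f := fun u => liftGen O σ b H (liftPath ω u.toNNReal)) (C := C)
    fun u _ => h2 _ (liftPath_mem ω _)
  rw [Real.norm_eq_abs] at h3
  have h4 := h1 _ (liftPath_mem ω t)
  have h5 := h1 _ (liftPath_mem ω s)
  unfold liftIncrement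
  rw [abs_le] at h3 h4 h5 ⊢
  constructor <;> linarith [h3.1, h3.2, h4.1, h4.2, h5.1, h5.2]

end LiftPath

end WongZakai

namespace WongZakai

/-! ### Solutions driven by a dyadic polygonalization, interval by interval. -/

section Level

variable {d r : ℕ}

local notation "𝔼" => EuclideanSpace ℝ (Fin d)
local notation "𝔽" => EuclideanSpace ℝ (Fin r)
local notation "ℂ₀" => C(ℝ≥0, EuclideanSpace ℝ (Fin r))
local notation "𝕊" => EuclideanSpace ℝ (Fin d) × (EuclideanSpace ℝ (Fin d) × EuclideanSpace ℝ (Fin r))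

variable {O : Set (EuclideanSpace ℝ (Fin d))}
  {σ : EuclideanSpace ℝ (Fin d) → EuclideanSpace ℝ (Fin r) →L[ℝ] EuclideanSpace ℝ (Fin d)}
  {b : EuclideanSpace ℝ (Fin d) → EuclideanSpace ℝ (Fin d)}
  {H : EuclideanSpace ℝ (Fin d) × (EuclideanSpace ℝ (Fin d) × EuclideanSpace ℝ (Fin r)) → ℝ}
  {x₀ : EuclideanSpace ℝ (Fin d)} {Kσ Kb : ℝ≥0}

/-- The restriction to `[0, k 2⁻ᴺ]` of the solution driven by the dyadic polygonalization only
depends on the restriction of the path to this interval. -/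
lemma IsReflectedSolution.eq_of_eq_past (hO : IsAdmissible O) (hObdd : Bornology.IsBounded O)
    (hσ : LipschitzOnWith Kσ σ (closure O)) (hb : LipschitzOnWith Kb b (closure O)) {N k : ℕ}
    {w w' : ℂ₀} {x x' : C(ℝ≥0, closure O)} {ℓ ℓ' : C(ℝ≥0, 𝔼)}
    (h : IsReflectedSolution O σ b x₀ (polygonal N w) x ℓ)
    (h' : IsReflectedSolution O σ b x₀ (polygonal N w') x' ℓ')
    (hw : ∀ u ≤ (k : ℝ≥0) / 2 ^ N, w u = w' u) {t : ℝ≥0} (ht : t ≤ (k : ℝ≥0) / 2 ^ N) :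
    x t = x' t ∧ ℓ t = ℓ' t := by
  obtain ⟨h0, hy, n, m, harc⟩ := h.exists_isReflectedArc hσ.continuousOn hb.continuousOn
  obtain ⟨h0', hy', n', m', harc'⟩ := h'.exists_isReflectedArc hσ.continuousOn hb.continuousOn
  set T : ℝ := (k : ℝ) / 2 ^ N with hT
  have hTc : ((k : ℝ≥0) / 2 ^ N : ℝ≥0) = T := by rw [hT]; push_cast; rfl
  have htT : (t : ℝ) ≤ T := by rw [← hTc]; exact_mod_cast ht
  obtain ⟨C, hC⟩ := norm_deriv_polygonal_le N w T
  have hder : (fun s => deriv (fun u : ℝ => polygonal N w u.toNNReal) s)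
      =ᵐ[volume.restrict (Icc 0 T)] fun s => deriv (fun u : ℝ => polygonal N w' u.toNNReal) s := by
    rw [← Measure.restrict_congr_set (Ioo_ae_eq_Icc (a := (0 : ℝ)) (b := T))]
    filter_upwards [ae_restrict_mem measurableSet_Ioo] with s hs
    refine Filter.EventuallyEq.deriv_eq ?_
    filter_upwards [Ioo_mem_nhds hs.1 hs.2] with u hu
    refine polygonal_congr N k hw ?_
    rw [Real.toNNReal_le_iff_le_coe, hTc]; exact hu.2.le
  have heq : ∀ s ∈ Icc 0 T, (x s.toNNReal : 𝔼) = x' s.toNNReal := fun s hs =>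
    IsReflectedArc.eq_of_drift_eq hO hObdd hσ hb hC (harc T)
      ((harc' T).congr_drift (by
        filter_upwards [hder] with s hs
        rw [hs])) (by fun_prop) (by fun_prop) (by simp only [Real.toNNReal_zero]; rw [h0, h0']) hs
  have hx : (x t : 𝔼) = x' t := by simpa using heq t ⟨t.2, htT⟩
  refine ⟨Subtype.ext hx, ?_⟩
  -- Once the paths agree, so do the integrals that express X - L, and hence the reflection terms.
  have e : ∫ s in Ioc (0 : ℝ) t, (σ (x s.toNNReal) (deriv (fun u : ℝ => polygonal N w u.toNNReal) s) +
      b (x s.toNNReal)) = ∫ s in Ioc (0 : ℝ) t,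
      (σ (x' s.toNNReal) (deriv (fun u : ℝ => polygonal N w' u.toNNReal) s) + b (x' s.toNNReal)) := by
    refine integral_congr_ae ?_
    filter_upwards [ae_restrict_of_ae_restrict_of_subset
      (fun s hs => ⟨hs.1.le, hs.2.trans htT⟩ : Ioc (0 : ℝ) t ⊆ Icc 0 T) hder,
      ae_restrict_mem measurableSet_Ioc] with s hs hsI
    rw [hs, heq s ⟨hsI.1.le, hsI.2.trans htT⟩]
  have h1 := hy t
  rw [e, ← hy' t, hx] at h1
  exact sub_right_injective h1

/-- The solution on a dyadic interval. -/
lemma IsReflectedSolution.exists_isReflectedArc_step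
    (hσ : ContinuousOn σ (closure O)) (hb : ContinuousOn b (closure O)) {N : ℕ} (k : ℕ)
    {w : ℂ₀} {x : C(ℝ≥0, closure O)} {ℓ : C(ℝ≥0, 𝔼)}
    (h : IsReflectedSolution O σ b x₀ (polygonal N w) x ℓ) :
    ∃ n m, IsReflectedArc O ((k : ℝ) / 2 ^ N) (((k + 1 : ℕ) : ℝ) / 2 ^ N)
      (fun s => (x s.toNNReal : 𝔼))
      (fun s => σ (x s.toNNReal) (slope N w k) + b (x s.toNNReal)) n m ∧
      ∀ t ∈ Icc ((k : ℝ) / 2 ^ N) (((k + 1 : ℕ) : ℝ) / 2 ^ N),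
        (x t.toNNReal : 𝔼) - ℓ t.toNNReal =
          (x ((k : ℝ) / 2 ^ N).toNNReal : 𝔼) - ℓ ((k : ℝ) / 2 ^ N).toNNReal +
          ∫ s in Ioc ((k : ℝ) / 2 ^ N) t, (σ (x s.toNNReal) (slope N w k) + b (x s.toNNReal)) := by
  obtain ⟨-, hy, n, m, harc⟩ := h.exists_isReflectedArc hσ hb
  have ha0 : 0 ≤ (k : ℝ) / 2 ^ N := by positivity
  set a := (k : ℝ) / 2 ^ N with ha
  set a' := ((k + 1 : ℕ) : ℝ) / 2 ^ N with ha'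
  have hv : (fun s : ℝ => σ (x s.toNNReal) (deriv (fun u : ℝ => polygonal N w u.toNNReal) s) +
      b (x s.toNNReal)) =ᵐ[volume.restrict (Icc a a')]
      fun s => σ (x s.toNNReal) (slope N w k) + b (x s.toNNReal) := by
    rw [← Measure.restrict_congr_set (Ioo_ae_eq_Icc (a := a) (b := a'))]
    filter_upwards [ae_restrict_mem measurableSet_Ioo] with s hs
    rw [deriv_polygonal N k w hs]
  refine ⟨n, m, ((harc a').mono ha0 le_rfl).congr_drift hv, fun t ht => ?_⟩
  have h1 := hy t.toNNReal
  have h2 := hy a.toNNReal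
  rw [Real.coe_toNNReal _ (ha0.trans ht.1)] at h1
  rw [Real.coe_toNNReal _ ha0] at h2
  have hI := (harc a').integrable_drift
  rw [h1, h2, ← Ioc_union_Ioc_eq_Ioc ha0 ht.1, setIntegral_union
    (Ioc_disjoint_Ioc_of_le le_rfl) measurableSet_Ioc
    (hI.mono_set fun s hs => ⟨hs.1.le, hs.2.trans (ht.1.trans ht.2)⟩)
    (hI.mono_set fun s hs => ⟨ha0.trans hs.1.le, hs.2.trans ht.2⟩), add_assoc]
  congr 2
  refine integral_congr_ae (ae_restrict_of_ae_restrict_of_subset ?_ hv)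
  exact fun s hs => ⟨hs.1.le, hs.2.trans ht.2⟩

lemma smul_slope (N k : ℕ) (w : ℂ₀) :
    ((((k + 1 : ℕ) : ℝ) / 2 ^ N) - (k : ℝ) / 2 ^ N) • slope N w k =
      w (((k + 1 : ℕ) : ℝ≥0) / 2 ^ N) - w ((k : ℝ≥0) / 2 ^ N) := by
  rw [slope, smul_smul]
  have : (((k + 1 : ℕ) : ℝ) / 2 ^ N - k / 2 ^ N) * 2 ^ N = 1 := by
    push_cast; field_simp; ring
  rw [this, one_smul]

/-- A lower bound for the increments of `H(X, X - L, W)`, in excess of the generator, for the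
solution driven by the dyadic polygonalization. -/
theorem exists_dyadic_step_bound (hO : IsAdmissible O) (hObdd : Bornology.IsBounded O)
    (hσ : LipschitzOnWith Kσ σ (closure O)) (hσ1 : ContDiffOn ℝ 1 σ (closure O))
    (hb : LipschitzOnWith Kb b (closure O)) (hH : ContDiff ℝ 2 H)
    (hn : ∀ x ∈ frontier O, ∀ n ∈ inwardNormals O x, ∀ p, 0 ≤ fderiv ℝ H (x, p) (n, 0))
    {ρ : ℝ} (hρ : ∀ z, ρ < ‖z.2‖ → H z = 0) {ε : ℝ} (hε : 0 < ε) :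
    ∃ (Φ : 𝔼 → ℝ) (G : 𝕊 → 𝔽 →L[ℝ] ℝ) (C : ℝ), ContinuousOn Φ (closure O) ∧
      (∀ x ∈ closure O, |Φ x| ≤ ε) ∧ ContinuousOn G (closure O ×ˢ univ) ∧ 0 ≤ C ∧
      (∀ z ∈ closure O ×ˢ univ, ‖G z‖ ≤ C) ∧
      (∀ z ∈ closure O ×ˢ univ, ‖hessNoise O σ H z‖ ≤ C) ∧
      ∀ (N k : ℕ) (w : ℂ₀) (x : C(ℝ≥0, closure O)) (ℓ : C(ℝ≥0, 𝔼)) (a a' : ℝ≥0) (Δ : 𝔽),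
        IsReflectedSolution O σ b x₀ (polygonal N w) x ℓ →
        a = (k : ℝ≥0) / 2 ^ N → a' = ((k + 1 : ℕ) : ℝ≥0) / 2 ^ N → Δ = w a' - w a →
        G (liftPath (x, ℓ, polygonal N w) a) Δ +
        (1 / 2 : ℝ) * (hessNoise O σ H (liftPath (x, ℓ, polygonal N w) a) Δ Δ -
          ((a' : ℝ) - a) * bilinTrace (hessNoise O σ H (liftPath (x, ℓ, polygonal N w) a))) -
        (ε * (‖Δ‖ ^ 2 + ((a' : ℝ) - a)) + C * (‖Δ‖ ^ 4 + ((a' : ℝ) - a) ^ 2)) ≤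
      liftIncrement σ b H a a' (x, ℓ, polygonal N w) + Φ (x a') - Φ (x a) := by
  obtain ⟨Φ, G, C, h1, h2, h3, h4, h5, h6, h⟩ :=
    exists_step_bound hO hObdd hσ hσ1 hb hH hn hρ hε
  refine ⟨Φ, G, C, h1, h2, h3, h4, h5, h6, fun N k w x ℓ a a' Δ hsol ha ha' hΔ => ?_⟩
  obtain ⟨n, m, harc, hy⟩ := hsol.exists_isReflectedArc_step hσ.continuousOn hb.continuousOn k
  have hac : (a : ℝ) = (k : ℝ) / 2 ^ N := by rw [ha]; push_cast; rfl
  have hac' : (a' : ℝ) = ((k + 1 : ℕ) : ℝ) / 2 ^ N := by rw [ha']; push_cast; rfl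
  have hΔ' : ((a' : ℝ) - a) • slope N w k = Δ := by
    rw [hΔ, ha, ha', ← smul_slope, ← hac, ← hac', ha, ha']
  rw [← hac, ← hac'] at harc hy
  have hle : (a : ℝ) ≤ a' := by
    rw [hac, hac']; gcongr; simp
  have hτ1 : (a' : ℝ) - a ≤ 1 := by
    rw [hac, hac', div_sub_div_same, div_le_one (by positivity)]
    push_cast
    have := one_le_pow₀ (M₀ := ℝ) (one_le_two) (n := N)
    linarith
  have key := h a a' (slope N w k) (fun s => (x s.toNNReal : 𝔼)) n
    (fun s => (x s.toNNReal : 𝔼) - ℓ s.toNNReal) (fun s => polygonal N w s.toNNReal) m hle hτ1 harc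
    hy (fun t ht => by
      have e := polygonal_eq_of_mem_Icc N k w (s := t) (by rwa [← hac, ← hac'])
      have e' := polygonal_eq_of_mem_Icc N k w (s := a) (by rw [← hac, ← hac']; exact ⟨le_rfl, hle⟩)
      rw [e, e', ← hac]; simp)
  rw [hΔ'] at key
  simp only [Real.toNNReal_coe] at key
  rw [← intervalIntegral.integral_of_le hle] at key
  unfold liftIncrement
  unfold liftPath
  linarith

end Level

end WongZakai

namespace WongZakai

/-! ### Expectation bounds summed over the dyadic steps. -/

section Expectation

variable {d r : ℕ}

local notation "𝔼" => EuclideanSpace ℝ (Fin d)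
local notation "𝔽" => EuclideanSpace ℝ (Fin r)
local notation "ℂ₀" => C(ℝ≥0, EuclideanSpace ℝ (Fin r))
local notation "𝕊" => EuclideanSpace ℝ (Fin d) × (EuclideanSpace ℝ (Fin d) × EuclideanSpace ℝ (Fin r))

variable {O : Set (EuclideanSpace ℝ (Fin d))}
  {σ : EuclideanSpace ℝ (Fin d) → EuclideanSpace ℝ (Fin r) →L[ℝ] EuclideanSpace ℝ (Fin d)}
  {b : EuclideanSpace ℝ (Fin d) → EuclideanSpace ℝ (Fin d)}
  {H : EuclideanSpace ℝ (Fin d) × (EuclideanSpace ℝ (Fin d) × EuclideanSpace ℝ (Fin r)) → ℝ}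
  {x₀ : EuclideanSpace ℝ (Fin d)} {Kσ Kb : ℝ≥0}
  {𝕎 : Measure C(ℝ≥0, EuclideanSpace ℝ (Fin r))} [IsProbabilityMeasure 𝕎]

lemma liftGen_eq_zero_of_cutoff {ρ : ℝ} (hρ : ∀ z, ρ < ‖z.2‖ → H z = 0) {z : 𝕊}
    (hz : ρ < ‖z.2‖) : liftGen O σ b H z = 0 := by
  rw [liftGen, hessNoise_eq_zero_of_cutoff hρ hz, fderiv_eq_zero_of_cutoff hρ hz]
  simp [bilinTrace]

lemma exists_bound_of_cutoff (hO : IsAdmissible O) (hObdd : Bornology.IsBounded O)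
    (hσ1 : ContDiffOn ℝ 1 σ (closure O)) (hb : ContinuousOn b (closure O)) (hH : ContDiff ℝ 2 H)
    {ρ : ℝ} (hρ : ∀ z, ρ < ‖z.2‖ → H z = 0) :
    ∃ C : ℝ, (∀ z ∈ closure O ×ˢ univ, |H z| ≤ C) ∧
      ∀ z ∈ closure O ×ˢ univ, |liftGen O σ b H z| ≤ C := by
  obtain ⟨C₁, h1, hC₁⟩ := exists_bound_of_eq_zero (ρ := ρ) (f := H) hObdd.isCompact_closure
    hH.continuous.continuousOn hρ
  obtain ⟨C₂, h2, hC₂⟩ := exists_bound_of_eq_zero (ρ := ρ) (f := liftGen O σ b H)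
    hObdd.isCompact_closure (continuousOn_liftGen hO hσ1 hb hH)
    fun z hz => liftGen_eq_zero_of_cutoff hρ hz
  exact ⟨C₁ + C₂, fun z hz => (hC₁ z hz).trans (by linarith),
    fun z hz => (hC₂ z hz).trans (by linarith)⟩

/-- Per step of length τ this is O(ε τ) + O(τ²). Over about T / τ steps it leaves a multiple of ε
and a term that vanishes with the mesh. -/
lemma integral_smul_bound_le (h𝕎 : IsWienerMeasure 𝕎) {a a' : ℝ≥0} (h : a ≤ a') (ε C : ℝ)
    (hC : 0 ≤ C) :
    Integrable (fun w : ℂ₀ => ε * (‖w a' - w a‖ ^ 2 + ((a' : ℝ) - a)) +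
      C * (‖w a' - w a‖ ^ 4 + ((a' : ℝ) - a) ^ 2)) 𝕎 ∧
    ∫ w : ℂ₀, (ε * (‖w a' - w a‖ ^ 2 + ((a' : ℝ) - a)) +
      C * (‖w a' - w a‖ ^ 4 + ((a' : ℝ) - a) ^ 2)) ∂𝕎 ≤
      ε * ((r + 1) * ((a' : ℝ) - a)) + C * ((fourthMoment r + 1) * ((a' : ℝ) - a) ^ 2) := by
  have i2 : Integrable (fun w : ℂ₀ => ‖w a' - w a‖ ^ 2) 𝕎 := by
    have := (h𝕎.memLp_norm_increment h 2).integrable_norm_pow (p := 2) (by norm_num)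
    simpa using this
  have i4 : Integrable (fun w : ℂ₀ => ‖w a' - w a‖ ^ 4) 𝕎 := by
    have := (h𝕎.memLp_norm_increment h 4).integrable_norm_pow (p := 4) (by norm_num)
    simpa using this
  have j2 : Integrable (fun w : ℂ₀ => ε * (‖w a' - w a‖ ^ 2 + ((a' : ℝ) - a))) 𝕎 :=
    (i2.add (integrable_const _)).const_mul _
  have j4 : Integrable (fun w : ℂ₀ => C * (‖w a' - w a‖ ^ 4 + ((a' : ℝ) - a) ^ 2)) 𝕎 :=
    (i4.add (integrable_const _)).const_mul _
  refine ⟨j2.add j4, ?_⟩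
  rw [integral_add j2 j4, integral_const_mul, integral_const_mul,
    integral_add i2 (integrable_const _), integral_add i4 (integrable_const _),
    h𝕎.integral_norm_increment_sq h]
  have h4 := mul_le_mul_of_nonneg_left (h𝕎.integral_norm_increment_pow_four_le h) hC
  simp only [integral_const, probReal_univ, one_smul]
  linarith

/-- Asymptotically, `H(X, X - L, W)` is a submartingale in excess of its generator along the
solutions driven by the dyadic polygonalizations. -/
theorem exists_expectation_bound (hO : IsAdmissible O) (hObdd : Bornology.IsBounded O)
    (hσ : LipschitzOnWith Kσ σ (closure O)) (hσ1 : ContDiffOn ℝ 1 σ (closure O))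
    (hb : LipschitzOnWith Kb b (closure O)) (hH : ContDiff ℝ 2 H)
    (hn : ∀ x ∈ frontier O, ∀ n ∈ inwardNormals O x, ∀ p, 0 ≤ fderiv ℝ H (x, p) (n, 0))
    {ρ : ℝ} (hρ : ∀ z, ρ < ‖z.2‖ → H z = 0) (h𝕎 : IsWienerMeasure 𝕎) {ε : ℝ} (hε : 0 < ε) :
    ∃ C : ℝ, 0 ≤ C ∧ ∀ (N : ℕ) (X : ℂ₀ → C(ℝ≥0, closure O)) (L : ℂ₀ → C(ℝ≥0, 𝔼)),
      (∀ w, IsReflectedSolution O σ b x₀ (polygonal N w) (X w) (L w)) →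
      AEMeasurable (fun w => ((X w, L w, polygonal N w) : PathSpace r O)) 𝕎 →
      ∀ F : PathSpace r O → ℝ, Continuous F → (∀ ω, 0 ≤ F ω) → (∀ ω, F ω ≤ 1) →
      ∀ i j : ℕ, i ≤ j →
        -(2 * ε + ((j : ℝ) - i) / 2 ^ N * (ε * (r + 1) + C / 2 ^ N)) ≤
        ∫ w, F (stopTriple ((i : ℝ≥0) / 2 ^ N) (X w, L w, polygonal N w)) *
          liftIncrement σ b H ((i : ℝ≥0) / 2 ^ N) ((j : ℝ≥0) / 2 ^ N)
            ((X w, L w, polygonal N w) : PathSpace r O) ∂𝕎 := by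
  obtain ⟨Φ, G, C, hΦc, hΦ, hGc, hC0, hG, hA, hstep⟩ :=
    exists_dyadic_step_bound (x₀ := x₀) hO hObdd hσ hσ1 hb hH hn hρ hε
  obtain ⟨S, hS1, hS2⟩ := exists_bound_of_cutoff hO hObdd hσ1 hb.continuousOn hH hρ
  have hgenc := continuousOn_liftGen hO hσ1 hb.continuousOn hH
  have hAc := continuousOn_hessNoise hO hσ1 hH
  refine ⟨C * (fourthMoment r + 1), mul_nonneg hC0 (by have := fourthMoment_nonneg (r := r); linarith),
    fun N X L hsol hmeas F hFc hF0 hF1 i j hij => ?_⟩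
  set Θ : ℂ₀ → PathSpace r O := fun w => (X w, L w, polygonal N w) with hΘ
  set t : ℕ → ℝ≥0 := fun k => (k : ℝ≥0) / 2 ^ N with ht
  have htmono : Monotone t := fun k k' h => by simp only [ht]; gcongr
  have htdiff : ∀ k, (t (k + 1) : ℝ) - t k = 1 / 2 ^ N := fun k => by
    simp only [ht]; push_cast; ring
  set f : ℂ₀ → ℝ := fun w => F (stopTriple (t i) (Θ w)) with hf
  -- Adaptedness at grid times comes from pathwise uniqueness, so the given family of solutions need
  -- not be chosen measurably with respect to the past.
  have hpast : ∀ k w w', (∀ u ≤ t k, w u = w' u) → ∀ u ≤ t k,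
      (Θ w).1 u = (Θ w').1 u ∧ (Θ w).2.1 u = (Θ w').2.1 u ∧ (Θ w).2.2 u = (Θ w').2.2 u := by
    intro k w w' h u hu
    obtain ⟨h1, h2⟩ := (hsol w).eq_of_eq_past hO hObdd hσ hb (hsol w') h hu
    exact ⟨h1, h2, polygonal_congr N k h hu⟩
  have hfpast : ∀ k, i ≤ k → DependsOnPast (t k) f := by
    intro k hk w w' h
    refine congrArg F (Prod.ext ?_ (Prod.ext ?_ ?_)) <;> ext1 u
    · exact (hpast k w w' h _ ((min_le_right _ _).trans (htmono hk))).1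
    · exact (hpast k w w' h _ ((min_le_right _ _).trans (htmono hk))).2.1
    · exact (hpast k w w' h _ ((min_le_right _ _).trans (htmono hk))).2.2
  have hZpast : ∀ k, DependsOnPast (t k) fun w => liftPath (Θ w) (t k) := by
    intro k w w' h
    obtain ⟨h1, h2, h3⟩ := hpast k w w' h _ le_rfl
    simp only [liftPath]
    rw [h1, h2, h3]
  have hΘm : AEStronglyMeasurable Θ 𝕎 := hmeas.aestronglyMeasurable
  have hfm : AEStronglyMeasurable f 𝕎 :=
    (hFc.comp (continuous_stopTriple _)).comp_aestronglyMeasurable hΘm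
  have hf1 : ∀ w, ‖f w‖ ≤ 1 := fun w => by
    rw [Real.norm_of_nonneg (hF0 _)]; exact hF1 _
  have hZm : ∀ {Y : Type} [TopologicalSpace Y] {g : 𝕊 → Y} (k : ℕ),
      ContinuousOn g (closure O ×ˢ univ) →
      AEStronglyMeasurable (fun w => g (liftPath (Θ w) (t k))) 𝕎 := fun k hg =>
    (hg.comp_continuous (continuous_liftPath.comp (Continuous.prodMk_left (t k)))
      fun ω => liftPath_mem ω _).comp_aestronglyMeasurable hΘm
  have hΦm : ∀ k, AEStronglyMeasurable (fun w => Φ (X w (t k))) 𝕎 := fun k =>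
    hZm k (g := fun z => Φ z.1) (hΦc.comp continuousOn_fst fun z hz => hz.1)
  have hΦb : ∀ k w, |Φ (X w (t k))| ≤ ε := fun k w => hΦ _ (X w (t k)).2
  have hJint : ∀ k k', Integrable (fun w => f w *
      (liftIncrement σ b H (t k) (t k') (Θ w) + Φ (X w (t k')) - Φ (X w (t k)))) 𝕎 := by
    intro k k'
    refine Integrable.of_bound (hfm.mul (((continuous_liftIncrement hgenc
      hH.continuous _ _).comp_aestronglyMeasurable hΘm).add (hΦm k') |>.sub (hΦm k)))
      (2 * S + S * |(t k' : ℝ) - t k| + 2 * ε) (ae_of_all _ fun w => ?_)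
    rw [norm_mul]
    refine (mul_le_of_le_one_left (norm_nonneg _) (hf1 w)).trans ?_
    have h1 := abs_le.1 (abs_liftIncrement_le hS1 hS2 (t k) (t k') (Θ w))
    have h2 := abs_le.1 (hΦb k w)
    have h3 := abs_le.1 (hΦb k' w)
    rw [Real.norm_eq_abs, abs_le]
    constructor <;> linarith [h1.1, h1.2, h2.1, h2.2, h3.1, h3.2]
  have hone : ∀ k, i ≤ k → -(1 / 2 ^ N * (ε * (r + 1) + C * (fourthMoment r + 1) / 2 ^ N)) ≤
      ∫ w, f w * (liftIncrement σ b H (t k) (t (k + 1)) (Θ w) + Φ (X w (t (k + 1))) -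
        Φ (X w (t k))) ∂𝕎 := by
    intro k hk
    have hle : t k ≤ t (k + 1) := htmono (Nat.le_succ k)
    obtain ⟨g1, g2⟩ := h𝕎.integral_clm_increment hle (g := fun w => f w • G (liftPath (Θ w) (t k)))
      (fun w w' h => congrArg₂ (fun (c : ℝ) z => c • G z) (hfpast k hk w w' h) (hZpast k w w' h))
      (hfm.smul (hZm k hGc)) (C := C) fun w => by
        rw [norm_smul]
        exact (mul_le_of_le_one_left (norm_nonneg _) (hf1 w)).trans (hG _ (liftPath_mem _ _))
    obtain ⟨b1, b2, b3⟩ := h𝕎.integral_bilin_increment hle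
      (A := fun w => f w • hessNoise O σ H (liftPath (Θ w) (t k)))
      (fun w w' h => congrArg₂ (fun (c : ℝ) z => c • hessNoise O σ H z) (hfpast k hk w w' h)
        (hZpast k w w' h))
      (hfm.smul (hZm k hAc)) (C := C) fun w => by
        refine (ContinuousLinearMap.opNorm_smul_le _ _).trans ?_
        exact (mul_le_of_le_one_left (ContinuousLinearMap.opNorm_nonneg _) (hf1 w)).trans
          (hA _ (liftPath_mem _ _))
    obtain ⟨e1, e2⟩ := integral_smul_bound_le h𝕎 hle ε C hC0
    have hlow := (g1.add (((b1.sub (b2.const_mul ((t (k + 1) : ℝ) - t k))).const_mul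
      (1 / 2 : ℝ)))).sub e1
    have hmono := integral_mono hlow (hJint k (k + 1)) fun w => by
      have h1 := hstep N k w (X w) (L w) (t k) (t (k + 1)) _ (hsol w) rfl rfl rfl
      have hf0 : 0 ≤ f w := hF0 _
      have h2 := mul_le_mul_of_nonneg_left h1 hf0
      -- The test functional is at most one and the error is nonnegative, so the functional may be
      -- removed from the error.
      have h3 : f w * (ε * (‖w (t (k + 1)) - w (t k)‖ ^ 2 + ((t (k + 1) : ℝ) - t k)) +
          C * (‖w (t (k + 1)) - w (t k)‖ ^ 4 + ((t (k + 1) : ℝ) - t k) ^ 2)) ≤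
          (ε * (‖w (t (k + 1)) - w (t k)‖ ^ 2 + ((t (k + 1) : ℝ) - t k)) +
          C * (‖w (t (k + 1)) - w (t k)‖ ^ 4 + ((t (k + 1) : ℝ) - t k) ^ 2)) := by
        refine mul_le_of_le_one_left ?_ (hF1 _)
        have : (0 : ℝ) ≤ (t (k + 1) : ℝ) - t k := by rw [htdiff]; positivity
        positivity
      have h4 : bilinTrace (f w • hessNoise O σ H (liftPath (Θ w) (t k))) =
          f w * bilinTrace (hessNoise O σ H (liftPath (Θ w) (t k))) := by
        simp [bilinTrace, Finset.mul_sum]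
      simp only [Pi.add_apply, Pi.sub_apply, _root_.smul_apply, smul_eq_mul, h4]
      linarith
    refine le_trans ?_ hmono
    rw [integral_sub' (g1.add ((b1.sub (b2.const_mul _)).const_mul _)) e1,
      integral_add' g1 ((b1.sub (b2.const_mul _)).const_mul _), g2, zero_add, integral_const_mul,
      integral_sub' b1 (b2.const_mul _), integral_const_mul, b3, sub_self, mul_zero, zero_sub]
    refine neg_le_neg (e2.trans (le_of_eq ?_))
    rw [htdiff]; ring
  -- The corrector telescopes, so the functional `f`, fixed at time `t i`, multiplies a single
  -- difference of `Φ`. Removing it afterwards costs `2 * ε` whatever the number of steps.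
  have hind : ∀ j, i ≤ j →
      -(((j : ℝ) - i) * (1 / 2 ^ N * (ε * (r + 1) + C * (fourthMoment r + 1) / 2 ^ N))) ≤
      ∫ w, f w * (liftIncrement σ b H (t i) (t j) (Θ w) + Φ (X w (t j)) - Φ (X w (t i))) ∂𝕎 := by
    intro j hij
    induction j, hij using Nat.le_induction with
    | base => simp [liftIncrement]
    | succ j hij ih =>
      have e : ∀ w, f w * (liftIncrement σ b H (t i) (t (j + 1)) (Θ w) + Φ (X w (t (j + 1))) -
          Φ (X w (t i))) =
          f w * (liftIncrement σ b H (t i) (t j) (Θ w) + Φ (X w (t j)) - Φ (X w (t i))) +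
          f w * (liftIncrement σ b H (t j) (t (j + 1)) (Θ w) + Φ (X w (t (j + 1))) -
          Φ (X w (t j))) := fun w => by
        rw [← liftIncrement_add hgenc (Θ w) (t i) (t j) (t (j + 1))]; ring
      simp_rw [e]
      rw [integral_add (hJint _ _) (hJint _ _)]
      have := hone j hij
      push_cast
      linarith
  have hlast := hind j hij
  have hfi : Integrable (fun w => f w * liftIncrement σ b H (t i) (t j) (Θ w)) 𝕎 := by
    refine Integrable.of_bound (hfm.mul ((continuous_liftIncrement hgenc
      hH.continuous _ _).comp_aestronglyMeasurable hΘm))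
      (2 * S + S * |(t j : ℝ) - t i|) (ae_of_all _ fun w => ?_)
    rw [norm_mul]
    exact (mul_le_of_le_one_left (norm_nonneg _) (hf1 w)).trans
      (abs_liftIncrement_le hS1 hS2 (t i) (t j) (Θ w))
  have hfin := integral_mono (hJint i j) (hfi.add (integrable_const (2 * ε))) fun w => by
    have h0 : 0 ≤ f w := hF0 _
    have h2 := abs_le.1 (hΦb i w)
    have h3 := abs_le.1 (hΦb j w)
    have h4 : f w * (Φ (X w (t j)) - Φ (X w (t i))) ≤ 2 * ε := by
      refine (mul_le_mul_of_nonneg_left (by linarith [h2.1, h3.2] : _ ≤ 2 * ε) h0).trans ?_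
      exact mul_le_of_le_one_left (by positivity) (hF1 _)
    simp only [Pi.add_apply]
    linarith
  rw [integral_add' hfi (integrable_const _)] at hfin
  simp only [integral_const, probReal_univ, one_smul] at hfin
  have e : ((j : ℝ) - i) / 2 ^ N * (ε * (r + 1) + C * (fourthMoment r + 1) / 2 ^ N) =
    ((j : ℝ) - i) * (1 / 2 ^ N * (ε * (r + 1) + C * (fourthMoment r + 1) / 2 ^ N)) := by ring
  rw [e]
  linarith

end Expectation

end WongZakai

namespace WongZakai

/-! ### Passage to the weak limit and to arbitrary times. -/

section Limit

variable {d r : ℕ}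

local notation "𝔼" => EuclideanSpace ℝ (Fin d)
local notation "𝔽" => EuclideanSpace ℝ (Fin r)
local notation "ℂ₀" => C(ℝ≥0, EuclideanSpace ℝ (Fin r))
local notation "𝕊" => EuclideanSpace ℝ (Fin d) × (EuclideanSpace ℝ (Fin d) × EuclideanSpace ℝ (Fin r))

variable {O : Set (EuclideanSpace ℝ (Fin d))}
  {σ : EuclideanSpace ℝ (Fin d) → EuclideanSpace ℝ (Fin r) →L[ℝ] EuclideanSpace ℝ (Fin d)}
  {b : EuclideanSpace ℝ (Fin d) → EuclideanSpace ℝ (Fin d)}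
  {H : EuclideanSpace ℝ (Fin d) × (EuclideanSpace ℝ (Fin d) × EuclideanSpace ℝ (Fin r)) → ℝ}
  {x₀ : EuclideanSpace ℝ (Fin d)} {Kσ Kb : ℝ≥0}
  {𝕎 : Measure C(ℝ≥0, EuclideanSpace ℝ (Fin r))} [IsProbabilityMeasure 𝕎]
  {X : ℕ → C(ℝ≥0, EuclideanSpace ℝ (Fin r)) → C(ℝ≥0, closure O)}
  {L : ℕ → C(ℝ≥0, EuclideanSpace ℝ (Fin r)) → C(ℝ≥0, EuclideanSpace ℝ (Fin d))}
  {P : ProbabilityMeasure (PathSpace r O)}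

lemma continuous_stopPath_uncurry {Y : Type*} [TopologicalSpace Y] :
    Continuous fun p : ℝ≥0 × C(ℝ≥0, Y) => stopPath p.1 p.2 := by
  refine ContinuousMap.continuous_of_continuous_uncurry _ ?_
  change Continuous fun q : (ℝ≥0 × C(ℝ≥0, Y)) × ℝ≥0 => q.1.2 (min q.2 q.1.1)
  fun_prop

lemma continuous_stopTriple_uncurry :
    Continuous fun p : ℝ≥0 × PathSpace r O => stopTriple p.1 p.2 := by
  refine (continuous_stopPath_uncurry.comp (f := fun p : ℝ≥0 × PathSpace r O => (p.1, p.2.1))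
    (by fun_prop)).prodMk ((continuous_stopPath_uncurry.comp
      (f := fun p : ℝ≥0 × PathSpace r O => (p.1, p.2.2.1)) (by fun_prop)).prodMk
      (continuous_stopPath_uncurry.comp
        (f := fun p : ℝ≥0 × PathSpace r O => (p.1, p.2.2.2)) (by fun_prop)))

/-- `Measure.map` of a map that is not a.e. measurable is zero. The masses converge to one, so this
cannot happen far along the subsequence. -/
lemma eventually_aemeasurable_of_isWeakLimitPoint {k : ℕ → ℕ}
    (hk : Tendsto (fun j => approxLaw 𝕎 (k j) (X (k j)) (L (k j))) atTop (𝓝 P.toFiniteMeasure)) :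
    ∀ᶠ j in atTop,
      AEMeasurable (fun w => ((X (k j) w, L (k j) w, polygonal (k j) w) : PathSpace r O)) 𝕎 := by
  have h1 := hk.mass
  have h2 : P.toFiniteMeasure.mass = 1 := by simp
  rw [h2] at h1
  filter_upwards [h1.eventually (lt_mem_nhds zero_lt_one)] with j hj
  by_contra h
  have : approxLaw 𝕎 (k j) (X (k j)) (L (k j)) = 0 := by
    refine Subtype.ext ?_
    exact Measure.map_of_not_aemeasurable h
  rw [this] at hj
  simp at hj

/-- The submartingale property between dyadic times, for functions with bounded support. -/
lemma integral_liftIncrement_dyadic_nonneg (hO : IsAdmissible O) (hObdd : Bornology.IsBounded O)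
    (hσ : LipschitzOnWith Kσ σ (closure O)) (hσ1 : ContDiffOn ℝ 1 σ (closure O))
    (hb : LipschitzOnWith Kb b (closure O)) (h𝕎 : IsWienerMeasure 𝕎)
    (hXL : ∀ N w, IsReflectedSolution O σ b x₀ (polygonal N w) (X N w) (L N w))
    (hP : IsWeakLimitPoint (fun N => approxLaw 𝕎 N (X N) (L N)) P)
    (hH : ContDiff ℝ 2 H)
    (hn : ∀ x ∈ frontier O, ∀ n ∈ inwardNormals O x, ∀ p, 0 ≤ fderiv ℝ H (x, p) (n, 0))
    {ρ : ℝ} (hρ : ∀ z, ρ < ‖z.2‖ → H z = 0) {F : PathSpace r O → ℝ} (hF : Continuous F)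
    (hF0 : ∀ ω, 0 ≤ F ω) (hF1 : ∀ ω, F ω ≤ 1) (n i j : ℕ) (hij : i ≤ j) :
    0 ≤ ∫ ω, F (stopTriple ((i : ℝ≥0) / 2 ^ n) ω) *
      liftIncrement σ b H ((i : ℝ≥0) / 2 ^ n) ((j : ℝ≥0) / 2 ^ n) ω ∂(P : Measure (PathSpace r O)) := by
  obtain ⟨k, hk, hlim⟩ := hP
  obtain ⟨S, hS1, hS2⟩ := exists_bound_of_cutoff hO hObdd hσ1 hb.continuousOn hH hρ
  have hgenc := continuousOn_liftGen hO hσ1 hb.continuousOn hH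
  set s : ℝ≥0 := (i : ℝ≥0) / 2 ^ n with hs
  set t : ℝ≥0 := (j : ℝ≥0) / 2 ^ n with ht
  have hst : (t : ℝ) - s = ((j : ℝ) - i) / 2 ^ n := by
    rw [hs, ht]; push_cast; ring
  have hst0 : 0 ≤ (t : ℝ) - s := by
    rw [hst]
    have : (i : ℝ) ≤ j := by exact_mod_cast hij
    exact div_nonneg (by linarith) (by positivity)
  set Ψ : PathSpace r O → ℝ := fun ω => F (stopTriple s ω) * liftIncrement σ b H s t ω with hΨ
  have hΨc : Continuous Ψ :=
    (hF.comp (continuous_stopTriple s)).mul (continuous_liftIncrement hgenc hH.continuous s t)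
  have hΨb : ∀ ω, ‖Ψ ω‖ ≤ 2 * S + S * |(t : ℝ) - s| := fun ω => by
    rw [norm_mul]
    refine (mul_le_of_le_one_left (norm_nonneg _) ?_).trans (abs_liftIncrement_le hS1 hS2 s t ω)
    rw [Real.norm_of_nonneg (hF0 _)]; exact hF1 _
  have hconv := (FiniteMeasure.tendsto_iff_forall_integral_tendsto.1 hlim)
    (BoundedContinuousFunction.ofNormedAddCommGroup Ψ hΨc _ hΨb)
  simp only [BoundedContinuousFunction.coe_ofNormedAddCommGroup] at hconv
  change Tendsto _ _ (𝓝 (∫ ω, Ψ ω ∂(P : Measure (PathSpace r O)))) at hconv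
  refine le_of_forall_pos_le_add fun η hη => ?_
  obtain ⟨ε, hε, hεη⟩ : ∃ ε : ℝ, 0 < ε ∧ 2 * ε + ((t : ℝ) - s) * (ε * (r + 1)) ≤ η :=
    ⟨η / (2 + ((t : ℝ) - s) * (r + 1)), by positivity, by
      rw [← sub_nonneg]; field_simp; ring_nf; exact le_rfl⟩
  -- `C` depends on `ε`, but it enters with a factor that tends to zero along the subsequence; `ε`
  -- stays fixed while the limit is taken.
  obtain ⟨C, hC, hbound⟩ := exists_expectation_bound (x₀ := x₀) hO hObdd hσ hσ1 hb hH hn hρ h𝕎 hε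
  have hk' : Tendsto (fun j => 1 / (2 : ℝ) ^ k j) atTop (𝓝 0) := by
    have := (tendsto_pow_atTop_nhds_zero_of_lt_one (r := (1 / 2 : ℝ)) (by norm_num)
      (by norm_num)).comp hk.tendsto_atTop
    refine this.congr fun j => ?_
    simp
  have hlow : Tendsto (fun m => -(2 * ε + ((t : ℝ) - s) * (ε * (r + 1) + C * (1 / 2 ^ k m)))) atTop
      (𝓝 (-(2 * ε + ((t : ℝ) - s) * (ε * (r + 1) + C * 0)))) :=
    (((hk'.const_mul C).const_add _).const_mul _).const_add _ |>.neg
  have hle := le_of_tendsto_of_tendsto hlow hconv (by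
    filter_upwards [eventually_aemeasurable_of_isWeakLimitPoint hlim,
      hk.tendsto_atTop.eventually_ge_atTop n] with m hm hnm
    -- Grid times of level `n` are grid times of every finer level.
    have e : ∀ i : ℕ, ((i * 2 ^ (k m - n) : ℕ) : ℝ≥0) / 2 ^ k m = (i : ℝ≥0) / 2 ^ n := fun i => by
      obtain ⟨c, hc⟩ := Nat.exists_eq_add_of_le hnm
      rw [hc, Nat.add_sub_cancel_left, pow_add]
      push_cast
      field_simp
    have h1 := hbound (k m) (X (k m)) (L (k m)) (hXL (k m)) hm F hF hF0 hF1
      (i * 2 ^ (k m - n)) (j * 2 ^ (k m - n)) (Nat.mul_le_mul_right _ hij)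
    rw [e, e] at h1
    have h2 : (((j * 2 ^ (k m - n) : ℕ) : ℝ) - (i * 2 ^ (k m - n) : ℕ)) / 2 ^ k m = (t : ℝ) - s := by
      rw [sub_div, hs, ht, ← e i, ← e j]; push_cast; rfl
    rw [h2, ← mul_one_div C] at h1
    refine h1.trans (le_of_eq ?_)
    change _ = ∫ ω, Ψ ω ∂(𝕎.map _)
    rw [integral_map hm hΨc.aestronglyMeasurable])
  rw [mul_zero, add_zero] at hle
  linarith

lemma tendsto_dyadic_ceil (s : ℝ≥0) :
    Tendsto (fun n : ℕ => ((⌈s * 2 ^ n⌉₊ : ℕ) : ℝ≥0) / 2 ^ n) atTop (𝓝 s) := by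
  have h1 : Tendsto (fun n : ℕ => s + 1 / 2 ^ n) atTop (𝓝 (s + 0)) := by
    refine tendsto_const_nhds.add ?_
    have := tendsto_pow_atTop_nhds_zero_of_lt_one (r := (1 / 2 : ℝ≥0)) (zero_le) (by
      rw [← NNReal.coe_lt_coe]; norm_num)
    refine this.congr fun j => ?_
    simp
  rw [add_zero] at h1
  refine tendsto_of_tendsto_of_tendsto_of_le_of_le tendsto_const_nhds h1 (fun n => ?_) fun n => ?_
  · have h2 : (0 : ℝ≥0) < 2 ^ n := by positivity
    change s ≤ _ / _
    rw [le_div_iff₀ h2]; exact Nat.le_ceil _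
  · have h2 : (0 : ℝ≥0) < 2 ^ n := by positivity
    change _ / _ ≤ s + _
    rw [div_le_iff₀ h2, add_mul, one_div, inv_mul_cancel₀ h2.ne']
    exact (Nat.ceil_lt_add_one (zero_le)).le

/-- The submartingale property for functions with bounded support. -/
lemma integral_liftIncrement_nonneg_of_cutoff (hO : IsAdmissible O) (hObdd : Bornology.IsBounded O)
    (hσ : LipschitzOnWith Kσ σ (closure O)) (hσ1 : ContDiffOn ℝ 1 σ (closure O))
    (hb : LipschitzOnWith Kb b (closure O)) (h𝕎 : IsWienerMeasure 𝕎)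
    (hXL : ∀ N w, IsReflectedSolution O σ b x₀ (polygonal N w) (X N w) (L N w))
    (hP : IsWeakLimitPoint (fun N => approxLaw 𝕎 N (X N) (L N)) P)
    (hH : ContDiff ℝ 2 H)
    (hn : ∀ x ∈ frontier O, ∀ n ∈ inwardNormals O x, ∀ p, 0 ≤ fderiv ℝ H (x, p) (n, 0))
    {ρ : ℝ} (hρ : ∀ z, ρ < ‖z.2‖ → H z = 0) {F : PathSpace r O → ℝ} (hF : Continuous F)
    (hF0 : ∀ ω, 0 ≤ F ω) (hF1 : ∀ ω, F ω ≤ 1) {s t : ℝ≥0} (hst : s ≤ t) :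
    0 ≤ ∫ ω, F (stopTriple s ω) * liftIncrement σ b H s t ω ∂(P : Measure (PathSpace r O)) := by
  obtain ⟨S, hS1, hS2⟩ := exists_bound_of_cutoff hO hObdd hσ1 hb.continuousOn hH hρ
  have hgenc := continuousOn_liftGen hO hσ1 hb.continuousOn hH
  set u : ℝ≥0 → ℕ → ℝ≥0 := fun s n => ((⌈s * 2 ^ n⌉₊ : ℕ) : ℝ≥0) / 2 ^ n with hu
  have hulim : ∀ s, Tendsto (u s) atTop (𝓝 s) := tendsto_dyadic_ceil
  have hudist : Tendsto (fun n => |(u t n : ℝ) - u s n|) atTop (𝓝 |(t : ℝ) - s|) :=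
    (((NNReal.continuous_coe.tendsto _).comp (hulim t)).sub
      ((NNReal.continuous_coe.tendsto _).comp (hulim s))).abs
  have hSnn : (PathSpace r O → 0 ≤ S) := fun ω =>
    (abs_nonneg _).trans (hS1 _ (liftPath_mem ω 0))
  refine ge_of_tendsto (tendsto_integral_filter_of_dominated_convergence
    (F := fun n ω => F (stopTriple (u s n) ω) * liftIncrement σ b H (u s n) (u t n) ω)
    (l := atTop) (fun _ => 2 * S + S * (|(t : ℝ) - s| + 1)) ?_ ?_ (integrable_const _) ?_) ?_
  · refine Eventually.of_forall fun n => ?_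
    exact ((hF.comp (continuous_stopTriple _)).mul
      (continuous_liftIncrement hgenc hH.continuous _ _)).aestronglyMeasurable
  · filter_upwards [hudist.eventually (gt_mem_nhds (lt_add_one _))] with n hn
    refine ae_of_all _ fun ω => ?_
    rw [norm_mul]
    refine (mul_le_of_le_one_left (norm_nonneg _) ?_).trans
      ((abs_liftIncrement_le hS1 hS2 _ _ ω).trans ?_)
    · rw [Real.norm_of_nonneg (hF0 _)]; exact hF1 _
    · have := hSnn ω
      gcongr
  · refine ae_of_all _ fun ω => Tendsto.mul ?_ ?_
    -- The test functional moves with the approximating time as well; the stopped trajectory depends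
    -- continuously on the stopping time.
    · exact ((hF.comp (continuous_stopTriple_uncurry.comp (Continuous.prodMk_left ω))).tendsto
        s).comp (hulim s)
    · have hp : ∀ s, Tendsto (fun n => H (liftPath ω (u s n))) atTop (𝓝 (H (liftPath ω s))) :=
        fun s => ((hH.continuous.comp (continuous_liftPath.comp
          (Continuous.prodMk_right ω))).tendsto s).comp (hulim s)
      have hi : ∀ s, Tendsto (fun n => ∫ v in (0 : ℝ)..(u s n), liftGen O σ b H (liftPath ω v.toNNReal))
          atTop (𝓝 (∫ v in (0 : ℝ)..s, liftGen O σ b H (liftPath ω v.toNNReal))) := fun s =>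
        ((intervalIntegral.continuous_primitive
          (fun a b => intervalIntegrable_liftGen_liftPath hgenc ω a b) 0).tendsto (s : ℝ)).comp
            ((NNReal.continuous_coe.tendsto _).comp (hulim s))
      have e : ∀ s t : ℝ≥0, liftIncrement σ b H s t ω = H (liftPath ω t) - H (liftPath ω s) -
          ((∫ v in (0 : ℝ)..t, liftGen O σ b H (liftPath ω v.toNNReal)) -
            ∫ v in (0 : ℝ)..s, liftGen O σ b H (liftPath ω v.toNNReal)) := fun s t => by
        rw [liftIncrement, intervalIntegral.integral_interval_sub_left
          (intervalIntegrable_liftGen_liftPath hgenc ω _ _)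
          (intervalIntegrable_liftGen_liftPath hgenc ω _ _)]
      simp_rw [e]
      exact ((hp t).sub (hp s)).sub ((hi t).sub (hi s))
  · refine Eventually.of_forall fun n => ?_
    refine integral_liftIncrement_dyadic_nonneg hO hObdd hσ hσ1 hb h𝕎 hXL hP hH hn hρ hF hF0 hF1
      n _ _ (Nat.ceil_mono ?_)
    gcongr

end Limit

end WongZakai

namespace WongZakai

/-! ### Generator bounds and smooth cutoffs. -/

section Cutoff

variable {d r : ℕ}

local notation "𝔼" => EuclideanSpace ℝ (Fin d)
local notation "𝔽" => EuclideanSpace ℝ (Fin r)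
local notation "ℂ₀" => C(ℝ≥0, EuclideanSpace ℝ (Fin r))
local notation "𝕊" => EuclideanSpace ℝ (Fin d) × (EuclideanSpace ℝ (Fin d) × EuclideanSpace ℝ (Fin r))

variable {O : Set (EuclideanSpace ℝ (Fin d))}
  {σ : EuclideanSpace ℝ (Fin d) → EuclideanSpace ℝ (Fin r) →L[ℝ] EuclideanSpace ℝ (Fin d)}
  {b : EuclideanSpace ℝ (Fin d) → EuclideanSpace ℝ (Fin d)}
  {H : EuclideanSpace ℝ (Fin d) × (EuclideanSpace ℝ (Fin d) × EuclideanSpace ℝ (Fin r)) → ℝ}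

lemma liftGen_congr {H' : 𝕊 → ℝ} {z : 𝕊} (h : H =ᶠ[𝓝 z] H') :
    liftGen O σ b H z = liftGen O σ b H' z := by
  have h1 : gradNoise σ H =ᶠ[𝓝 z] gradNoise σ H' := by
    filter_upwards [h.fderiv (𝕜 := ℝ)] with z' hz'
    rw [gradNoise, gradNoise, hz']
  rw [liftGen, liftGen, hessNoise, hessNoise, h1.fderivWithin_eq_of_nhds, h.fderiv_eq]

lemma hasFDerivWithinAt_liftDiffusion (hσ1 : ContDiffOn ℝ 1 σ (closure O)) {z : 𝕊}
    (hz : z ∈ closure O ×ˢ (univ : Set (𝔼 × 𝔽))) :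
    HasFDerivWithinAt (liftDiffusion σ)
      ((ContinuousLinearMap.compL ℝ 𝔽 𝔼 𝕊 (diagIncl d r)).comp
        ((fderivWithin ℝ σ (closure O) z.1).comp (ContinuousLinearMap.fst ℝ 𝔼 (𝔼 × 𝔽))))
      (closure O ×ˢ univ) z := by
  have h1 : HasFDerivWithinAt σ (fderivWithin ℝ σ (closure O) z.1) (closure O) z.1 :=
    (hσ1.differentiableOn one_ne_zero z.1 hz.1).hasFDerivWithinAt
  have h2 := h1.comp z (hasFDerivWithinAt_fst (s := closure O ×ˢ (univ : Set (𝔼 × 𝔽))))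
    fun z hz => hz.1
  exact ((ContinuousLinearMap.compL ℝ 𝔽 𝔼 𝕊 (diagIncl d r)).hasFDerivAt.comp_hasFDerivWithinAt z
    h2).add_const _

/-- The generator is bounded on functions with bounded derivatives up to order two. -/
lemma exists_liftGen_bound (hO : IsAdmissible O) (hObdd : Bornology.IsBounded O)
    (hσ1 : ContDiffOn ℝ 1 σ (closure O)) (hb : ContinuousOn b (closure O)) :
    ∃ B : ℝ, 0 ≤ B ∧ ∀ (H : 𝕊 → ℝ) (C : ℝ), 0 ≤ C → ContDiff ℝ 2 H →
      (∀ k : ℕ, k ≤ 2 → ∀ z, ‖iteratedFDeriv ℝ k H z‖ ≤ C) →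
      ∀ z ∈ closure O ×ˢ univ, |liftGen O σ b H z| ≤ B * C := by
  have hK : IsCompact (closure O) := hObdd.isCompact_closure
  -- The lifted coefficient depends on the first component only, so the bound at `(x, 0)` is valid
  -- everywhere over `x`.
  obtain ⟨S₀, hS₀⟩ := hK.exists_bound_of_continuousOn (f := fun x => liftDiffusion σ ((x, 0) : 𝕊))
    ((contDiffOn_liftDiffusion hσ1).continuousOn.comp (by fun_prop) fun x hx => ⟨hx, mem_univ _⟩)
  obtain ⟨S₁, hS₁⟩ := hK.exists_bound_of_continuousOn
    (hσ1.continuousOn_fderivWithin (uniqueDiffOn_closure hO) le_rfl)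
  obtain ⟨S₂, hS₂⟩ := hK.exists_bound_of_continuousOn hb
  refine ⟨1 / 2 * (r * (2 * (|S₁| * |S₀| + |S₀| * |S₀|))) + |S₂|, by positivity,
    fun H C hC hH hbd z hz => ?_⟩
  have hD1 : ‖fderiv ℝ H z‖ ≤ C := by
    rw [← norm_iteratedFDeriv_one]; exact hbd 1 one_le_two z
  have hD2 : ‖fderiv ℝ (fderiv ℝ H) z‖ ≤ C := by
    rw [← norm_iteratedFDeriv_one, norm_iteratedFDeriv_fderiv]; exact hbd 2 le_rfl z
  have hs0 : ‖liftDiffusion σ z‖ ≤ |S₀| := (hS₀ z.1 hz.1).trans (le_abs_self _)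
  have hs1 : ‖fderivWithin ℝ σ (closure O) z.1‖ ≤ |S₁| := (hS₁ z.1 hz.1).trans (le_abs_self _)
  have hc : HasFDerivWithinAt (fderiv ℝ H) (fderiv ℝ (fderiv ℝ H) z)
      (closure O ×ˢ (univ : Set (𝔼 × 𝔽))) z :=
    (((hH.fderiv_right (m := 1) (by norm_num)).differentiable one_ne_zero z).hasFDerivAt).hasFDerivWithinAt
  have hder := (hc.clm_comp (hasFDerivWithinAt_liftDiffusion hσ1 hz)).fderivWithin
    (uniqueDiffOn_closure_prod hO z hz)
  have hhess : ‖hessNoise O σ H z‖ ≤ 2 * (|S₁| * |S₀| + |S₀| * |S₀|) * C := by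
    refine ContinuousLinearMap.opNorm_le_bound₂ _ (by positivity) fun v u => ?_
    -- Product rule: the first term carries the derivative of σ along the noise, the second the
    -- Hessian of `H`.
    have e : hessNoise O σ H z v u =
        fderiv ℝ H z (diagIncl d r (fderivWithin ℝ σ (closure O) z.1 (liftDiffusion σ z v).1 u)) +
        fderiv ℝ (fderiv ℝ H) z (liftDiffusion σ z v) (liftDiffusion σ z u) := by
      rw [hessNoise]
      change fderivWithin ℝ (fun y => (fderiv ℝ H y).comp (liftDiffusion σ y))
        (closure O ×ˢ univ) z (liftDiffusion σ z v) u = _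
      rw [hder]; rfl
    have hv := (liftDiffusion σ z).le_of_opNorm_le hs0 v
    have hu := (liftDiffusion σ z).le_of_opNorm_le hs0 u
    have hv1 : ‖(liftDiffusion σ z v).1‖ ≤ |S₀| * ‖v‖ := (norm_fst_le _).trans hv
    have h1 := (fderiv ℝ H z).le_of_opNorm_le_of_le hD1 (le_of_eq_of_le (norm_diagIncl_apply _)
      ((fderivWithin ℝ σ (closure O) z.1).le_of_opNorm₂_le_of_le hs1 hv1 (le_refl ‖u‖)))
    have h2 := (fderiv ℝ (fderiv ℝ H) z).le_of_opNorm₂_le_of_le hD2 hv hu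
    rw [e]
    refine (norm_add_le _ _).trans ((add_le_add h1 h2).trans ?_)
    have h3 : 0 ≤ (|S₁| * |S₀| + |S₀| * |S₀|) * C * ‖v‖ * ‖u‖ := by positivity
    linarith
  have h4 : |bilinTrace (hessNoise O σ H z)| ≤ r * (2 * (|S₁| * |S₀| + |S₀| * |S₀|) * C) :=
    (abs_bilinTrace_le _).trans (by gcongr)
  have h5 : |fderiv ℝ H z (liftDrift b z)| ≤ C * |S₂| :=
    (fderiv ℝ H z).le_of_opNorm_le_of_le hD1 (le_of_eq_of_le (norm_diagIncl_apply _)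
      ((hS₂ z.1 hz.1).trans (le_abs_self _)))
  rw [liftGen]
  refine (abs_add_le _ _).trans ?_
  rw [abs_mul, abs_of_pos (by norm_num : (0 : ℝ) < 1 / 2)]
  linarith

/-- Functions in `C²_b` are limits of functions with bounded support in the last variables, with
uniform bounds on the derivatives. -/
lemma IsC2b.exists_cutoff (hH : IsC2b H) : ∃ (Hn : ℕ → 𝕊 → ℝ) (C : ℝ), 0 ≤ C ∧
    (∀ n, ContDiff ℝ 2 (Hn n)) ∧ (∀ n, ∀ k : ℕ, k ≤ 2 → ∀ z, ‖iteratedFDeriv ℝ k (Hn n) z‖ ≤ C) ∧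
    (∀ n : ℕ, ∀ z : 𝕊, 2 * ((n : ℝ) + 1) < ‖z.2‖ → Hn n z = 0) ∧
    (∀ n : ℕ, ∀ z : 𝕊, ‖z.2‖ < (n : ℝ) + 1 → Hn n =ᶠ[𝓝 z] H) ∧
    ∀ n (x : 𝔼) (p : 𝔼 × 𝔽) (v : 𝔼), 0 ≤ fderiv ℝ H (x, p) (v, 0) →
      0 ≤ fderiv ℝ (Hn n) (x, p) (v, 0) := by
  -- The bump is composed with the scaling by `1 / (n + 1)`, a map of norm at most one, so the
  -- derivative bounds are uniform in `n`.
  let χ : ContDiffBump (0 : 𝔼 × 𝔽) := ⟨1, 2, one_pos, one_lt_two⟩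
  have hχ : ContDiff ℝ 2 χ := χ.contDiff
  have hχb : ∀ k : ℕ, k ≤ 2 → ∃ C, ∀ p, ‖iteratedFDeriv ℝ k χ p‖ ≤ C := fun k hk =>
    (χ.hasCompactSupport.iteratedFDeriv k).exists_bound_of_continuous
      (hχ.continuous_iteratedFDeriv (by exact_mod_cast hk))
  choose! B hB using hχb
  choose! A hA using hH.2
  obtain ⟨B₀, hB₀, hB₀'⟩ : ∃ B₀, 0 ≤ B₀ ∧ ∀ k : ℕ, k ≤ 2 → ∀ p, ‖iteratedFDeriv ℝ k χ p‖ ≤ B₀ := by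
    refine ⟨|B 0| + |B 1| + |B 2|, by positivity, fun k hk p => (hB k hk p).trans ?_⟩
    have h0 := le_abs_self (B k)
    have := abs_nonneg (B 0)
    have := abs_nonneg (B 1)
    have := abs_nonneg (B 2)
    interval_cases k <;> linarith
  obtain ⟨A₀, hA₀, hA₀'⟩ : ∃ A₀, 0 ≤ A₀ ∧ ∀ k : ℕ, k ≤ 2 → ∀ p, ‖iteratedFDeriv ℝ k H p‖ ≤ A₀ := by
    refine ⟨|A 0| + |A 1| + |A 2|, by positivity, fun k hk p => (hA k hk p).trans ?_⟩
    have h0 := le_abs_self (A k)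
    have := abs_nonneg (A 0)
    have := abs_nonneg (A 1)
    have := abs_nonneg (A 2)
    interval_cases k <;> linarith
  let g : ℕ → 𝕊 →L[ℝ] 𝔼 × 𝔽 := fun n => ((n : ℝ) + 1)⁻¹ • ContinuousLinearMap.snd ℝ 𝔼 (𝔼 × 𝔽)
  have hg1 : ∀ n, ‖g n‖ ≤ 1 := fun n => by
    refine (ContinuousLinearMap.opNorm_smul_le _ _).trans ?_
    have h1 : ‖((n : ℝ) + 1)⁻¹‖ ≤ 1 := by
      rw [Real.norm_of_nonneg (by positivity)]
      exact inv_le_one_of_one_le₀ (by linarith [Nat.cast_nonneg (α := ℝ) n])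
    exact mul_le_one₀ h1 (norm_nonneg _) (ContinuousLinearMap.norm_snd_le ℝ 𝔼 (𝔼 × 𝔽))
  have hgn : ∀ n (z : 𝕊), ‖g n z‖ = ‖z.2‖ / ((n : ℝ) + 1) := fun n z => by
    change ‖((n : ℝ) + 1)⁻¹ • z.2‖ = _
    rw [norm_smul, Real.norm_of_nonneg (by positivity), inv_mul_eq_div]
  have hχg : ∀ n, ContDiff ℝ 2 fun z => χ (g n z) := fun n => hχ.comp (g n).contDiff
  refine ⟨fun n z => H z * χ (g n z), 4 * (A₀ * B₀), by positivity, fun n => hH.1.mul (hχg n),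
    fun n k hk z => ?_, fun n z hz => ?_, fun n z hz => ?_, fun n x p v hv => ?_⟩
  · refine (norm_iteratedFDeriv_mul_le hH.1 (hχg n) z (by exact_mod_cast hk)).trans ?_
    have h1 : ∀ i ∈ Finset.range (k + 1), (k.choose i : ℝ) * ‖iteratedFDeriv ℝ i H z‖ *
        ‖iteratedFDeriv ℝ (k - i) (fun z => χ (g n z)) z‖ ≤ (k.choose i : ℝ) * (A₀ * B₀) := by
      intro i hi
      have hi' : i ≤ 2 := (Nat.lt_succ_iff.1 (Finset.mem_range.1 hi)).trans hk
      have hki : k - i ≤ 2 := (Nat.sub_le _ _).trans hk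
      have h2 : ‖iteratedFDeriv ℝ (k - i) (fun z => χ (g n z)) z‖ ≤ B₀ := by
        have e := (g n).iteratedFDeriv_comp_right (i := k - i) hχ z (by exact_mod_cast hki)
        change ‖iteratedFDeriv ℝ (k - i) (χ ∘ g n) z‖ ≤ B₀
        rw [e]
        refine (ContinuousMultilinearMap.norm_compContinuousLinearMap_le _ _).trans ?_
        refine (mul_le_of_le_one_right (norm_nonneg _) ?_).trans (hB₀' _ hki _)
        exact Finset.prod_le_one (fun _ _ => norm_nonneg _) fun _ _ => hg1 n
      rw [mul_assoc]
      have := hA₀' i hi' z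
      gcongr
    refine (Finset.sum_le_sum h1).trans ?_
    rw [← Finset.sum_mul]
    have h3 : ∑ i ∈ Finset.range (k + 1), (k.choose i : ℝ) ≤ 4 := by
      have := Nat.sum_range_choose k
      have h4 : (∑ i ∈ Finset.range (k + 1), (k.choose i : ℝ)) = 2 ^ k := by exact_mod_cast this
      rw [h4]
      calc (2 : ℝ) ^ k ≤ 2 ^ 2 := pow_le_pow_right₀ one_le_two hk
        _ = 4 := by norm_num
    gcongr
  · have : χ (g n z) = 0 := by
      refine χ.zero_of_le_dist ?_
      rw [dist_zero_right, hgn]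
      change (2 : ℝ) ≤ _
      rw [le_div_iff₀ (by positivity)]
      exact hz.le
    simp [this]
  · have hopen : IsOpen {z : 𝕊 | ‖z.2‖ < (n : ℝ) + 1} := isOpen_lt (by fun_prop) continuous_const
    filter_upwards [hopen.mem_nhds hz] with z' hz'
    have : χ (g n z') = 1 := by
      refine χ.one_of_mem_closedBall ?_
      rw [mem_closedBall_zero_iff, hgn]
      change _ ≤ (1 : ℝ)
      rw [div_le_one (by positivity)]
      exact (show ‖z'.2‖ < (n : ℝ) + 1 from hz').le
    simp [this]
  -- The cutoff ignores the first variable, so the derivative in the reflection direction is merely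
  -- multiplied by a nonnegative number.
  · have h1 : HasFDerivAt H (fderiv ℝ H (x, p)) (x, p) :=
      (hH.1.differentiable two_ne_zero _).hasFDerivAt
    have h2 : HasFDerivAt (fun z => χ (g n z)) ((fderiv ℝ χ (g n (x, p))).comp (g n)) (x, p) :=
      ((hχ.differentiable two_ne_zero _).hasFDerivAt).comp (x, p) (g n).hasFDerivAt
    change 0 ≤ fderiv ℝ (H * fun z => χ (g n z)) (x, p) (v, 0)
    rw [(h1.mul h2).fderiv]
    have h3 : g n (v, 0) = 0 := by simp [g]
    simp only [_root_.add_apply, _root_.smul_apply, ContinuousLinearMap.comp_apply, h3, map_zero,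
      smul_eq_mul, mul_zero, zero_add]
    exact mul_nonneg χ.nonneg hv

end Cutoff

end WongZakai

namespace WongZakai

/-! ### From continuous test functionals to the submartingale property for the filtration. -/

section Submartingale

variable {d r : ℕ}

local notation "𝔼" => EuclideanSpace ℝ (Fin d)
local notation "𝔽" => EuclideanSpace ℝ (Fin r)
local notation "ℂ₀" => C(ℝ≥0, EuclideanSpace ℝ (Fin r))
local notation "𝕊" => EuclideanSpace ℝ (Fin d) × (EuclideanSpace ℝ (Fin d) × EuclideanSpace ℝ (Fin r))

variable {O : Set (EuclideanSpace ℝ (Fin d))}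
  {σ : EuclideanSpace ℝ (Fin d) → EuclideanSpace ℝ (Fin r) →L[ℝ] EuclideanSpace ℝ (Fin d)}
  {b : EuclideanSpace ℝ (Fin d) → EuclideanSpace ℝ (Fin d)}
  {H : EuclideanSpace ℝ (Fin d) × (EuclideanSpace ℝ (Fin d) × EuclideanSpace ℝ (Fin r)) → ℝ}
  {x₀ : EuclideanSpace ℝ (Fin d)} {Kσ Kb : ℝ≥0}
  {𝕎 : Measure C(ℝ≥0, EuclideanSpace ℝ (Fin r))} [IsProbabilityMeasure 𝕎]
  {X : ℕ → C(ℝ≥0, EuclideanSpace ℝ (Fin r)) → C(ℝ≥0, closure O)}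
  {L : ℕ → C(ℝ≥0, EuclideanSpace ℝ (Fin r)) → C(ℝ≥0, EuclideanSpace ℝ (Fin d))}
  {P : ProbabilityMeasure (PathSpace r O)}

lemma IsC2b.exists_bound (hO : IsAdmissible O) (hObdd : Bornology.IsBounded O)
    (hσ1 : ContDiffOn ℝ 1 σ (closure O)) (hb : ContinuousOn b (closure O)) (hH : IsC2b H) :
    ∃ C : ℝ, (∀ z ∈ closure O ×ˢ univ, |H z| ≤ C) ∧
      ∀ z ∈ closure O ×ˢ univ, |liftGen O σ b H z| ≤ C := by
  obtain ⟨B, hB, hBH⟩ := exists_liftGen_bound (r := r) hO hObdd hσ1 hb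
  obtain ⟨Hn, C, hC, h1, h2, -, h4, -⟩ := hH.exists_cutoff
  have key : ∀ z : 𝕊, ∃ n, Hn n =ᶠ[𝓝 z] H := fun z => by
    obtain ⟨n, hn⟩ := exists_nat_gt ‖z.2‖
    exact ⟨n, h4 n z (by linarith)⟩
  refine ⟨C + B * C, fun z hz => ?_, fun z hz => ?_⟩
  · obtain ⟨n, hn⟩ := key z
    have := h2 n 0 zero_le_two z
    rw [norm_iteratedFDeriv_zero, hn.eq_of_nhds, Real.norm_eq_abs] at this
    have : 0 ≤ B * C := by positivity
    linarith
  · obtain ⟨n, hn⟩ := key z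
    rw [← liftGen_congr hn]
    have := hBH (Hn n) C hC (h1 n) (h2 n) z hz
    linarith

/-- The submartingale property, tested with continuous functionals of the past. -/
theorem integral_liftIncrement_nonneg (hO : IsAdmissible O) (hObdd : Bornology.IsBounded O)
    (hσ : LipschitzOnWith Kσ σ (closure O)) (hσ1 : ContDiffOn ℝ 1 σ (closure O))
    (hb : LipschitzOnWith Kb b (closure O)) (h𝕎 : IsWienerMeasure 𝕎)
    (hXL : ∀ N w, IsReflectedSolution O σ b x₀ (polygonal N w) (X N w) (L N w))
    (hP : IsWeakLimitPoint (fun N => approxLaw 𝕎 N (X N) (L N)) P) (hH : IsC2b H)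
    (hn : ∀ x ∈ frontier O, ∀ n ∈ inwardNormals O x, ∀ p, 0 ≤ fderiv ℝ H (x, p) (n, 0))
    {F : PathSpace r O → ℝ} (hF : Continuous F)
    (hF0 : ∀ ω, 0 ≤ F ω) (hF1 : ∀ ω, F ω ≤ 1) {s t : ℝ≥0} (hst : s ≤ t) :
    0 ≤ ∫ ω, F (stopTriple s ω) * liftIncrement σ b H s t ω ∂(P : Measure (PathSpace r O)) := by
  obtain ⟨B, hB, hBH⟩ := exists_liftGen_bound (r := r) hO hObdd hσ1 hb.continuousOn
  obtain ⟨Hn, C, hC, h1, h2, h3, h4, h5⟩ := hH.exists_cutoff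
  have hgenc := fun n => continuousOn_liftGen hO hσ1 hb.continuousOn (h1 n)
  have hb1 : ∀ n, ∀ z ∈ closure O ×ˢ (univ : Set (𝔼 × 𝔽)), |Hn n z| ≤ C + B * C := fun n z _ => by
    have := h2 n 0 zero_le_two z
    rw [norm_iteratedFDeriv_zero, Real.norm_eq_abs] at this
    have : 0 ≤ B * C := by positivity
    linarith
  have hb2 : ∀ n, ∀ z ∈ closure O ×ˢ (univ : Set (𝔼 × 𝔽)), |liftGen O σ b (Hn n) z| ≤ C + B * C :=
    fun n z hz => (hBH (Hn n) C hC (h1 n) (h2 n) z hz).trans (by linarith)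
  refine ge_of_tendsto (tendsto_integral_of_dominated_convergence
    (F := fun n ω => F (stopTriple s ω) * liftIncrement σ b (Hn n) s t ω)
    (fun _ => 2 * (C + B * C) + (C + B * C) * |(t : ℝ) - s|) (fun n => ?_) (integrable_const _)
    (fun n => ae_of_all _ fun ω => ?_) (ae_of_all _ fun ω => ?_)) (Eventually.of_forall fun n =>
      integral_liftIncrement_nonneg_of_cutoff hO hObdd hσ hσ1 hb h𝕎 hXL hP (h1 n)
        (fun x hx m hm p => h5 n x p m (hn x hx m hm p)) (h3 n) hF hF0 hF1 hst)
  · exact ((hF.comp (continuous_stopTriple s)).mul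
      (continuous_liftIncrement (hgenc n) (h1 n).continuous s t)).aestronglyMeasurable
  · rw [norm_mul]
    refine (mul_le_of_le_one_left (norm_nonneg _) ?_).trans
      (abs_liftIncrement_le (hb1 n) (hb2 n) s t ω)
    rw [Real.norm_of_nonneg (hF0 _)]; exact hF1 _
  -- Each trajectory is bounded on `[0, t]`, so from some `n` on the cutoff function agrees with `H`
  -- near it and the two increments coincide.
  · refine tendsto_const_nhds.mul (tendsto_nhds_of_eventually_eq ?_)
    have hc : Continuous fun u : ℝ≥0 => ‖(liftPath ω u).2‖ :=
      ((continuous_liftPath.comp (Continuous.prodMk_right ω)).snd).norm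
    obtain ⟨R, hR⟩ := (isCompact_Icc (a := (0 : ℝ≥0)) (b := t)).exists_bound_of_continuousOn
      hc.continuousOn
    obtain ⟨n₀, hn₀⟩ := exists_nat_gt R
    filter_upwards [eventually_ge_atTop n₀] with n hnn
    have heq : ∀ u ≤ t, Hn n =ᶠ[𝓝 (liftPath ω u)] H := fun u hu => by
      refine h4 n _ ?_
      have := hR u ⟨zero_le, hu⟩
      rw [norm_norm] at this
      have : (n₀ : ℝ) ≤ n := by exact_mod_cast hnn
      linarith
    unfold liftIncrement
    rw [(heq t le_rfl).eq_of_nhds, (heq s hst).eq_of_nhds]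
    congr 1
    refine intervalIntegral.integral_congr fun u hu => ?_
    rw [uIcc_of_le (by exact_mod_cast hst)] at hu
    exact liftGen_congr (heq _ (Real.toNNReal_le_iff_le_coe.2 hu.2))

lemma measurable_stopPath_comp {Ω : Type*} {m : MeasurableSpace Ω} {q : ℕ} {t : ℝ≥0}
    {θ : Ω → C(ℝ≥0, EuclideanSpace ℝ (Fin q))} (h : ∀ u ≤ t, Measurable fun ω => θ ω u) :
    Measurable fun ω => stopPath t (θ ω) :=
  measurableEmbedding_denseEval.measurable_comp_iff.1
    (measurable_pi_lambda _ fun _ => h _ (min_le_right _ _))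

/-- Composition with the inclusion of `K` is inducing on path spaces, so the Borel field is pulled
back from paths in the full space. -/
lemma measurable_stopPath_comp_subtype {Ω : Type*} {m : MeasurableSpace Ω} {t : ℝ≥0} {K : Set 𝔼}
    {θ : Ω → C(ℝ≥0, K)} (h : ∀ u ≤ t, Measurable fun ω => θ ω u) :
    Measurable fun ω => stopPath t (θ ω) := by
  have h1 := ContinuousMap.isInducing_postcomp (X := ℝ≥0) (⟨Subtype.val, continuous_subtype_val⟩ : C(K, 𝔼))
    Topology.IsInducing.subtypeVal
  have h2 : pathMeasurableSpace K = (pathMeasurableSpace 𝔼).comap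
      (ContinuousMap.comp (⟨Subtype.val, continuous_subtype_val⟩ : C(K, 𝔼))) := by
    change borel _ = (borel _).comap _
    rw [h1.eq_induced]
    exact borel_comap
  rw [h2, measurable_comap_iff]
  exact measurable_stopPath_comp (θ := fun ω => ContinuousMap.comp ⟨Subtype.val, continuous_subtype_val⟩ (θ ω))
    fun u hu => measurable_subtype_coe.comp (h u hu)

lemma measurable_eval_of_le {t u : ℝ≥0} (hu : u ≤ t) : Measurable[pathFiltration r O t]
    fun ω : PathSpace r O => (ω.1 u, ω.2.1 u, ω.2.2 u) := by
  rw [measurable_iff_comap_le]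
  exact le_iSup₂_of_le (f := fun j (_ : j ≤ t) => MeasurableSpace.comap
      (fun ω : PathSpace r O => (ω.1 j, ω.2.1 j, ω.2.2 j)) inferInstance) u hu le_rfl

lemma measurable_stopTriple (t : ℝ≥0) :
    Measurable[pathFiltration r O t] (stopTriple (r := r) (O := O) t) := by
  refine Measurable.prodMk (m := pathFiltration r O t) ?_
    (Measurable.prodMk (m := pathFiltration r O t) ?_ ?_)
  · exact measurable_stopPath_comp_subtype fun u hu => measurable_fst.comp (measurable_eval_of_le hu)
  · exact measurable_stopPath_comp fun u hu =>
      (measurable_fst.comp measurable_snd).comp (measurable_eval_of_le hu)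
  · exact measurable_stopPath_comp fun u hu =>
      (measurable_snd.comp measurable_snd).comp (measurable_eval_of_le hu)

/-- Evaluations up to time `t` do not change under stopping at `t`. Events of the past are thus
events of the stopped trajectory, which the continuous test functionals can approximate. -/
lemma exists_preimage_stopTriple_eq {t : ℝ≥0} {A : Set (PathSpace r O)}
    (hA : MeasurableSet[pathFiltration r O t] A) :
    ∃ B, MeasurableSet B ∧ stopTriple t ⁻¹' B = A := by
  have hle : (pathFiltration r O t : MeasurableSpace (PathSpace r O)) ≤
      MeasurableSpace.comap (stopTriple t) inferInstance := by
    change (⨆ j ≤ t, MeasurableSpace.comap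
      (fun ω : PathSpace r O => (ω.1 j, ω.2.1 j, ω.2.2 j)) inferInstance) ≤ _
    refine iSup₂_le fun j hj => ?_
    have e : (fun ω : PathSpace r O => (ω.1 j, ω.2.1 j, ω.2.2 j)) =
        (fun ω : PathSpace r O => (ω.1 j, ω.2.1 j, ω.2.2 j)) ∘ stopTriple t := by
      funext ω
      simp [stopTriple, stopPath_apply, hj]
    rw [e, ← MeasurableSpace.comap_comp]
    refine MeasurableSpace.comap_mono ?_
    have := (stronglyMeasurable_eval (r := r) O j).measurable
    exact this.comap_le
  exact hle A hA

/-- Indicators of closed sets are pointwise limits of continuous functions with values in `[0, 1]`.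
A Borel set contains closed subsets whose complement in it has small mass, and a bounded `D` makes
the difference small. -/
theorem setIntegral_nonneg_of_forall_continuous {Ω S : Type*} [MeasurableSpace Ω]
    [TopologicalSpace S] [TopologicalSpace.PseudoMetrizableSpace S] [MeasurableSpace S]
    [BorelSpace S] {μ : Measure Ω} [IsFiniteMeasure μ] {θ : Ω → S} (hθ : Measurable θ) {D : Ω → ℝ}
    (hD : AEStronglyMeasurable D μ) {C : ℝ} (hC : ∀ ω, |D ω| ≤ C)
    (h : ∀ F : S → ℝ, Continuous F → (∀ y, 0 ≤ F y) → (∀ y, F y ≤ 1) → 0 ≤ ∫ ω, F (θ ω) * D ω ∂μ)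
    {B : Set S} (hB : MeasurableSet B) : 0 ≤ ∫ ω in θ ⁻¹' B, D ω ∂μ := by
  have hDi : Integrable D μ := .of_bound hD C (ae_of_all _ hC)
  have hclosed : ∀ K : Set S, IsClosed K → 0 ≤ ∫ ω in θ ⁻¹' K, D ω ∂μ := by
    intro K hK
    rw [← integral_indicator (hθ hK.measurableSet)]
    refine ge_of_tendsto (tendsto_integral_of_dominated_convergence
      (F := fun n ω => ((hK.apprSeq n (θ ω) : ℝ≥0) : ℝ) * D ω) (fun _ => C) (fun n => ?_)
      (integrable_const _) (fun n => ae_of_all _ fun ω => ?_) (ae_of_all _ fun ω => ?_))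
      (Eventually.of_forall fun n => h (fun y => ((hK.apprSeq n y : ℝ≥0) : ℝ))
        (NNReal.continuous_coe.comp (hK.apprSeq n).continuous) (fun y => NNReal.coe_nonneg _)
        fun y => by exact_mod_cast HasOuterApproxClosed.apprSeq_apply_le_one hK n y)
    · exact ((NNReal.continuous_coe.comp (hK.apprSeq n).continuous).measurable.comp
        hθ).aestronglyMeasurable.mul hD
    · rw [norm_mul]
      refine (mul_le_of_le_one_left (norm_nonneg _) ?_).trans (hC ω)
      rw [Real.norm_of_nonneg (NNReal.coe_nonneg _)]
      exact_mod_cast HasOuterApproxClosed.apprSeq_apply_le_one hK n _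
    · have h1 := (tendsto_pi_nhds.1 (HasOuterApproxClosed.tendsto_apprSeq hK)) (θ ω)
      have h2 := ((NNReal.continuous_coe.tendsto _).comp h1).mul_const (D ω)
      have e : (θ ⁻¹' K).indicator D ω =
          ((K.indicator (fun _ => (1 : ℝ≥0)) (θ ω) : ℝ≥0) : ℝ) * D ω := by
        by_cases hω : θ ω ∈ K
        · rw [indicator_of_mem hω, indicator_of_mem (show ω ∈ θ ⁻¹' K from hω)]; simp
        · rw [indicator_of_notMem hω, indicator_of_notMem (show ω ∉ θ ⁻¹' K from hω)]; simp
      rw [e]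
      exact h2
  refine le_of_forall_pos_le_add fun η hη => ?_
  have hC1 : (0 : ℝ) < η / (|C| + 1) := by positivity
  obtain ⟨K, hKB, hK, hlt⟩ := hB.exists_isClosed_sdiff_lt (measure_ne_top (μ.map θ) B)
    (ENNReal.ofReal_pos.2 hC1).ne'
  rw [Measure.map_apply hθ (hB.diff hK.measurableSet)] at hlt
  have h1 : ∫ ω in θ ⁻¹' B, D ω ∂μ = ∫ ω in θ ⁻¹' K, D ω ∂μ + ∫ ω in θ ⁻¹' (B \ K), D ω ∂μ := by
    rw [← setIntegral_union (disjoint_sdiff_right.preimage θ) (hθ (hB.diff hK.measurableSet))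
      hDi.integrableOn hDi.integrableOn, ← preimage_union, union_sdiff_cancel hKB]
  have h2 : ‖∫ ω in θ ⁻¹' (B \ K), D ω ∂μ‖ ≤ C * μ.real (θ ⁻¹' (B \ K)) :=
    norm_setIntegral_le_of_norm_le_const (measure_lt_top _ _) fun ω _ => hC ω
  have h3 : μ.real (θ ⁻¹' (B \ K)) ≤ η / (|C| + 1) := by
    rw [Measure.real]
    exact ENNReal.toReal_le_of_le_ofReal hC1.le hlt.le
  have h4 : C * μ.real (θ ⁻¹' (B \ K)) ≤ η := by
    calc _ ≤ (|C| + 1) * (η / (|C| + 1)) := by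
          refine mul_le_mul ((le_abs_self C).trans (by linarith)) h3 measureReal_nonneg (by positivity)
      _ = η := by field_simp
  have h5 := hclosed K hK
  rw [Real.norm_eq_abs] at h2
  have := (abs_le.1 h2).1
  linarith

/-- The submartingale property of `H(X, X - L, W)` in excess of its generator. -/
theorem submartingale_lift (hO : IsAdmissible O) (hObdd : Bornology.IsBounded O)
    (hσ : LipschitzOnWith Kσ σ (closure O)) (hσ1 : ContDiffOn ℝ 1 σ (closure O))
    (hb : LipschitzOnWith Kb b (closure O)) (h𝕎 : IsWienerMeasure 𝕎)
    (hXL : ∀ N w, IsReflectedSolution O σ b x₀ (polygonal N w) (X N w) (L N w))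
    (hP : IsWeakLimitPoint (fun N => approxLaw 𝕎 N (X N) (L N)) P) (hH : IsC2b H)
    (hn : ∀ x ∈ frontier O, ∀ n ∈ inwardNormals O x, ∀ p, 0 ≤ fderiv ℝ H (x, p) (n, 0)) :
    Submartingale (fun (t : ℝ≥0) (ω : PathSpace r O) => H (liftPath ω t) -
      ∫ u in (0 : ℝ)..t, liftGen O σ b H (liftPath ω u.toNNReal)) (pathFiltration r O)
      (P : Measure (PathSpace r O)) := by
  obtain ⟨C, hC1, hC2⟩ := hH.exists_bound hO hObdd hσ1 hb.continuousOn
  have hgenc := continuousOn_liftGen hO hσ1 hb.continuousOn hH.1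
  have hMc : ∀ t : ℝ≥0, Continuous fun ω : PathSpace r O => H (liftPath ω t) -
      ∫ u in (0 : ℝ)..t, liftGen O σ b H (liftPath ω u.toNNReal) := fun t =>
    (hH.1.continuous.comp (continuous_liftPath.comp (Continuous.prodMk_left t))).sub
      (intervalIntegral.continuous_parametric_intervalIntegral_of_continuous'
        (continuous_liftGen_liftPath hgenc) _ _)
  refine submartingale_of_setIntegral_le (fun t => ?_) (fun t => ?_) fun s t hst A hA => ?_
  -- Adaptedness: the process at time `t` is a continuous function of the trajectory stopped at `t`.
  · have e : (fun ω : PathSpace r O => H (liftPath ω t) -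
        ∫ u in (0 : ℝ)..t, liftGen O σ b H (liftPath ω u.toNNReal)) =
        (fun ω : PathSpace r O => H (liftPath ω t) -
        ∫ u in (0 : ℝ)..t, liftGen O σ b H (liftPath ω u.toNNReal)) ∘ stopTriple t := by
      have hst : ∀ (ω : PathSpace r O), ∀ u ≤ t, liftPath (stopTriple t ω) u = liftPath ω u := by
        intro ω u hu
        simp [liftPath, stopTriple, stopPath_apply, hu]
      funext ω
      simp only [Function.comp_apply]
      rw [hst ω t le_rfl]
      congr 1
      refine intervalIntegral.integral_congr fun u hu => ?_
      rw [uIcc_of_le (NNReal.coe_nonneg t)] at hu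
      rw [hst ω _ (Real.toNNReal_le_iff_le_coe.2 hu.2)]
    rw [e]
    exact ((hMc t).measurable.comp (measurable_stopTriple t)).stronglyMeasurable
  · refine Integrable.of_bound (hMc t).aestronglyMeasurable (C + C * |(t : ℝ) - 0|)
      (ae_of_all _ fun ω => ?_)
    refine (norm_sub_le _ _).trans (add_le_add (hC1 _ (liftPath_mem ω t)) ?_)
    exact intervalIntegral.norm_integral_le_of_norm_le_const fun u _ => hC2 _ (liftPath_mem ω _)
  · obtain ⟨B, hB, rfl⟩ := exists_preimage_stopTriple_eq hA
    have hint : ∀ t : ℝ≥0, Integrable (fun ω : PathSpace r O => H (liftPath ω t) -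
        ∫ u in (0 : ℝ)..t, liftGen O σ b H (liftPath ω u.toNNReal)) (P : Measure (PathSpace r O)) :=
      fun t => by
      refine Integrable.of_bound (hMc t).aestronglyMeasurable (C + C * |(t : ℝ) - 0|)
        (ae_of_all _ fun ω => ?_)
      refine (norm_sub_le _ _).trans (add_le_add (hC1 _ (liftPath_mem ω t)) ?_)
      exact intervalIntegral.norm_integral_le_of_norm_le_const fun u _ => hC2 _ (liftPath_mem ω _)
    rw [← sub_nonneg, ← integral_sub (hint t).integrableOn (hint s).integrableOn]
    have e : ∀ ω : PathSpace r O, (H (liftPath ω t) -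
        ∫ u in (0 : ℝ)..t, liftGen O σ b H (liftPath ω u.toNNReal)) - (H (liftPath ω s) -
        ∫ u in (0 : ℝ)..s, liftGen O σ b H (liftPath ω u.toNNReal)) =
        liftIncrement σ b H s t ω := fun ω => by
      rw [liftIncrement, ← intervalIntegral.integral_interval_sub_left
          (intervalIntegrable_liftGen_liftPath hgenc ω 0 t)
          (intervalIntegrable_liftGen_liftPath hgenc ω 0 s)]
      ring
    simp_rw [e]
    exact setIntegral_nonneg_of_forall_continuous (continuous_stopTriple s).measurable
      (continuous_liftIncrement hgenc hH.1.continuous s t).aestronglyMeasurable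
      (abs_liftIncrement_le hC1 hC2 s t)
      (fun F hF hF0 hF1 => integral_liftIncrement_nonneg hO hObdd hσ hσ1 hb h𝕎 hXL hP hH hn hF hF0
        hF1 hst) hB

end Submartingale

end WongZakai

/-! ### Identification of the generators and the final deduction. -/

namespace WongZakai

lemma IsC2b.comp_clm {E G : Type*} [NormedAddCommGroup E] [NormedSpace ℝ E] [NormedAddCommGroup G]
    [NormedSpace ℝ G] {f : E → ℝ} (hf : IsC2b f) (g : G →L[ℝ] E) : IsC2b fun x => f (g x) := by
  refine ⟨hf.1.comp g.contDiff, fun k hk => ?_⟩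
  obtain ⟨C, hC⟩ := hf.2 k hk
  refine ⟨C * ‖g‖ ^ k, fun x => ?_⟩
  have e := g.iteratedFDeriv_comp_right (i := k) hf.1 x (by exact_mod_cast hk)
  change ‖iteratedFDeriv ℝ k (f ∘ g) x‖ ≤ _
  rw [e]
  refine (ContinuousMultilinearMap.norm_compContinuousLinearMap_le _ _).trans ?_
  rw [Finset.prod_const, Finset.card_univ, Fintype.card_fin]
  gcongr
  exact hC _

lemma IsC2b.neg {E : Type*} [NormedAddCommGroup E] [NormedSpace ℝ E] {f : E → ℝ} (hf : IsC2b f) :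
    IsC2b fun x => -f x := by
  refine ⟨hf.1.neg, fun k hk => ?_⟩
  obtain ⟨C, hC⟩ := hf.2 k hk
  refine ⟨C, fun x => ?_⟩
  have : iteratedFDeriv ℝ k (fun x => -f x) x = -iteratedFDeriv ℝ k f x :=
    iteratedFDeriv_neg_apply
  rw [this, norm_neg]
  exact hC x

section Generators

variable {d r : ℕ}

local notation "𝔼" => EuclideanSpace ℝ (Fin d)
local notation "𝔽" => EuclideanSpace ℝ (Fin r)
local notation "𝕊" => EuclideanSpace ℝ (Fin d) × (EuclideanSpace ℝ (Fin d) × EuclideanSpace ℝ (Fin r))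

variable {O : Set (EuclideanSpace ℝ (Fin d))}
  {σ : EuclideanSpace ℝ (Fin d) → EuclideanSpace ℝ (Fin r) →L[ℝ] EuclideanSpace ℝ (Fin d)}
  {b : EuclideanSpace ℝ (Fin d) → EuclideanSpace ℝ (Fin d)}
  {H : EuclideanSpace ℝ (Fin d) × (EuclideanSpace ℝ (Fin d) × EuclideanSpace ℝ (Fin r)) → ℝ}

lemma liftGen_neg (hO : IsAdmissible O) {z : 𝕊} (hz : z ∈ closure O ×ˢ (univ : Set (𝔼 × 𝔽))) : liftGen O σ b (fun z => -H z) z = -liftGen O σ b H z := by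
  have hU := uniqueDiffOn_closure_prod hO z hz
  have h1 : gradNoise σ (fun z => -H z) = fun z => -gradNoise σ H z := by
    funext z
    rw [gradNoise, gradNoise, fderiv_fun_neg, ContinuousLinearMap.neg_comp]
  have h2 : hessNoise O σ (fun z => -H z) z = -hessNoise O σ H z := by
    rw [hessNoise, hessNoise, h1]
    rw [fderivWithin_fun_neg hU]
    rfl
  rw [liftGen, liftGen, h2, fderiv_fun_neg]
  simp only [bilinTrace, _root_.neg_apply, Finset.sum_neg_distrib]
  ring

lemma hasFDerivWithinAt_gradNoise_apply (hσ1 : ContDiffOn ℝ 1 σ (closure O)) (hH : ContDiff ℝ 2 H)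
    (ξ : 𝔽) {z : 𝕊} (hz : z ∈ closure O ×ˢ (univ : Set (𝔼 × 𝔽))) :
    HasFDerivWithinAt (fun z => gradNoise σ H z ξ) ((ContinuousLinearMap.apply ℝ ℝ ξ).comp
      (fderivWithin ℝ (gradNoise σ H) (closure O ×ˢ univ) z)) (closure O ×ˢ univ) z :=
  (ContinuousLinearMap.apply ℝ ℝ ξ).hasFDerivAt.comp_hasFDerivWithinAt z
    ((contDiffOn_gradNoise hσ1 hH).differentiableOn one_ne_zero z hz).hasFDerivWithinAt

lemma dirDeriv_eq_fderiv {E : Type*} [NormedAddCommGroup E] [NormedSpace ℝ E] {S : Set E}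
    (hS : UniqueDiffOn ℝ S) {f : E → ℝ} (hf : ContDiff ℝ 2 f) (V : E → E) {x : E} (hx : x ∈ S) :
    dirDeriv S V f x = fderiv ℝ f x (V x) := by
  rw [dirDeriv, (hf.differentiable two_ne_zero x).fderivWithin (hS x hx)]

lemma fderiv_comp_clm_apply {E G : Type*} [NormedAddCommGroup E] [NormedSpace ℝ E]
    [NormedAddCommGroup G] [NormedSpace ℝ G] {f : E → ℝ} (hf : ContDiff ℝ 2 f) (g : G →L[ℝ] E)
    (x v : G) : fderiv ℝ (fun x => f (g x)) x v = fderiv ℝ f (g x) (g v) := by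
  have h : HasFDerivAt (fun x => f (g x)) ((fderiv ℝ f (g x)).comp g) x :=
    (hf.differentiable two_ne_zero (g x)).hasFDerivAt.comp x g.hasFDerivAt
  rw [h.fderiv]; rfl

/-- Both second-order terms differentiate the same function `k` of the first variable, once within
the closed domain and once within the lifted one; uniqueness of derivatives there identifies the
results. -/
lemma gen_eq_liftGen (hO : IsAdmissible O) (hσ1 : ContDiffOn ℝ 1 σ (closure O)) {f : 𝔼 → ℝ}
    (hf : ContDiff ℝ 2 f) {z : 𝕊} (hz : z.1 ∈ closure O) :
    gen O σ b f z.1 = liftGen O σ b (fun z => f z.1) z := by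
  have hK := uniqueDiffOn_closure hO
  have hz' : z ∈ closure O ×ˢ (univ : Set (𝔼 × 𝔽)) := ⟨hz, mem_univ _⟩
  have hH : ContDiff ℝ 2 fun z : 𝕊 => f z.1 := hf.comp contDiff_fst
  have hfd : ∀ (z : 𝕊) v, fderiv ℝ (fun z : 𝕊 => f z.1) z v = fderiv ℝ f z.1 v.1 := fun z v =>
    fderiv_comp_clm_apply hf (ContinuousLinearMap.fst ℝ 𝔼 (𝔼 × 𝔽)) z v
  have hk : ∀ i : Fin r, DifferentiableOn ℝ (fun x => fderiv ℝ f x (σ x (EuclideanSpace.single i 1)))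
      (closure O) := fun i =>
    (((hf.fderiv_right (m := 1) (by norm_num)).contDiffOn).clm_apply
      (hσ1.clm_apply contDiffOn_const)).differentiableOn one_ne_zero
  rw [gen, liftGen, bilinTrace]
  congr 1
  · congr 1
    refine Finset.sum_congr rfl fun i _ => ?_
    set k : 𝔼 → ℝ := fun x => fderiv ℝ f x (σ x (EuclideanSpace.single i 1)) with hkd
    have h1 : dirDeriv (closure O) (column σ i) (dirDeriv (closure O) (column σ i) f) z.1 =
        fderivWithin ℝ k (closure O) z.1 (column σ i z.1) := by
      rw [dirDeriv, fderivWithin_congr (fun x hx => dirDeriv_eq_fderiv hK hf _ hx)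
        (dirDeriv_eq_fderiv hK hf _ hz)]
      rfl
    have h2 : HasFDerivWithinAt (fun z : 𝕊 => k z.1) ((fderivWithin ℝ k (closure O) z.1).comp
        (ContinuousLinearMap.fst ℝ 𝔼 (𝔼 × 𝔽))) (closure O ×ˢ univ) z :=
      (hk i z.1 hz).hasFDerivWithinAt.comp z hasFDerivWithinAt_fst fun z hz => hz.1
    have h3 : (fun z : 𝕊 => gradNoise σ (fun z => f z.1) z (EuclideanSpace.single i 1)) =
        fun z : 𝕊 => k z.1 := by
      funext z
      rw [gradNoise, ContinuousLinearMap.comp_apply, hfd, liftDiffusion_apply]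
    have h4 := hasFDerivWithinAt_gradNoise_apply hσ1 hH (EuclideanSpace.single i 1) hz'
    rw [h3] at h4
    have h5 := (uniqueDiffOn_closure_prod hO z hz').eq h2 h4
    have h6 := DFunLike.congr_fun h5 (liftDiffusion σ z (EuclideanSpace.single i 1))
    rw [h1]
    rw [liftDiffusion_apply] at h6
    refine h6.trans ?_
    rw [← liftDiffusion_apply σ z]
    rfl
  · rw [dirDeriv_eq_fderiv hK hf _ hz, hfd]
    rfl

lemma genTilde_eq_liftGen (hO : IsAdmissible O) (hσ1 : ContDiffOn ℝ 1 σ (closure O))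
    {h : 𝔼 × 𝔽 → ℝ} (hh : ContDiff ℝ 2 h) (ℓ : 𝔼) {x : 𝔼} (hx : x ∈ closure O) (w : 𝔽) :
    genTilde O σ b (translate ℓ h) (x, w) = liftGen O σ b (fun z => h z.2) (x, (x - ℓ, w)) := by
  have hU : UniqueDiffOn ℝ (closure O ×ˢ (univ : Set 𝔽)) :=
    (uniqueDiffOn_closure hO).prod uniqueDiffOn_univ
  have hq : (x, w) ∈ closure O ×ˢ (univ : Set 𝔽) := ⟨hx, mem_univ _⟩
  have hz : ((x, (x - ℓ, w)) : 𝕊) ∈ closure O ×ˢ (univ : Set (𝔼 × 𝔽)) := ⟨hx, mem_univ _⟩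
  have hH : ContDiff ℝ 2 fun z : 𝕊 => h z.2 := hh.comp contDiff_snd
  have hfd : ∀ (z : 𝕊) v, fderiv ℝ (fun z : 𝕊 => h z.2) z v = fderiv ℝ h z.2 v.2 := fun z v =>
    fderiv_comp_clm_apply hh (ContinuousLinearMap.snd ℝ 𝔼 (𝔼 × 𝔽)) z v
  have hte : translate ℓ h = fun p => h (p - (ℓ, 0)) := by
    funext p; simp [translate, Prod.sub_def]
  have ht : ContDiff ℝ 2 (translate ℓ h) := by
    rw [hte]; exact hh.comp (contDiff_id.sub contDiff_const)
  have htd : ∀ p v, fderiv ℝ (translate ℓ h) p v = fderiv ℝ h (p.1 - ℓ, p.2) v := fun p v => by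
    have h1 : HasFDerivAt (fun p => h (p - (ℓ, 0))) _ p :=
      (hh.differentiable two_ne_zero (p - (ℓ, 0))).hasFDerivAt.comp p
        ((hasFDerivAt_id p).sub_const (ℓ, 0))
    rw [hte, h1.fderiv]; simp [Prod.sub_def]
  -- With the value of L frozen, this map pulls the lifted noise coefficient back to the first
  -- derivative of the translated function, and its derivative carries (V_i, e_i) to the lifted
  -- diffusion vector.
  let θ : 𝔼 × 𝔽 → 𝕊 := fun p => (p.1, (p.1 - ℓ, p.2))
  have hθ : HasFDerivWithinAt θ ((ContinuousLinearMap.fst ℝ 𝔼 𝔽).prod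
      ((ContinuousLinearMap.fst ℝ 𝔼 𝔽).prod (ContinuousLinearMap.snd ℝ 𝔼 𝔽)))
      (closure O ×ˢ univ) (x, w) :=
    hasFDerivWithinAt_fst.prodMk ((hasFDerivWithinAt_fst.sub_const ℓ).prodMk hasFDerivWithinAt_snd)
  rw [genTilde, liftGen, bilinTrace]
  congr 1
  · congr 1
    refine Finset.sum_congr rfl fun i _ => ?_
    have h1 : ∀ p ∈ closure O ×ˢ (univ : Set 𝔽),
        dirDeriv (closure O ×ˢ univ) (columnTilde σ i) (translate ℓ h) p =
        gradNoise σ (fun z => h z.2) (θ p) (EuclideanSpace.single i 1) := fun p hp => by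
      rw [dirDeriv_eq_fderiv hU ht _ hp, htd, gradNoise, ContinuousLinearMap.comp_apply, hfd,
        liftDiffusion_apply]
      rfl
    have hm : MapsTo θ (closure O ×ˢ (univ : Set 𝔽)) (closure O ×ˢ univ) :=
      fun p hp => ⟨hp.1, mem_univ _⟩
    have h2 := (hasFDerivWithinAt_gradNoise_apply hσ1 hH (EuclideanSpace.single i 1) hz).comp
      (x, w) hθ hm
    have h3 : fderivWithin ℝ (fun p => gradNoise σ (fun z => h z.2) (θ p) (EuclideanSpace.single i 1))
      (closure O ×ˢ univ) (x, w) = _ := h2.fderivWithin (hU _ hq)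
    rw [dirDeriv, fderivWithin_congr h1 (h1 _ hq), h3, hessNoise,
      ContinuousLinearMap.comp_apply, show ((ContinuousLinearMap.fst ℝ 𝔼 𝔽).prod
      ((ContinuousLinearMap.fst ℝ 𝔼 𝔽).prod (ContinuousLinearMap.snd ℝ 𝔼 𝔽)))
      (columnTilde σ i (x, w)) = liftDiffusion σ ((x, (x - ℓ, w)) : 𝕊) (EuclideanSpace.single i 1)
      by rw [liftDiffusion_apply]; rfl]
    rfl
  · rw [dirDeriv_eq_fderiv hU ht _ hq, htd, hfd]
    rfl

end Generators

end WongZakai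

theorem mainTheorem4 {d r : ℕ} (O : Set (EuclideanSpace ℝ (Fin d)))
    (hO : WongZakai.IsAdmissible O) (hObdd : Bornology.IsBounded O)
    (σ : EuclideanSpace ℝ (Fin d) → EuclideanSpace ℝ (Fin r) →L[ℝ] EuclideanSpace ℝ (Fin d))
    (b : EuclideanSpace ℝ (Fin d) → EuclideanSpace ℝ (Fin d))
    (hσLip : ∃ K : ℝ≥0, LipschitzOnWith K σ (closure O))
    (hσ : ContDiffOn ℝ 2 σ (closure O))
    (hb : ∃ K : ℝ≥0, LipschitzOnWith K b (closure O))
    (x₀ : EuclideanSpace ℝ (Fin d)) (hx₀ : x₀ ∈ closure O)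
    (𝕎 : Measure C(ℝ≥0, EuclideanSpace ℝ (Fin r))) [IsProbabilityMeasure 𝕎]
    (h𝕎 : WongZakai.IsWienerMeasure 𝕎)
    (X : ℕ → C(ℝ≥0, EuclideanSpace ℝ (Fin r)) → C(ℝ≥0, closure O))
    (L : ℕ → C(ℝ≥0, EuclideanSpace ℝ (Fin r)) → C(ℝ≥0, EuclideanSpace ℝ (Fin d)))
    (hXL : ∀ N w, WongZakai.IsReflectedSolution O σ b x₀ (WongZakai.polygonal N w) (X N w) (L N w))
    (P : ProbabilityMeasure (WongZakai.PathSpace r O))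
    (hP : WongZakai.IsWeakLimitPoint (fun N => WongZakai.approxLaw 𝕎 N (X N) (L N)) P) :
    (∀ h : EuclideanSpace ℝ (Fin d) × EuclideanSpace ℝ (Fin r) → ℝ, WongZakai.IsC2b h →
      Martingale
        (fun (t : ℝ≥0) (ω : WongZakai.PathSpace r O) =>
          h ((ω.1 t : EuclideanSpace ℝ (Fin d)) - ω.2.1 t, ω.2.2 t) -
            ∫ s in (0 : ℝ)..t,
              WongZakai.genTilde O σ b (WongZakai.translate (ω.2.1 s.toNNReal) h)
                ((ω.1 s.toNNReal : EuclideanSpace ℝ (Fin d)), ω.2.2 s.toNNReal))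
        (WongZakai.pathFiltration r O) (P : Measure (WongZakai.PathSpace r O))) ∧
    (∀ f : EuclideanSpace ℝ (Fin d) → ℝ, WongZakai.IsC2b f →
      (∀ x ∈ frontier O, ∀ n ∈ WongZakai.inwardNormals O x, 0 ≤ fderiv ℝ f x n) →
      Submartingale
        (fun (t : ℝ≥0) (ω : WongZakai.PathSpace r O) =>
          f (ω.1 t : EuclideanSpace ℝ (Fin d)) - f x₀ -
            ∫ s in (0 : ℝ)..t, WongZakai.gen O σ b f (ω.1 s.toNNReal : EuclideanSpace ℝ (Fin d)))
        (WongZakai.pathFiltration r O) (P : Measure (WongZakai.PathSpace r O))) := by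
  obtain ⟨Kσ, hσL⟩ := hσLip
  obtain ⟨Kb, hbL⟩ := hb
  have hσ1 : ContDiffOn ℝ 1 σ (closure O) := hσ.of_le one_le_two
  refine ⟨fun h hh => ?_, fun f hf hfn => ?_⟩
  · have hH : WongZakai.IsC2b fun z : EuclideanSpace ℝ (Fin d) × (EuclideanSpace ℝ (Fin d) ×
        EuclideanSpace ℝ (Fin r)) => h z.2 :=
      hh.comp_clm (ContinuousLinearMap.snd ℝ (EuclideanSpace ℝ (Fin d)) (EuclideanSpace ℝ (Fin d) ×
        EuclideanSpace ℝ (Fin r)))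
    -- The function does not see the reflected component, so the boundary condition holds with
    -- equality. Applying the submartingale property to the function and to its negative gives the
    -- martingale.
    have hn : ∀ (x : EuclideanSpace ℝ (Fin d)) (n : EuclideanSpace ℝ (Fin d))
        (p : EuclideanSpace ℝ (Fin d) × EuclideanSpace ℝ (Fin r)),
        fderiv ℝ (fun z : EuclideanSpace ℝ (Fin d) × (EuclideanSpace ℝ (Fin d) ×
        EuclideanSpace ℝ (Fin r)) => h z.2) (x, p) (n, 0) = 0 := fun x n p =>
      (WongZakai.fderiv_comp_clm_apply hh.1 (ContinuousLinearMap.snd ℝ (EuclideanSpace ℝ (Fin d))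
        (EuclideanSpace ℝ (Fin d) × EuclideanSpace ℝ (Fin r))) (x, p) (n, 0)).trans (by simp)
    have hsub := WongZakai.submartingale_lift hO hObdd hσL hσ1 hbL h𝕎 hXL hP hH
      fun x _ n _ p => (hn x n p).ge
    have hsup := (WongZakai.submartingale_lift hO hObdd hσL hσ1 hbL h𝕎 hXL hP hH.neg
      fun x _ n _ p => by rw [fderiv_fun_neg, _root_.neg_apply, hn, neg_zero]).neg
    have e : ∀ (ω : WongZakai.PathSpace r O) (s : ℝ),
        WongZakai.genTilde O σ b (WongZakai.translate (ω.2.1 s.toNNReal) h)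
          ((ω.1 s.toNNReal : EuclideanSpace ℝ (Fin d)), ω.2.2 s.toNNReal) =
        WongZakai.liftGen O σ b (fun z => h z.2) (WongZakai.liftPath ω s.toNNReal) := fun ω s =>
      WongZakai.genTilde_eq_liftGen hO hσ1 hh.1 _ (ω.1 s.toNNReal).2 _
    have e' : ∀ (ω : WongZakai.PathSpace r O) (s : ℝ),
        WongZakai.liftGen O σ b (fun z => -h z.2) (WongZakai.liftPath ω s.toNNReal) =
        -WongZakai.liftGen O σ b (fun z => h z.2) (WongZakai.liftPath ω s.toNNReal) := fun ω s =>
      WongZakai.liftGen_neg (H := fun z => h z.2) hO (WongZakai.liftPath_mem ω _)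
    simp_rw [e]
    refine martingale_iff.2 ⟨?_, hsub⟩
    simp only [e', intervalIntegral.integral_neg] at hsup
    refine Eq.subst (motive := fun Y => Supermartingale Y _ _) ?_ hsup
    funext t ω
    simp only [Pi.neg_apply, WongZakai.liftPath]
    ring
  · have hH : WongZakai.IsC2b fun z : EuclideanSpace ℝ (Fin d) × (EuclideanSpace ℝ (Fin d) ×
        EuclideanSpace ℝ (Fin r)) => f z.1 :=
      hf.comp_clm (ContinuousLinearMap.fst ℝ (EuclideanSpace ℝ (Fin d)) (EuclideanSpace ℝ (Fin d) ×
        EuclideanSpace ℝ (Fin r)))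
    have hsub := WongZakai.submartingale_lift hO hObdd hσL hσ1 hbL h𝕎 hXL hP hH
      fun x hx n hn p => (hfn x hx n hn).trans_eq
        (WongZakai.fderiv_comp_clm_apply hf.1 (ContinuousLinearMap.fst ℝ (EuclideanSpace ℝ (Fin d))
          (EuclideanSpace ℝ (Fin d) × EuclideanSpace ℝ (Fin r))) (x, p) (n, 0)).symm
    have e : ∀ (ω : WongZakai.PathSpace r O) (s : ℝ),
        WongZakai.gen O σ b f (ω.1 s.toNNReal : EuclideanSpace ℝ (Fin d)) =
        WongZakai.liftGen O σ b (fun z => f z.1) (WongZakai.liftPath ω s.toNNReal) := fun ω s =>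
      WongZakai.gen_eq_liftGen hO hσ1 hf.1 (z := WongZakai.liftPath ω s.toNNReal)
        (ω.1 s.toNNReal).2
    simp_rw [e]
    refine Eq.subst (motive := fun Y => Submartingale Y _ _) ?_
      (hsub.sub_martingale (martingale_const (WongZakai.pathFiltration r O)
        (P : Measure (WongZakai.PathSpace r O)) (f x₀)))
    funext t ω
    simp only [Pi.sub_apply, WongZakai.liftPath]
    ring
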